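/- A multiplicative distance function is a function $\Phi:\mathbb{C}[x]\to[0,\infty)$ that is continuous in the coefficients on polynomials of bounded degree and satisfies $\Phi(f)=0\iff f=0$, $\Phi(wf)=|w|\,\Phi(f)$ and $\Phi(fg)=\Phi(f)\Phi(g)$ for all $f,g\in\mathbb{C}[x]$, $w\in\mathbb{C}$. Its root function is $\phi(\gamma)=\Phi(x-\gamma)$ for $\gamma\in\mathbb{C}$, and its real degree $N$ moment function is \[ F_N(\Phi;s)=\int_{\mathbb{R}^N}\Phi\Big(x^N+\sum_{n=1}^N b_n x^{N-n}\Big)^{-s}\,d\lambda_N(\mathbf{b}), \] where $\lambda_N$ is Lebesgue measure. For polynomials $P,Q$ put $\langle P,Q\rangle=\langle P,Q\rangle_{\mathbb{R}}+\langle P,Q\rangle_{\mathbb{C}}$ with \[ \langle P,Q\rangle_{\mathbb{R}}=\int_{\mathbb{R}^2}\phi(x)^{-s}\phi(y)^{-s}P(x)Q(y)\,\mathrm{sgn}(y-x)\,dx\,dy, \] \[ \langle P,Q\rangle_{\mathbb{C}}=-2i\int_{\mathbb{C}}\phi(\beta)^{-s}\phi(\overline\beta)^{-s}P(\overline\beta)Q(\beta)\,\mathrm{sgn}(\operatorname{Im}\beta)\,d\lambda_2(\beta).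 \] \textbf{Corollary 3.} Let $\Phi$ be a multiplicative distance function whose root function satisfies $\phi(-\beta)=\phi(\beta)$ for every $\beta\in\mathbb{C}$. Let $N\ge 0$ be an integer, let $J$ be the integer part of $(N+1)/2$, and let $s\in\mathbb{C}$ with $\operatorname{Re}(s)>N$. Let $\mathbf{P}=\{P_1,\dots,P_N\}$ be monic polynomials in $\mathbb{R}[x]$ with $\deg P_n=n-1$ such that $P_n$ is even when $n-1$ is even and odd when $n-1$ is odd. Let $U_{\mathbf{P}}$ be the $2J\times 2J$ antisymmetric matrix with entries \[ U_{\mathbf{P}}[j,k]=\begin{cases}\langle P_j,P_k\rangle & \text{if } j,k\le N,\\[2pt] \mathrm{sgn}(k-j)\displaystyle\int_{\mathbb{R}}\phi(x)^{-s}P_{\min\{j,k\}}(x)\,dx & \text{otherwise}\end{cases} \] (the diagonal entry with $j=k=N+1$, which occurs when $N$ is odd, is $0$). Then the integral defining $F_N(\Phi;s)$, the integrals defining $\langle P_j,P_k\rangle_{\mathbb{R}}$ and $\langle P_j,P_k\rangle_{\mathbb{C}}$ for $1\le j,k\le N$, and the integrals $\int_{\mathbb{R}}\phi(x)^{-s}P_j(x)\,dx$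 for $1\le j\le N$ all converge absolutely, and \[ F_N(\Phi;s)=\det A_{\mathbf{P}}, \] where $A_{\mathbf{P}}$ is the $J\times J$ matrix with entries $A_{\mathbf{P}}[j,k]=U_{\mathbf{P}}[2j-1,2k]$. -/

import Mathlib

open MeasureTheory

namespace MultDist

/-- A multiplicative distance function on `ℂ[x]`: a non-negative function which is continuous
(as a function of the coefficient vector, on polynomials of bounded degree), positive definite,
absolutely homogeneous and multiplicative. -/
structure IsMultiplicativeDistance (Φ : Polynomial ℂ → ℝ) : Prop where
  nonneg : ∀ f, 0 ≤ Φ f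
  continuous : ∀ n : ℕ, Continuous fun a : Fin n → ℂ =>
    Φ (∑ i : Fin n, Polynomial.C (a i) * Polynomial.X ^ (i : ℕ))
  eq_zero_iff : ∀ f, Φ f = 0 ↔ f = 0
  homogeneous : ∀ (w : ℂ) (f : Polynomial ℂ), Φ (Polynomial.C w * f) = ‖w‖ * Φ f
  map_mul : ∀ f g, Φ (f * g) = Φ f * Φ g

/-- The root function `φ(γ) = Φ(x - γ)`. -/
noncomputable def rootFunction (Φ : Polynomial ℂ → ℝ) (γ : ℂ) : ℝ :=
  Φ (Polynomial.X - Polynomial.C γ)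

/-- The degree `N` monic restriction
`b ↦ Φ(x^N + b₁ x^(N-1) + ⋯ + b_N)`; the coordinate `b_(n+1)` is `b n`. -/
noncomputable def monicRestriction (Φ : Polynomial ℂ → ℝ) (N : ℕ) (b : Fin N → ℂ) : ℝ :=
  Φ (Polynomial.X ^ N +
    ∑ n : Fin N, Polynomial.C (b n) * Polynomial.X ^ (N - ((n : ℕ) + 1)))

/-- The function of `b ∈ ℝ^N` whose Lebesgue integral is the real moment function. -/
noncomputable def momentIntegrand (Φ : Polynomial ℂ → ℝ) (N : ℕ) (s : ℂ) (b : Fin N → ℝ) : ℂ :=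
  (monicRestriction Φ N (fun n => (b n : ℂ)) : ℂ) ^ (-s)

/-- The real degree `N` moment function `F_N(Φ; s)`. -/
noncomputable def momentFunction (Φ : Polynomial ℂ → ℝ) (N : ℕ) (s : ℂ) : ℂ :=
  ∫ b : Fin N → ℝ, momentIntegrand Φ N s b

/-- The integrand of `⟨P, Q⟩_ℝ`, as a function of `(x, y) ∈ ℝ²`. -/
noncomputable def realIntegrand (Φ : Polynomial ℂ → ℝ) (s : ℂ) (P Q : Polynomial ℂ)
    (p : ℝ × ℝ) : ℂ :=
  (rootFunction Φ (p.1 : ℂ) : ℂ) ^ (-s) * (rootFunction Φ (p.2 : ℂ) : ℂ) ^ (-s) *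
    P.eval (p.1 : ℂ) * Q.eval (p.2 : ℂ) * (Real.sign (p.2 - p.1) : ℂ)

/-- The integrand of `⟨P, Q⟩_ℂ` (without the factor `-2i`), as a function of `β ∈ ℂ`. -/
noncomputable def complexIntegrand (Φ : Polynomial ℂ → ℝ) (s : ℂ) (P Q : Polynomial ℂ)
    (β : ℂ) : ℂ :=
  (rootFunction Φ β : ℂ) ^ (-s) * (rootFunction Φ (starRingEnd ℂ β) : ℂ) ^ (-s) *
    P.eval (starRingEnd ℂ β) * Q.eval β * (Real.sign β.im : ℂ)

/-- The integrand `φ(x)^(-s) P(x)` on the real line. -/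
noncomputable def lineIntegrand (Φ : Polynomial ℂ → ℝ) (s : ℂ) (P : Polynomial ℂ) (x : ℝ) : ℂ :=
  (rootFunction Φ (x : ℂ) : ℂ) ^ (-s) * P.eval (x : ℂ)

/-- The skew-symmetric form `⟨P, Q⟩_ℝ`. -/
noncomputable def realForm (Φ : Polynomial ℂ → ℝ) (s : ℂ) (P Q : Polynomial ℂ) : ℂ :=
  ∫ p : ℝ × ℝ, realIntegrand Φ s P Q p

/-- The skew-symmetric form `⟨P, Q⟩_ℂ`. -/
noncomputable def complexForm (Φ : Polynomial ℂ → ℝ) (s : ℂ) (P Q : Polynomial ℂ) : ℂ :=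
  -2 * Complex.I * ∫ β : ℂ, complexIntegrand Φ s P Q β

/-- The skew-symmetric form `⟨P, Q⟩ = ⟨P, Q⟩_ℝ + ⟨P, Q⟩_ℂ`. -/
noncomputable def skewForm (Φ : Polynomial ℂ → ℝ) (s : ℂ) (P Q : Polynomial ℂ) : ℂ :=
  realForm Φ s P Q + complexForm Φ s P Q

/-- The antisymmetric `2J × 2J` matrix `U_P`, where `J` is the integer part of `(N+1)/2`.
Indices start at `0`: the index `j : Fin (2J)` stands for `j + 1`, and `P j` for `P_(j+1)`.
The last case occurs only for `N` odd and `j = k = N`, a diagonal entry, where `sgn(k - j) = 0`. -/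
noncomputable def matrixU (Φ : Polynomial ℂ → ℝ) (s : ℂ) {N : ℕ} (P : Fin N → Polynomial ℂ) :
    Matrix (Fin (2 * ((N + 1) / 2))) (Fin (2 * ((N + 1) / 2))) ℂ :=
  Matrix.of fun j k =>
    if h : (j : ℕ) < N ∧ (k : ℕ) < N then
      skewForm Φ s (P ⟨j, h.1⟩) (P ⟨k, h.2⟩)
    else if h' : min (j : ℕ) (k : ℕ) < N then
      (Real.sign ((k : ℝ) - (j : ℝ)) : ℂ) *
        ∫ x : ℝ, lineIntegrand Φ s (P ⟨min (j : ℕ) (k : ℕ), h'⟩) x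
    else 0

/-- The `J × J` matrix `A_P[j,k] = U_P[2j-1, 2k]`. With indices starting at `0`, the row `2j-1`
and the column `2k` of `U_P` become `2j` and `2k+1`. -/
noncomputable def matrixA (Φ : Polynomial ℂ → ℝ) (s : ℂ) {N : ℕ} (P : Fin N → Polynomial ℂ) :
    Matrix (Fin ((N + 1) / 2)) (Fin ((N + 1) / 2)) ℂ :=
  Matrix.of fun j k =>
    matrixU Φ s P ⟨2 * (j : ℕ), by omega⟩ ⟨2 * (k : ℕ) + 1, by omega⟩

end MultDist

/-! Write `N = 2J + M` with `M ≤ 1` (this `J` is the integer part of `N/2`), and parametrise monic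
real polynomials of degree `N` by products of `J` monic quadratics and one monic factor of degree
`M`. The multiplication map is many-to-one, but its signed number of preimages is almost everywhere
`J!`.

To see this, split off one quadratic at a time. The Jacobian of `(q, g) ↦ q g` is the Sylvester
determinant, that is the resultant. For a separable `f = q g` it is positive when the roots of `q`
are complex conjugate, and has the sign of `-f'(a) f'(b)` when they are real, `a < b`. The signs of
`f'` at the successive real roots alternate, so `r` real roots contribute the integer part of `r/2`
in total, and every conjugate pair contributes `1`. The signed count is therefore the integer part
of `deg f / 2`, independent of `f` (`exists_fibre_mulMap`). Separability holds almost everywhere by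
Sard's theorem, and the signed change of variables `integral_det_smul_comp_eq` applies at each stage
(`integral_chainResultant_smul`).

The product of the successive resultants, times the root differences inside the quadratics, is the
Vandermonde determinant of all roots (`det_vandermonde_rootVec`). It can be written with the monic
polynomials `P_j` in place of powers. Since the weight is multiplicative, the Leibniz expansion and
Fubini turn `J! F_N` into a signed sum over permutations of products of integrals over one quadratic
each, with one line integral when `N` is odd (`factorial_mul_integral_eq_sum`). Passing from a
quadratic to its roots identifies each such integral with the positive half of `⟨P_j, P_k⟩`; the
factor `-2i` arises as `4 Im β / (β - conj β)` (`integral_pairDensity`).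

The sum is of Pfaffian type. The symmetry `φ(-β) = φ(β)` makes the positive half symmetric on
polynomials of equal parity, so only entries joining an even index to an odd one survive
antisymmetrisation. The sum then reduces to `J!` times a determinant (`pairSum_eq_sum_det`), and
`J!` cancels. -/

namespace MultDist

/-! ### Area formula and change of variables with signed multiplicity -/

section AreaFormula

open Set Filter Function

variable {E : Type*} [NormedAddCommGroup E] [NormedSpace ℝ E] [FiniteDimensional ℝ E]

/-- A set on which the derivative is invertible splits into countably many disjoint measurable
pieces on which the function is injective. -/
theorem exists_measurable_partition_injOn [MeasurableSpace E] [BorelSpace E] {F : E → E}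
    {F' : E → E →L[ℝ] E} (hF : ∀ x, HasFDerivAt F (F' x) x)
    {s : Set E} (hs : MeasurableSet s) (hdet : ∀ x ∈ s, (F' x).det ≠ 0) :
    ∃ t : ℕ → Set E, (∀ n, MeasurableSet (t n)) ∧ Pairwise (Disjoint on t) ∧
      (⋃ n, t n) = s ∧ ∀ n, InjOn F (t n) := by
  classical
  rcases s.eq_empty_or_nonempty with rfl | hne
  · exact ⟨fun _ => ∅, by simp, by simp [Pairwise, Function.onFun], by simp, by simp⟩
  have key : ∀ A : E →L[ℝ] E, ∃ r : NNReal, r ≠ 0 ∧ (A.det ≠ 0 →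
      ∀ u : Set E, ApproximatesLinearOn F A u r → InjOn F u) := by
    intro A
    by_cases hA : A.det = 0
    · exact ⟨1, one_ne_zero, fun h => absurd hA h⟩
    · let B := A.toContinuousLinearEquivOfDetNeZero hA
      have hB : (B : E →L[ℝ] E) = A := A.coe_toContinuousLinearEquivOfDetNeZero hA
      rcases subsingleton_or_nontrivial E with hE | hE
      · exact ⟨1, one_ne_zero, fun _ u _ x _ y _ _ => Subsingleton.elim x y⟩
      have hpos : 0 < ‖(B.symm : E →L[ℝ] E)‖₊⁻¹ := by
        have := (nnnorm_pos (a := (B.symm : E →L[ℝ] E))).2 fun h0 => by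
          obtain ⟨x, hx⟩ := exists_ne (0 : E)
          exact hx (by simpa using congrArg (fun L : E →L[ℝ] E => L (B x)) h0)
        positivity
      -- Any error strictly below `‖B⁻¹‖⁻¹` keeps a map approximated by `B` injective; half of it is
      -- a convenient choice.
      refine ⟨‖(B.symm : E →L[ℝ] E)‖₊⁻¹ / 2, (half_pos hpos).ne', fun _ u hu => ?_⟩
      rw [← hB] at hu
      exact hu.injOn (Or.inr (NNReal.half_lt_self hpos.ne'))
  choose r hr0 hr using key
  obtain ⟨t, A, hd, hm, hcov, happ, hA⟩ :=
    exists_partition_approximatesLinearOn_of_hasFDerivWithinAt F s F'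
      (fun x _ => (hF x).hasFDerivWithinAt) r hr0
  refine ⟨fun n => s ∩ t n, fun n => hs.inter (hm n), fun i j hij => ?_, ?_, fun n => ?_⟩
  · exact (hd hij).mono inter_subset_right inter_subset_right
  · rw [← inter_iUnion]
    exact inter_eq_left.2 hcov
  · obtain ⟨y, hy, hyA⟩ := hA hne n
    refine hr (A n) ?_ _ (happ n)
    rw [hyA]
    exact hdet y hy

variable [MeasurableSpace E] [BorelSpace E] (μ : Measure E) [μ.IsAddHaarMeasure]
  {G : Type*} [NormedAddCommGroup G] [NormedSpace ℝ G]

/-- The area formula on a set where the derivative is invertible and where the fibres are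
finite of bounded cardinality. -/
theorem integral_abs_det_smul_comp_eq_integral_ncard [CompleteSpace G] {F : E → E}
    {F' : E → E →L[ℝ] E} (hF : ∀ x, HasFDerivAt F (F' x) x)
    {s : Set E} (hs : MeasurableSet s) (hdet : ∀ x ∈ s, (F' x).det ≠ 0) {K : ℕ}
    (hfib : ∀ᵐ y ∂μ, ∃ S : Finset E, (∀ x, x ∈ S ↔ x ∈ s ∧ F x = y) ∧ S.card ≤ K)
    {h : E → G} (hh : Integrable h μ) :
    IntegrableOn (fun x => |(F' x).det| • h (F x)) s μ ∧
      Integrable (fun y => ((s ∩ F ⁻¹' {y}).ncard : ℝ) • h y) μ ∧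
      ∫ x in s, |(F' x).det| • h (F x) ∂μ = ∫ y, ((s ∩ F ⁻¹' {y}).ncard : ℝ) • h y ∂μ := by
  classical
  obtain ⟨t, htm, htd, hts, hinj⟩ := exists_measurable_partition_injOn hF hs hdet
  have hFw : ∀ n, ∀ x ∈ t n, HasFDerivWithinAt F (F' x) (t n) x :=
    fun n x _ => (hF x).hasFDerivWithinAt
  have himg : ∀ n, MeasurableSet (F '' t n) := fun n =>
    measurable_image_of_fderivWithin (htm n) (hFw n) (hinj n)
  -- Each preimage of `y` in `s` lies in exactly one piece `t n`, and each piece contains at most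
  -- one preimage, so the image indicators add up to the cardinality of the fibre.
  have hsum : ∀ᵐ y ∂μ, HasSum (fun n => (F '' t n).indicator (fun _ => (1 : ℝ)) y)
      ((s ∩ F ⁻¹' {y}).ncard : ℝ) ∧ (s ∩ F ⁻¹' {y}).ncard ≤ K := by
    filter_upwards [hfib] with y ⟨S, hS, hSK⟩
    have hSs : s ∩ F ⁻¹' {y} = S := by ext x; simp [hS]
    rw [hSs, ncard_coe_finset]
    refine ⟨?_, hSK⟩
    have h1 : ∀ n, (F '' t n).indicator (fun _ => (1 : ℝ)) y
        = ∑ x ∈ S, (t n).indicator (fun _ => (1 : ℝ)) x := by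
      intro n
      by_cases hy : y ∈ F '' t n
      · obtain ⟨x, hx, rfl⟩ := hy
        rw [indicator_of_mem (mem_image_of_mem F hx), Finset.sum_eq_single x]
        · simp [hx]
        · intro z hz hzx
          refine indicator_of_notMem (fun hz' => hzx ?_) _
          exact hinj n hz' hx ((hS z).1 hz).2
        · intro hxS
          exact absurd ((hS x).2 ⟨hts ▸ mem_iUnion.2 ⟨n, hx⟩, rfl⟩) hxS
      · rw [indicator_of_notMem hy, Finset.sum_eq_zero]
        intro x hx
        refine indicator_of_notMem (fun hx' => hy ⟨x, hx', ((hS x).1 hx).2⟩) _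
    simp_rw [h1]
    have h2 : ((S.card : ℕ) : ℝ) = ∑ x ∈ S, (1 : ℝ) := by simp
    rw [h2]
    refine hasSum_sum fun x hx => ?_
    obtain ⟨n, hn⟩ := mem_iUnion.1 (hts ▸ ((hS x).1 hx).1)
    convert hasSum_ite_eq n (1 : ℝ) using 2 with m
    by_cases hm : m = n
    · subst hm; simp [hn]
    · have : x ∉ t m := fun hx' => disjoint_left.1 (htd hm) hx' hn
      simp [hm, this]
  have hint : ∀ n, Integrable ((F '' t n).indicator h) μ := fun n => hh.indicator (himg n)
  have hnorm : ∀ n, ∫ y, ‖(F '' t n).indicator h y‖ ∂μ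
      = ∫ y, (F '' t n).indicator (fun _ => (1 : ℝ)) y * ‖h y‖ ∂μ := by
    intro n
    congr 1
    ext y
    by_cases hy : y ∈ F '' t n <;> simp [hy]
  have hint1 : ∀ n, Integrable (fun y => (F '' t n).indicator (fun _ => (1 : ℝ)) y * ‖h y‖) μ := by
    intro n
    refine (hh.norm.indicator (himg n)).congr (Eventually.of_forall fun y => ?_)
    by_cases hy : y ∈ F '' t n <;> simp [hy]
  -- The images overlap at most `K` times, which bounds the partial sums by `K ∫ ‖h‖` and allows
  -- summation and integration to be exchanged.
  have hsummable : Summable fun n => ∫ y, ‖(F '' t n).indicator h y‖ ∂μ := by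
    refine summable_of_sum_le (c := K * ∫ y, ‖h y‖ ∂μ)
      (fun n => integral_nonneg fun y => norm_nonneg _) fun u => ?_
    simp_rw [hnorm]
    rw [← integral_finsetSum _ fun n _ => hint1 n, ← integral_const_mul]
    refine integral_mono_ae (integrable_finsetSum _ fun n _ => hint1 n)
      (hh.norm.const_mul _) ?_
    filter_upwards [hsum] with y ⟨hy, hyK⟩
    rw [← Finset.sum_mul]
    refine mul_le_mul_of_nonneg_right ?_ (norm_nonneg _)
    refine (sum_le_hasSum u (fun n _ => ?_) hy).trans (by exact_mod_cast hyK)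
    exact indicator_nonneg (fun _ _ => zero_le_one) _
  have hpiece : ∀ n, IntegrableOn (fun x => |(F' x).det| • h (F x)) (t n) μ := fun n =>
    (integrableOn_image_iff_integrableOn_abs_det_fderiv_smul μ (htm n) (hFw n) (hinj n) h).1
      hh.integrableOn
  have hI : IntegrableOn (fun x => |(F' x).det| • h (F x)) s μ := by
    rw [← hts]
    refine integrableOn_iUnion_of_summable_integral_norm hpiece ?_
    refine hsummable.congr fun n => ?_
    have e1 : ∀ y, ‖(F '' t n).indicator h y‖ = (F '' t n).indicator (fun z => ‖h z‖) y :=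
      fun y => norm_indicator_eq_indicator_norm h y
    simp_rw [e1]
    rw [integral_indicator (himg n),
      integral_image_eq_integral_abs_det_fderiv_smul μ (htm n) (hFw n) (hinj n)]
    simp [norm_smul]
  have hlim : ∀ᵐ y ∂μ, HasSum (fun n => (F '' t n).indicator h y)
      (((s ∩ F ⁻¹' {y}).ncard : ℝ) • h y) := by
    filter_upwards [hsum] with y ⟨hy, _⟩
    convert hy.smul_const (h y) using 2 with n
    by_cases hy : y ∈ F '' t n <;> simp [hy]
  have hae : (fun y => ∑' n, (F '' t n).indicator h y) =ᵐ[μ]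
      fun y => ((s ∩ F ⁻¹' {y}).ncard : ℝ) • h y := by
    filter_upwards [hlim] with y hy using hy.tsum_eq
  refine ⟨hI, ?_, ?_⟩
  · refine Integrable.mono' (hh.norm.const_mul K) ?_ ?_
    · refine aestronglyMeasurable_of_tendsto_ae atTop
        (f := fun N y => ∑ n ∈ Finset.range N, (F '' t n).indicator h y)
        (fun N => (integrable_finsetSum _ fun n _ => hint n).1) ?_
      filter_upwards [hlim] with y hy using hy.tendsto_sum_nat
    · filter_upwards [hsum] with y ⟨_, hy⟩
      rw [norm_smul]
      refine mul_le_mul_of_nonneg_right ?_ (norm_nonneg _)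
      simpa using hy
  · have hL := hasSum_integral_iUnion htm htd (hts ▸ hI)
    rw [hts] at hL
    have hR := hasSum_integral_of_summable_integral_norm hint hsummable
    rw [integral_congr_ae hae] at hR
    refine hL.unique ?_
    convert hR using 2 with n
    rw [integral_indicator (himg n),
      integral_image_eq_integral_abs_det_fderiv_smul μ (htm n) (hFw n) (hinj n)]

/-- Change of variables for a map whose signed number of preimages is almost everywhere
equal to a constant `d`. -/
theorem integral_det_smul_comp_eq [CompleteSpace G] {F : E → E}
    {F' : E → E →L[ℝ] E} (hF : ∀ x, HasFDerivAt F (F' x) x) (hF' : Continuous F') {K : ℕ} {d : ℝ}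
    (hfib : ∀ᵐ y ∂μ, ∃ S : Finset E, (∀ x, x ∈ S ↔ F x = y) ∧ S.card ≤ K ∧
      ∑ x ∈ S, Real.sign (F' x).det = d)
    {h : E → G} (hh : Integrable h μ) :
    Integrable (fun x => (F' x).det • h (F x)) μ ∧
      ∫ x, ‖(F' x).det • h (F x)‖ ∂μ ≤ (2 * K : ℕ) * ∫ y, ‖h y‖ ∂μ ∧
      ∫ x, (F' x).det • h (F x) ∂μ = d • ∫ y, h y ∂μ := by
  classical
  have hdc : Continuous fun x => (F' x).det := ContinuousLinearMap.continuous_det.comp hF'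
  let p : Set E := {x | 0 < (F' x).det}
  let m : Set E := {x | (F' x).det < 0}
  have hp : MeasurableSet p := (isOpen_lt continuous_const hdc).measurableSet
  have hm : MeasurableSet m := (isOpen_lt hdc continuous_const).measurableSet
  have hfibs : ∀ s : Set E, ∀ᵐ y ∂μ, ∃ S : Finset E, (∀ x, x ∈ S ↔ x ∈ s ∧ F x = y) ∧
      S.card ≤ K := by
    intro s
    filter_upwards [hfib] with y ⟨S, hS, hK, _⟩
    refine ⟨S.filter (· ∈ s), fun x => ?_, (Finset.card_filter_le _ _).trans hK⟩
    rw [Finset.mem_filter, hS, and_comm]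
  have hp0 : ∀ x ∈ p, (F' x).det ≠ 0 := fun x (hx : 0 < _) => hx.ne'
  have hm0 : ∀ x ∈ m, (F' x).det ≠ 0 := fun x (hx : _ < 0) => hx.ne
  obtain ⟨ip, jp, ep⟩ := integral_abs_det_smul_comp_eq_integral_ncard μ hF hp hp0 (hfibs p) hh
  obtain ⟨im, jm, em⟩ := integral_abs_det_smul_comp_eq_integral_ncard μ hF hm hm0 (hfibs m) hh
  obtain ⟨ip', jp', ep'⟩ :=
    integral_abs_det_smul_comp_eq_integral_ncard μ hF hp hp0 (hfibs p) hh.norm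
  obtain ⟨im', jm', em'⟩ :=
    integral_abs_det_smul_comp_eq_integral_ncard μ hF hm hm0 (hfibs m) hh.norm
  rw [← integrable_indicator_iff hp] at ip ip'
  rw [← integrable_indicator_iff hm] at im im'
  rw [← integral_indicator hp] at ep ep'
  rw [← integral_indicator hm] at em em'
  -- The critical set carries zero integrand, so the signed integral is the unsigned one over `p`
  -- minus the unsigned one over `m`, and the norm is their sum.
  have hsplit : (fun x => (F' x).det • h (F x)) = fun x =>
      p.indicator (fun x => |(F' x).det| • h (F x)) x
        - m.indicator (fun x => |(F' x).det| • h (F x)) x := by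
    ext x
    rcases lt_trichotomy (F' x).det 0 with hx | hx | hx
    · have h1 : x ∈ m := hx
      have h2 : x ∉ p := fun h' : 0 < _ => lt_asymm hx h'
      simp [h1, h2, abs_of_neg hx]
    · have h1 : x ∉ m := fun h' : _ < 0 => h'.ne hx
      have h2 : x ∉ p := fun h' : 0 < _ => h'.ne' hx
      simp [h1, h2, hx]
    · have h1 : x ∈ p := hx
      have h2 : x ∉ m := fun h' : _ < 0 => lt_asymm hx h'
      simp [h1, h2, abs_of_pos hx]
  have hsplit' : (fun x => ‖(F' x).det • h (F x)‖) = fun x =>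
      p.indicator (fun x => |(F' x).det| • ‖h (F x)‖) x
        + m.indicator (fun x => |(F' x).det| • ‖h (F x)‖) x := by
    ext x
    rcases lt_trichotomy (F' x).det 0 with hx | hx | hx
    · have h1 : x ∈ m := hx
      have h2 : x ∉ p := fun h' : 0 < _ => lt_asymm hx h'
      simp [h1, h2, norm_smul]
    · have h1 : x ∉ m := fun h' : _ < 0 => h'.ne hx
      have h2 : x ∉ p := fun h' : 0 < _ => h'.ne' hx
      simp [h1, h2, hx]
    · have h1 : x ∈ p := hx
      have h2 : x ∉ m := fun h' : _ < 0 => lt_asymm hx h'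
      simp [h1, h2, norm_smul]
  have hcard : ∀ᵐ y ∂μ, ((p ∩ F ⁻¹' {y}).ncard : ℝ) - (m ∩ F ⁻¹' {y}).ncard = d ∧
      ((p ∩ F ⁻¹' {y}).ncard : ℝ) + (m ∩ F ⁻¹' {y}).ncard ≤ (2 * K : ℕ) := by
    filter_upwards [hfib] with y ⟨S, hS, hK, hd⟩
    have e1 : p ∩ F ⁻¹' {y} = S.filter (· ∈ p) := by ext x; simp [hS, and_comm]
    have e2 : m ∩ F ⁻¹' {y} = S.filter (· ∈ m) := by ext x; simp [hS, and_comm]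
    rw [e1, e2, ncard_coe_finset, ncard_coe_finset]
    constructor
    · rw [← hd, Finset.card_filter, Finset.card_filter]
      push_cast
      rw [← Finset.sum_sub_distrib]
      refine Finset.sum_congr rfl fun x _ => ?_
      rcases lt_trichotomy (F' x).det 0 with hx | hx | hx
      · have h1 : x ∈ m := hx
        have h2 : x ∉ p := fun h' : 0 < _ => lt_asymm hx h'
        simp [h1, h2, Real.sign_of_neg hx]
      · have h1 : x ∉ m := fun h' : _ < 0 => h'.ne hx
        have h2 : x ∉ p := fun h' : 0 < _ => h'.ne' hx
        simp [h1, h2, hx]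
      · have h1 : x ∈ p := hx
        have h2 : x ∉ m := fun h' : _ < 0 => lt_asymm hx h'
        simp [h1, h2, Real.sign_of_pos hx]
    · have h1 := (Finset.card_filter_le S (· ∈ p)).trans hK
      have h2 := (Finset.card_filter_le S (· ∈ m)).trans hK
      exact_mod_cast (by omega)
  refine ⟨?_, ?_, ?_⟩
  · rw [hsplit]
    exact ip.sub im
  · rw [hsplit', integral_add ip' im', ep', em', ← integral_add jp' jm', ← integral_const_mul]
    refine integral_mono_ae (jp'.add jm') (hh.norm.const_mul _) ?_
    filter_upwards [hcard] with y ⟨_, hy⟩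
    rw [← add_smul]
    exact mul_le_mul_of_nonneg_right hy (norm_nonneg _)
  · rw [hsplit, integral_sub ip im, ep, em, ← integral_sub jp jm, ← integral_smul]
    refine integral_congr_ae ?_
    filter_upwards [hcard] with y ⟨hy, _⟩
    rw [← sub_smul, hy]

end AreaFormula

/-! ### Multiplication of monic polynomials and its Jacobian -/

section MonicPoly

open Polynomial

variable {n m M : ℕ}

/-- The polynomial `∑ b_i x^i` of degree less than `n`. -/
noncomputable def lowPoly (b : Fin n → ℝ) : ℝ[X] := ∑ i, C (b i) * X ^ (i : ℕ)

/-- The monic polynomial `x^n + ∑ b_i x^i`. -/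
noncomputable def monicPoly (b : Fin n → ℝ) : ℝ[X] := X ^ n + lowPoly b

theorem coeff_lowPoly (b : Fin n → ℝ) (k : ℕ) :
    (lowPoly b).coeff k = if h : k < n then b ⟨k, h⟩ else 0 := by
  simp only [lowPoly, finsetSum_coeff, coeff_C_mul, coeff_X_pow]
  split_ifs with h
  · rw [Finset.sum_eq_single ⟨k, h⟩]
    · simp
    · intro j _ hj
      have : k ≠ j := fun h' => hj (Fin.ext h'.symm)
      simp [this]
    · simp
  · refine Finset.sum_eq_zero fun j _ => ?_
    have : k ≠ j := fun h' => h (h' ▸ j.2)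
    simp [this]

theorem degree_lowPoly_lt (b : Fin n → ℝ) : (lowPoly b).degree < n := by
  rw [degree_lt_iff_coeff_zero]
  intro k hk
  rw [coeff_lowPoly, dif_neg (by omega)]

theorem monic_monicPoly (b : Fin n → ℝ) : (monicPoly b).Monic :=
  monic_X_pow_add (degree_lowPoly_lt b)

@[simp] theorem natDegree_monicPoly (b : Fin n → ℝ) : (monicPoly b).natDegree = n := by
  rw [monicPoly, natDegree_add_eq_left_of_degree_lt]
  · simp
  · simpa using degree_lowPoly_lt b

theorem coeff_monicPoly (b : Fin n → ℝ) (k : ℕ) :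
    (monicPoly b).coeff k = (if k = n then 1 else 0) + if h : k < n then b ⟨k, h⟩ else 0 := by
  rw [monicPoly, coeff_add, coeff_X_pow, coeff_lowPoly]

theorem coeff_monicPoly_fin (b : Fin n → ℝ) (i : Fin n) : (monicPoly b).coeff i = b i := by
  have := i.2.ne
  simp [coeff_monicPoly, this]

theorem monicPoly_injective : Function.Injective (monicPoly : (Fin n → ℝ) → ℝ[X]) := by
  intro a b h
  ext i
  rw [← coeff_monicPoly_fin a, h, coeff_monicPoly_fin]

theorem monicPoly_coeff {p : ℝ[X]} (hp : p.Monic) (hn : p.natDegree = n) :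
    monicPoly (fun i : Fin n => p.coeff i) = p := by
  ext k
  rw [coeff_monicPoly]
  rcases lt_trichotomy k n with h | h | h
  · simp [h, h.ne]
  · subst h hn
    simp [hp]
  · rw [coeff_eq_zero_of_natDegree_lt (hn ▸ h)]
    simp [h.ne', h.le]

/-- Multiplication of monic polynomials of degrees `m` and `M`, on coefficient vectors. -/
noncomputable def mulMap (m M : ℕ) (x : Fin (m + M) → ℝ) : Fin (m + M) → ℝ := fun i =>
  (monicPoly (fun j => x (Fin.castAdd M j)) * monicPoly (fun j => x (Fin.natAdd m j))).coeff i

theorem monicPoly_mulMap (x : Fin (m + M) → ℝ) :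
    monicPoly (mulMap m M x) =
      monicPoly (fun j => x (Fin.castAdd M j)) * monicPoly (fun j => x (Fin.natAdd m j)) := by
  refine monicPoly_coeff ((monic_monicPoly _).mul (monic_monicPoly _)) ?_
  rw [(monic_monicPoly _).natDegree_mul (monic_monicPoly _)]
  simp

/-- The Sylvester matrix of the two factors, as a linear map. -/
noncomputable def mulMapDeriv (m M : ℕ) (x : Fin (m + M) → ℝ) :
    (Fin (m + M) → ℝ) →L[ℝ] (Fin (m + M) → ℝ) :=
  LinearMap.toContinuousLinearMap (Matrix.toLin'
    (sylvester (monicPoly fun j => x (Fin.castAdd M j)) (monicPoly fun j => x (Fin.natAdd m j)) m M))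

theorem det_mulMapDeriv (x : Fin (m + M) → ℝ) : (mulMapDeriv m M x).det =
    resultant (monicPoly fun j => x (Fin.castAdd M j)) (monicPoly fun j => x (Fin.natAdd m j)) := by
  rw [mulMapDeriv, LinearMap.det_toContinuousLinearMap, LinearMap.det_toLin', resultant,
    natDegree_monicPoly, natDegree_monicPoly]

/-- This is the product rule in matrix form: a perturbation of the coefficients of `q` gets
multiplied by `g` and conversely. It makes the Sylvester matrix the derivative of `mulMap`. -/
theorem sylvester_mulVec (q g : ℝ[X]) (hq : q.natDegree ≤ m) (hg : g.natDegree ≤ M)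
    (v : Fin (m + M) → ℝ) (i : Fin (m + M)) :
    (sylvester q g m M).mulVec v i =
      (q * lowPoly (fun j => v (Fin.natAdd m j)) +
        lowPoly (fun j => v (Fin.castAdd M j)) * g).coeff i := by
  rw [Matrix.mulVec, dotProduct, Fin.sum_univ_add, coeff_add, add_comm]
  congr 1
  · simp only [lowPoly, Finset.mul_sum, finsetSum_coeff, sylvester, Matrix.of_apply,
      Fin.addCases_right]
    refine Finset.sum_congr rfl fun j _ => ?_
    rw [mul_left_comm, coeff_C_mul, coeff_mul_X_pow', mul_comm]
    congr 1
    simp only [Set.mem_Icc, ite_and]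
    split_ifs with h1 h2 <;> try rfl
    exact (coeff_eq_zero_of_natDegree_lt (by omega)).symm
  · simp only [lowPoly, Finset.sum_mul, finsetSum_coeff, sylvester, Matrix.of_apply,
      Fin.addCases_left]
    refine Finset.sum_congr rfl fun j _ => ?_
    rw [mul_assoc, coeff_C_mul, coeff_X_pow_mul', mul_comm]
    congr 1
    simp only [Set.mem_Icc, ite_and]
    split_ifs with h1 h2 <;> try rfl
    exact (coeff_eq_zero_of_natDegree_lt (by omega)).symm

/-- The coefficients of the low-degree polynomial with coordinates `v ∘ f`, as functionals. -/
noncomputable def lowCoeff {N : ℕ} (f : Fin n → Fin N) (k : ℕ) : (Fin N → ℝ) →L[ℝ] ℝ :=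
  if h : k < n then ContinuousLinearMap.proj (f ⟨k, h⟩) else 0

theorem lowCoeff_apply {N : ℕ} (f : Fin n → Fin N) (k : ℕ) (v : Fin N → ℝ) :
    lowCoeff f k v = (lowPoly fun j => v (f j)).coeff k := by
  rw [coeff_lowPoly, lowCoeff]
  split_ifs <;> simp

theorem hasFDerivAt_coeff_monicPoly {N : ℕ} (f : Fin n → Fin N) (k : ℕ) (x : Fin N → ℝ) :
    HasFDerivAt (fun x : Fin N → ℝ => (monicPoly fun j => x (f j)).coeff k) (lowCoeff f k) x := by
  have : (fun x : Fin N → ℝ => (monicPoly fun j => x (f j)).coeff k) =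
      fun x => (if k = n then 1 else 0) + lowCoeff f k x := by
    ext x
    rw [lowCoeff_apply, monicPoly, coeff_add, coeff_X_pow]
  rw [this]
  exact (lowCoeff f k).hasFDerivAt.const_add _

theorem hasFDerivAt_mulMap (x : Fin (m + M) → ℝ) :
    HasFDerivAt (mulMap m M) (mulMapDeriv m M x) x := by
  rw [hasFDerivAt_pi']
  intro i
  have h : (fun x => mulMap m M x i) = fun x : Fin (m + M) → ℝ =>
      ∑ k ∈ Finset.HasAntidiagonal.antidiagonal (i : ℕ), (monicPoly fun j => x (Fin.castAdd M j)).coeff k.1 *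
        (monicPoly fun j => x (Fin.natAdd m j)).coeff k.2 := by
    ext x
    rw [mulMap, coeff_mul]
  rw [h]
  have h2 := HasFDerivAt.fun_sum (u := Finset.HasAntidiagonal.antidiagonal (i : ℕ)) fun k _ =>
    (hasFDerivAt_coeff_monicPoly (Fin.castAdd M) k.1 x).mul
      (hasFDerivAt_coeff_monicPoly (Fin.natAdd m) k.2 x)
  refine h2.congr_fderiv ?_
  symm
  refine ContinuousLinearMap.ext fun v => ?_
  have h3 := sylvester_mulVec (monicPoly fun j => x (Fin.castAdd M j))
    (monicPoly fun j => x (Fin.natAdd m j)) (natDegree_monicPoly _).le (natDegree_monicPoly _).le v i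
  simp only [mulMapDeriv, ContinuousLinearMap.coe_comp, Function.comp_apply,
    LinearMap.coe_toContinuousLinearMap', Matrix.toLin'_apply, ContinuousLinearMap.proj_apply,
    sum_apply, add_apply, smul_apply,
    lowCoeff_apply, smul_eq_mul]
  rw [h3, coeff_add, coeff_mul, coeff_mul, ← Finset.sum_add_distrib]
  refine Finset.sum_congr rfl fun k _ => ?_
  ring

theorem continuous_coeff_monicPoly (k : ℕ) :
    Continuous fun b : Fin n → ℝ => (monicPoly b).coeff k :=
  continuous_iff_continuousAt.2 fun b =>
    (hasFDerivAt_coeff_monicPoly (id : Fin n → Fin n) k b).continuousAt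

theorem continuous_sylvester {X : Type*} [TopologicalSpace X] {q g : X → ℝ[X]}
    (hq : ∀ k, Continuous fun x => (q x).coeff k) (hg : ∀ k, Continuous fun x => (g x).coeff k) :
    Continuous fun x => sylvester (q x) (g x) m M := by
  refine continuous_matrix fun i j => ?_
  refine Fin.addCases (fun j => ?_) (fun j => ?_) j
  · simp only [sylvester, Matrix.of_apply, Fin.addCases_left]
    split_ifs
    · exact hg _
    · exact continuous_const
  · simp only [sylvester, Matrix.of_apply, Fin.addCases_right]
    split_ifs
    · exact hq _
    · exact continuous_const

theorem continuous_mulMapDeriv : Continuous (mulMapDeriv m M) := by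
  have h1 : Continuous fun x : Fin (m + M) → ℝ =>
      sylvester (monicPoly fun j => x (Fin.castAdd M j))
        (monicPoly fun j => x (Fin.natAdd m j)) m M :=
    continuous_sylvester
      (fun k => (continuous_coeff_monicPoly k).comp (by fun_prop))
      (fun k => (continuous_coeff_monicPoly k).comp (by fun_prop))
  exact (LinearMap.continuous_of_finiteDimensional
    ((LinearMap.toContinuousLinearMap (𝕜 := ℝ) (E := Fin (m + M) → ℝ)
      (F' := Fin (m + M) → ℝ)).toLinearMap ∘ₗ
      (Matrix.toLin' (R := ℝ) (m := Fin (m + M)) (n := Fin (m + M))).toLinearMap)).comp h1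

/-- For almost all monic `f` of degree `m + M`, factors of degrees `m` and `M` are coprime. -/
theorem ae_isCoprime_of_mul_eq (h : m + M = n) : ∀ᵐ b : Fin n → ℝ,
    ∀ q g : ℝ[X], q.Monic → g.Monic → q.natDegree = m → g.natDegree = M → q * g = monicPoly b →
      IsCoprime q g := by
  subst h
  -- Sard's theorem: the critical values form a null set. A factorisation is critical exactly when
  -- its resultant vanishes, that is when the factors are not coprime.
  have hsard := addHaar_image_eq_zero_of_det_fderivWithin_eq_zero
    (volume : Measure (Fin (m + M) → ℝ)) (s := {x | (mulMapDeriv m M x).det = 0})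
    (fun x _ => (hasFDerivAt_mulMap x).hasFDerivWithinAt) (fun x hx => hx)
  rw [ae_iff]
  refine measure_mono_null (fun b hb => ?_) hsard
  simp only [Set.mem_ofPred_eq, not_forall] at hb
  obtain ⟨q, g, hq, hg, hqm, hgM, hqg, hco⟩ := hb
  have e1 : monicPoly (fun j : Fin m => q.coeff j) = q := monicPoly_coeff hq hqm
  have e2 : monicPoly (fun j : Fin M => g.coeff j) = g := monicPoly_coeff hg hgM
  let x : Fin (m + M) → ℝ := Fin.addCases (fun j => q.coeff j) (fun j => g.coeff j)
  have ex1 : (monicPoly fun j => x (Fin.castAdd M j)) = q := by simpa [x] using e1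
  have ex2 : (monicPoly fun j => x (Fin.natAdd m j)) = g := by simpa [x] using e2
  refine ⟨x, ?_, ?_⟩
  · rw [Set.mem_ofPred_eq, det_mulMapDeriv, ex1, ex2, resultant_eq_zero_iff]
    exact ⟨Or.inl hq.ne_zero, hco⟩
  · apply monicPoly_injective
    rw [monicPoly_mulMap, ex1, ex2, hqg]

end MonicPoly

/-! ### Almost every monic polynomial is separable -/

section Separable

open Polynomial

/-- Almost every monic real polynomial is separable. -/
theorem ae_separable_monicPoly (n : ℕ) : ∀ᵐ b : Fin n → ℝ, (monicPoly b).Separable := by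
  have h : ∀ m M : ℕ, m + M = n → ∀ᵐ b : Fin n → ℝ,
      ∀ q g : ℝ[X], q.Monic → g.Monic → q.natDegree = m → g.natDegree = M →
        q * g = monicPoly b → IsCoprime q g := fun m M h => ae_isCoprime_of_mul_eq h
  have h' : ∀ᵐ b : Fin n → ℝ, ∀ m M : ℕ, m + M = n →
      ∀ q g : ℝ[X], q.Monic → g.Monic → q.natDegree = m → g.natDegree = M →
        q * g = monicPoly b → IsCoprime q g := by
    refine ae_all_iff.2 fun m => ae_all_iff.2 fun M => ?_
    by_cases hm : m + M = n
    · filter_upwards [h m M hm] with b hb _ using hb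
    · exact Filter.Eventually.of_forall fun b hb => absurd hb hm
  filter_upwards [h'] with b hb
  rw [PerfectField.separable_iff_squarefree, squarefree_iff_irreducible_sq_not_dvd_of_ne_zero
    (monic_monicPoly b).ne_zero]
  rintro p hp ⟨r, hr⟩
  have hp0 : p.leadingCoeff ≠ 0 := leadingCoeff_ne_zero.2 hp.ne_zero
  -- If `p²` divides `f`, then `f = p' g` with `p'` the monic multiple of `p`, and `g` is still
  -- divisible by `p'`. These monic factors are not coprime.
  let p' := C p.leadingCoeff⁻¹ * p
  have hp' : p'.Monic := by
    rw [Monic, leadingCoeff_mul, leadingCoeff_C, inv_mul_cancel₀ hp0]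
  let g := p' * (C (p.leadingCoeff ^ 2) * r)
  have hg : p' * g = monicPoly b := by
    rw [hr]
    simp only [p', g]
    calc _ = (C (p.leadingCoeff⁻¹) * C p.leadingCoeff) ^ 2 * (p * p * r) := by
          rw [C_pow]; ring
      _ = _ := by rw [← C_mul, inv_mul_cancel₀ hp0]; simp
  have hgm : g.Monic := hp'.of_mul_monic_left (hg ▸ monic_monicPoly b)
  have hdeg : p'.natDegree + g.natDegree = n := by
    rw [← hp'.natDegree_mul hgm, hg, natDegree_monicPoly]
  have hco := hb _ _ hdeg p' g hp' hgm rfl rfl hg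
  have hu : IsUnit p' := hco.isUnit_of_dvd' dvd_rfl (dvd_mul_right _ _)
  exact hp.not_isUnit (isUnit_of_mul_isUnit_right hu)

end Separable

/-! ### Roots of a real quadratic, ordered -/

section RootPair

open Polynomial

/-- The discriminant of `x² + q₁ x + q₀`. -/
def quadDisc (q : Fin 2 → ℝ) : ℝ := q 1 ^ 2 - 4 * q 0

/-- A complex square root of the discriminant of `x² + q₁ x + q₀`. -/
noncomputable def sqrtDisc (q : Fin 2 → ℝ) : ℂ :=
  (√(quadDisc q) : ℂ) + (√(-quadDisc q) : ℂ) * Complex.I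

/-- The first root of `x² + q₁ x + q₀`: the smaller real one, or the one in the lower half plane. -/
noncomputable def lowRoot (q : Fin 2 → ℝ) : ℂ := (-(q 1 : ℂ) - sqrtDisc q) / 2

/-- The second root of `x² + q₁ x + q₀`: the larger real one, or the one in the upper half plane. -/
noncomputable def highRoot (q : Fin 2 → ℝ) : ℂ := (-(q 1 : ℂ) + sqrtDisc q) / 2

theorem sqrtDisc_sq (q : Fin 2 → ℝ) : sqrtDisc q ^ 2 = quadDisc q := by
  rcases le_total 0 (quadDisc q) with h | h
  · rw [sqrtDisc, Real.sqrt_eq_zero_of_nonpos (neg_nonpos.2 h)]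
    simp only [Complex.ofReal_zero, zero_mul, add_zero]
    exact_mod_cast Real.sq_sqrt h
  · rw [sqrtDisc, Real.sqrt_eq_zero_of_nonpos h]
    simp only [Complex.ofReal_zero, zero_add, mul_pow, Complex.I_sq]
    have := Real.sq_sqrt (neg_nonneg.2 h)
    rw [← Complex.ofReal_pow, this]
    simp

theorem lowRoot_add_highRoot (q : Fin 2 → ℝ) : lowRoot q + highRoot q = -(q 1 : ℂ) := by
  rw [lowRoot, highRoot]; ring

theorem lowRoot_mul_highRoot (q : Fin 2 → ℝ) : lowRoot q * highRoot q = q 0 := by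
  have h := sqrtDisc_sq q
  rw [quadDisc] at h
  push_cast at h
  rw [lowRoot, highRoot]
  linear_combination -h / 4

theorem highRoot_sub_lowRoot (q : Fin 2 → ℝ) : highRoot q - lowRoot q = sqrtDisc q := by
  rw [lowRoot, highRoot]; ring

theorem map_monicPoly_two (q : Fin 2 → ℝ) :
    (monicPoly q).map (algebraMap ℝ ℂ) = (X - C (lowRoot q)) * (X - C (highRoot q)) := by
  have h1 := congrArg C (lowRoot_add_highRoot q)
  have h2 := congrArg C (lowRoot_mul_highRoot q)
  simp only [C_add, C_mul, C_neg] at h1 h2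
  simp only [monicPoly, lowPoly, Fin.sum_univ_two, Polynomial.map_add, Polynomial.map_mul,
    Polynomial.map_pow, map_X, map_C, Fin.val_zero, Fin.val_one, Complex.coe_algebraMap]
  linear_combination X * h1 - h2

theorem quadDisc_eq_zero_iff (q : Fin 2 → ℝ) : quadDisc q = 0 ↔ lowRoot q = highRoot q := by
  rw [eq_comm (a := lowRoot q), ← sub_eq_zero (a := highRoot q), highRoot_sub_lowRoot,
    ← pow_eq_zero_iff (a := sqrtDisc q) two_ne_zero, sqrtDisc_sq, Complex.ofReal_eq_zero]

/-- The real quadratic polynomial with roots `a` and `b`, for real `a`, `b` or for `a = conj b`. -/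
noncomputable def pairCoeff (a b : ℂ) : Fin 2 → ℝ := ![(a * b).re, -(a + b).re]

@[simp] theorem pairCoeff_lowRoot_highRoot (q : Fin 2 → ℝ) :
    pairCoeff (lowRoot q) (highRoot q) = q := by
  ext i
  fin_cases i
  · simp [pairCoeff, lowRoot_mul_highRoot, -Complex.mul_re]
  · simp [pairCoeff, lowRoot_add_highRoot, -Complex.add_re]

theorem quadDisc_pairCoeff_ofReal (x y : ℝ) : quadDisc (pairCoeff x y) = (y - x) ^ 2 := by
  simp [quadDisc, pairCoeff]; ring

theorem quadDisc_pairCoeff_conj (β : ℂ) :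
    quadDisc (pairCoeff (starRingEnd ℂ β) β) = -(2 * β.im) ^ 2 := by
  simp [quadDisc, pairCoeff]; ring

theorem roots_pairCoeff_ofReal {x y : ℝ} (h : x < y) :
    lowRoot (pairCoeff x y) = x ∧ highRoot (pairCoeff x y) = y := by
  have h1 : √(quadDisc (pairCoeff x y)) = y - x := by
    rw [quadDisc_pairCoeff_ofReal, Real.sqrt_sq (sub_pos.2 h).le]
  have h2 : √(-quadDisc (pairCoeff x y)) = 0 :=
    Real.sqrt_eq_zero_of_nonpos (by rw [quadDisc_pairCoeff_ofReal, neg_nonpos]; positivity)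
  constructor
  · rw [lowRoot, sqrtDisc, h1, h2]; simp [pairCoeff]; ring
  · rw [highRoot, sqrtDisc, h1, h2]; simp [pairCoeff]; ring

theorem roots_pairCoeff_conj {β : ℂ} (h : 0 < β.im) :
    lowRoot (pairCoeff (starRingEnd ℂ β) β) = starRingEnd ℂ β ∧
      highRoot (pairCoeff (starRingEnd ℂ β) β) = β := by
  have h1 : √(-quadDisc (pairCoeff (starRingEnd ℂ β) β)) = 2 * β.im := by
    rw [quadDisc_pairCoeff_conj, neg_neg, Real.sqrt_sq (by positivity)]
  have h2 : √(quadDisc (pairCoeff (starRingEnd ℂ β) β)) = 0 :=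
    Real.sqrt_eq_zero_of_nonpos (by rw [quadDisc_pairCoeff_conj, neg_nonpos]; positivity)
  constructor
  · rw [lowRoot, sqrtDisc, h1, h2]
    apply Complex.ext
    · simp [pairCoeff]
    · simp [pairCoeff]
      ring
  · rw [highRoot, sqrtDisc, h1, h2]
    apply Complex.ext <;> simp [pairCoeff]

theorem exists_real_roots_of_quadDisc_pos {q : Fin 2 → ℝ} (h : 0 < quadDisc q) :
    ∃ x y : ℝ, x < y ∧ lowRoot q = x ∧ highRoot q = y := by
  refine ⟨(-q 1 - √(quadDisc q)) / 2, (-q 1 + √(quadDisc q)) / 2, ?_, ?_, ?_⟩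
  · have := Real.sqrt_pos.2 h
    linarith
  · rw [lowRoot, sqrtDisc, Real.sqrt_eq_zero_of_nonpos (neg_nonpos.2 h.le)]
    push_cast; ring
  · rw [highRoot, sqrtDisc, Real.sqrt_eq_zero_of_nonpos (neg_nonpos.2 h.le)]
    push_cast; ring

theorem conj_roots_of_quadDisc_neg {q : Fin 2 → ℝ} (h : quadDisc q < 0) :
    0 < (highRoot q).im ∧ lowRoot q = starRingEnd ℂ (highRoot q) := by
  have h0 := Real.sqrt_pos.2 (neg_pos.2 h)
  rw [highRoot, lowRoot, sqrtDisc, Real.sqrt_eq_zero_of_nonpos h.le]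
  constructor
  · simpa using h0
  · have h2 : (starRingEnd ℂ) 2 = 2 := map_ofNat _ 2
    apply Complex.ext <;> simp [h2]

/-- For a monic first argument the resultant is the product of the values of the second at the roots
of the first. -/
theorem ofReal_resultant {q g : ℝ[X]} {a b : ℂ}
    (hq : q.map (algebraMap ℝ ℂ) = (X - C a) * (X - C b)) :
    ((resultant q g : ℝ) : ℂ) =
      (g.map (algebraMap ℝ ℂ)).eval a * (g.map (algebraMap ℝ ℂ)).eval b := by
  have h0 : (X - C a) * (X - C b) ≠ 0 := mul_ne_zero (X_sub_C_ne_zero a) (X_sub_C_ne_zero b)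
  have h1 := resultant_map_map q g q.natDegree g.natDegree (algebraMap ℝ ℂ)
  rw [Complex.coe_algebraMap] at h1
  have h2 := resultant_eq_prod_eval (q.map (algebraMap ℝ ℂ)) (g.map (algebraMap ℝ ℂ)) g.natDegree
    natDegree_map_le (IsAlgClosed.splits _)
  rw [natDegree_map, h1, hq, roots_mul h0, roots_X_sub_C, roots_X_sub_C] at h2
  simpa [leadingCoeff_mul] using h2

end RootPair

/-! ### Signs of the derivative at real roots, and conjugate pairs -/

section SignedCount

open Polynomial

theorem real_sign_mul (x y : ℝ) : Real.sign (x * y) = Real.sign x * Real.sign y := by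
  rcases lt_trichotomy x 0 with hx | rfl | hx <;> rcases lt_trichotomy y 0 with hy | rfl | hy <;>
    simp [Real.sign_of_neg, Real.sign_of_pos, *, mul_pos_of_neg_of_neg, mul_neg_of_neg_of_pos,
      mul_neg_of_pos_of_neg]

/-- The alternating count of the points of a finite set of reals. -/
theorem sum_sign_prod_sub (A : Finset ℝ) :
    ∑ a ∈ A, Real.sign (∏ b ∈ A.erase a, (a - b)) = (A.card % 2 : ℕ) := by
  induction A using Finset.induction_on_max with
  | empty => simp
  | insert m s hm ih =>
    have hms : m ∉ s := fun h => lt_irrefl _ (hm m h)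
    rw [Finset.sum_insert hms, Finset.erase_insert hms, Finset.card_insert_of_notMem hms,
      Real.sign_of_pos (Finset.prod_pos fun b hb => sub_pos.2 (hm b hb))]
    -- A new maximum contributes `+1` and flips every earlier sign, so the sum `S` becomes `1 - S`
    -- and alternates between `0` and `1`.
    have h1 : ∑ a ∈ s, Real.sign (∏ b ∈ (insert m s).erase a, (a - b)) =
        ∑ a ∈ s, -Real.sign (∏ b ∈ s.erase a, (a - b)) := by
      refine Finset.sum_congr rfl fun a ha => ?_
      have hma : m ≠ a := (hm a ha).ne'
      rw [Finset.erase_insert_of_ne hma, Finset.prod_insert (by simp [hms]), real_sign_mul,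
        Real.sign_of_neg (sub_neg.2 (hm a ha)), neg_one_mul]
    rw [h1, Finset.sum_neg_distrib, ih]
    rcases Nat.mod_two_eq_zero_or_one s.card with h | h
    · rw [h, show (s.card + 1) % 2 = 1 by omega]; simp
    · rw [h, show (s.card + 1) % 2 = 0 by omega]; simp

/-- Expand the square: the diagonal contributes `1` per element, and the two off-diagonal halves
agree by symmetry. -/
theorem sum_offDiag_lt_mul {A : Finset ℝ} {ε : ℝ → ℝ} (hε : ∀ a ∈ A, ε a ^ 2 = 1) :
    2 * ∑ p ∈ (A ×ˢ A).filter (fun p => p.1 < p.2), ε p.1 * ε p.2 =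
      (∑ a ∈ A, ε a) ^ 2 - A.card := by
  have h1 : (∑ a ∈ A, ε a) ^ 2 = ∑ p ∈ A ×ˢ A, ε p.1 * ε p.2 := by
    rw [sq, Finset.sum_mul_sum, Finset.sum_product]
  have h2 : ∑ p ∈ (A ×ˢ A).filter (fun p => p.2 < p.1), ε p.1 * ε p.2 =
      ∑ p ∈ (A ×ˢ A).filter (fun p => p.1 < p.2), ε p.1 * ε p.2 := by
    refine Finset.sum_nbij' Prod.swap Prod.swap ?_ ?_ ?_ ?_ ?_
    · simp +contextual
    · simp +contextual
    · simp
    · simp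
    · intro p _
      simp [mul_comm]
  have h3 : ∑ p ∈ (A ×ˢ A).filter (fun p => p.1 = p.2), ε p.1 * ε p.2 = A.card := by
    have : ∑ a ∈ A, ε a ^ 2 = A.card := by
      rw [Finset.sum_congr rfl hε]; simp
    rw [← this]
    refine Finset.sum_nbij' Prod.fst (fun a => (a, a)) ?_ ?_ ?_ ?_ ?_
    · simp +contextual
    · simp +contextual
    · rintro ⟨a, b⟩ h
      simp only [Finset.mem_filter] at h
      simp [h.2]
    · simp
    · rintro ⟨a, b⟩ h
      simp only [Finset.mem_filter] at h
      simp only at h ⊢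
      rw [← h.2, sq]
  rw [h1, ← h3, ← Finset.sum_filter_add_sum_filter_not (A ×ˢ A) (fun p => p.1 < p.2)]
  have h4 : (A ×ˢ A).filter (fun p => ¬ p.1 < p.2) =
      (A ×ˢ A).filter (fun p => p.2 < p.1) ∪ (A ×ˢ A).filter (fun p => p.1 = p.2) := by
    rw [← Finset.filter_or]
    refine Finset.filter_congr fun p _ => ?_
    rw [not_lt, le_iff_lt_or_eq, eq_comm (a := p.2)]
  rw [h4, Finset.sum_union, h2]
  · ring
  · refine Finset.disjoint_filter.2 fun p _ hp hp' => hp.ne' hp'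

/-- A nonconstant monic polynomial that is nonpositive somewhere to the left of a nonnegative value
has a root by the intermediate value theorem. Hence the factor without real roots does not affect
signs of the derivative. -/
theorem eval_pos_of_roots_eq_zero {h : ℝ[X]} (hm : h.Monic) (hr : h.roots = 0) (x : ℝ) :
    0 < h.eval x := by
  by_contra! hx
  have hne : ∀ y, h.eval y ≠ 0 := fun y hy => by
    have : y ∈ h.roots := (mem_roots hm.ne_zero).2 hy
    simp [hr] at this
  rcases Nat.eq_zero_or_pos h.natDegree with h0 | h0
  · rw [eq_one_of_monic_natDegree_zero hm h0] at hx
    norm_num at hx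
  · have ht := h.tendsto_atTop_of_leadingCoeff_nonneg (natDegree_pos_iff_degree_pos.1 h0)
      (by rw [hm.leadingCoeff]; exact zero_le_one)
    obtain ⟨y, hy, hxy⟩ := ((ht.eventually_ge_atTop 0).and (Filter.eventually_ge_atTop x)).exists
    obtain ⟨z, _, hz⟩ := intermediate_value_Icc hxy h.continuous.continuousOn ⟨hx, hy⟩
    exact hne z hz

/-- The signed number of real roots of a separable monic polynomial is the parity of their
number. -/
theorem sum_sign_derivative {f : ℝ[X]} (hf : f.Monic) (hs : f.Separable) :
    ∑ a ∈ f.roots.toFinset, Real.sign (f.derivative.eval a) = (f.roots.toFinset.card % 2 : ℕ) := by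
  obtain ⟨h, hfh, _, hr⟩ := exists_prod_multiset_X_sub_C_mul f
  have hprod : (f.roots.map fun a => X - C a).prod = ∏ a ∈ f.roots.toFinset, (X - C a) := by
    rw [Finset.prod_eq_multiset_prod, Multiset.toFinset_val, (nodup_roots hs).dedup]
  have hpm : (∏ a ∈ f.roots.toFinset, (X - C a)).Monic := monic_prod_X_sub_C _ _
  rw [hprod] at hfh
  have hm : h.Monic := hpm.of_mul_monic_left (hfh.symm ▸ hf)
  rw [← sum_sign_prod_sub]
  refine Finset.sum_congr rfl fun a ha => ?_
  have h1 : f.derivative.eval a = (∏ b ∈ f.roots.toFinset.erase a, (a - b)) * h.eval a := by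
    conv_lhs => rw [← hfh, ← Finset.mul_prod_erase _ _ ha]
    simp [derivative_mul, eval_prod]
  rw [h1, real_sign_mul, Real.sign_of_pos (eval_pos_of_roots_eq_zero hm hr a), mul_one]

/-- The roots of a real polynomial in the upper half plane. -/
noncomputable def upperRoots (f : ℝ[X]) : Finset ℂ := by
  classical exact (f.map (algebraMap ℝ ℂ)).roots.toFinset.filter (fun z => 0 < z.im)

theorem mem_upperRoots {f : ℝ[X]} (hf : f ≠ 0) (z : ℂ) :
    z ∈ upperRoots f ↔ (f.map (algebraMap ℝ ℂ)).eval z = 0 ∧ 0 < z.im := by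
  classical
  have : f.map (algebraMap ℝ ℂ) ≠ 0 := Polynomial.map_ne_zero hf
  simp [upperRoots, this]

theorem eval_map_conj (f : ℝ[X]) (z : ℂ) :
    (f.map (algebraMap ℝ ℂ)).eval (starRingEnd ℂ z) =
      starRingEnd ℂ ((f.map (algebraMap ℝ ℂ)).eval z) := by
  rw [eval_map_algebraMap, eval_map_algebraMap]
  exact (aeval_conj f z)

theorem eval_map_ofReal (f : ℝ[X]) (x : ℝ) :
    (f.map (algebraMap ℝ ℂ)).eval (x : ℂ) = (f.eval x : ℝ) := by
  rw [eval_map_algebraMap, ← Complex.coe_algebraMap, aeval_algebraMap_apply, coe_aeval_eq_eval]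

/-- Over `ℂ` all roots are simple by separability, and conjugation matches the lower half plane
roots with the upper ones. -/
theorem card_roots_add_two_mul_card_upperRoots {f : ℝ[X]} (hs : f.Separable) :
    f.roots.toFinset.card + 2 * (upperRoots f).card = f.natDegree := by
  classical
  have hf : f ≠ 0 := hs.ne_zero
  have hfC : f.map (algebraMap ℝ ℂ) ≠ 0 := Polynomial.map_ne_zero hf
  set Z := (f.map (algebraMap ℝ ℂ)).roots.toFinset with hZ
  have hmem : ∀ z, z ∈ Z ↔ (f.map (algebraMap ℝ ℂ)).eval z = 0 := by
    intro z; simp [hZ, hfC]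
  have hcard : Z.card = f.natDegree := by
    rw [hZ, Multiset.toFinset_card_of_nodup (nodup_roots hs.map),
      IsAlgClosed.card_roots_map_eq_natDegree_of_leadingCoeff_ne_zero]
    simpa using hf
  have h1 : (Z.filter fun z => z.im = 0).card = f.roots.toFinset.card := by
    symm
    refine Finset.card_bij (fun a _ => (a : ℂ)) ?_ ?_ ?_
    · intro a ha
      simp only [Multiset.mem_toFinset, mem_roots hf, IsRoot.def] at ha
      rw [Finset.mem_filter, hmem, eval_map_ofReal, ha]
      simp
    · intro a _ b _ h
      exact_mod_cast h
    · intro z hz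
      rw [Finset.mem_filter, hmem] at hz
      have hz' : ((z.re : ℝ) : ℂ) = z := Complex.ext (by simp) (by simp [hz.2])
      refine ⟨z.re, ?_, hz'⟩
      rw [← hz', eval_map_ofReal] at hz
      simpa [hf] using hz.1
  have h2 : (Z.filter fun z => z.im < 0).card = (upperRoots f).card := by
    refine Finset.card_nbij' (starRingEnd ℂ) (starRingEnd ℂ) ?_ ?_ ?_ ?_
    · intro z hz
      simp only [Finset.coe_filter, Set.mem_ofPred_eq, hmem] at hz
      rw [Finset.mem_coe, mem_upperRoots hf, eval_map_conj, hz.1]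
      simpa using hz.2
    · intro z hz
      rw [Finset.mem_coe, mem_upperRoots hf] at hz
      simp only [Finset.coe_filter, Set.mem_ofPred_eq, hmem, eval_map_conj, hz.1]
      simpa using hz.2
    · intro z _; simp
    · intro z _; simp
  have h3 : (Z.filter fun z => 0 < z.im).card = (upperRoots f).card := rfl
  have h4 := Finset.card_filter_add_card_filter_not (s := Z) (fun z => z.im = 0)
  have h5 := Finset.card_filter_add_card_filter_not (s := Z.filter fun z => ¬ z.im = 0)
    (fun z => z.im < 0)
  rw [Finset.filter_filter, Finset.filter_filter] at h5
  have h6 : (Z.filter fun z => ¬ z.im = 0 ∧ z.im < 0) = Z.filter fun z => z.im < 0 :=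
    Finset.filter_congr fun z _ => ⟨fun h => h.2, fun h => ⟨h.ne, h⟩⟩
  have h7 : (Z.filter fun z => ¬ z.im = 0 ∧ ¬ z.im < 0) = Z.filter fun z => 0 < z.im :=
    Finset.filter_congr fun z _ => ⟨fun h => lt_of_le_of_ne (not_lt.1 h.2) (Ne.symm h.1),
      fun h => ⟨h.ne', not_lt.2 h.le⟩⟩
  rw [h6, h7, h2, h3] at h5
  omega

end SignedCount

/-! ### The signed fibre of multiplication by a quadratic -/

section Fibre

open Polynomial

variable {M : ℕ}

open Classical in
/-- The ordered pairs of roots `(a, b)` of `f` with `a < b` real, or `a = conj b` and `b` in the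
upper half plane. -/
noncomputable def rootPairs (f : ℝ[X]) : Finset (ℂ × ℂ) :=
    ((f.roots.toFinset ×ˢ f.roots.toFinset).filter fun p => p.1 < p.2).image
      (fun p => ((p.1 : ℂ), (p.2 : ℂ))) ∪
    (upperRoots f).image fun β => (starRingEnd ℂ β, β)

theorem mem_rootPairs {f : ℝ[X]} (hf : f ≠ 0) (p : ℂ × ℂ) : p ∈ rootPairs f ↔
    (∃ x y : ℝ, x < y ∧ f.eval x = 0 ∧ f.eval y = 0 ∧ p = (↑x, ↑y)) ∨
      ∃ β : ℂ, 0 < β.im ∧ (f.map (algebraMap ℝ ℂ)).eval β = 0 ∧ p = (starRingEnd ℂ β, β) := by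
  classical
  simp only [rootPairs, Finset.mem_union, Finset.mem_image, Finset.mem_filter, Finset.mem_product,
    Multiset.mem_toFinset, mem_roots hf, IsRoot.def, mem_upperRoots hf, Prod.exists]
  constructor
  · rintro (⟨x, y, ⟨⟨h1, h2⟩, h3⟩, rfl⟩ | ⟨β, ⟨h1, h2⟩, rfl⟩)
    · exact Or.inl ⟨x, y, h3, h1, h2, rfl⟩
    · exact Or.inr ⟨β, h2, h1, rfl⟩
  · rintro (⟨x, y, h3, h1, h2, rfl⟩ | ⟨β, h2, h1, rfl⟩)
    · exact Or.inl ⟨x, y, ⟨⟨h1, h2⟩, h3⟩, rfl⟩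
    · exact Or.inr ⟨β, ⟨h1, h2⟩, rfl⟩

theorem sum_rootPairs (f : ℝ[X]) (hf : f ≠ 0) (u : ℂ × ℂ → ℝ) :
    ∑ p ∈ rootPairs f, u p =
      ∑ p ∈ (f.roots.toFinset ×ˢ f.roots.toFinset).filter (fun p => p.1 < p.2),
        u ((p.1 : ℂ), (p.2 : ℂ)) + ∑ β ∈ upperRoots f, u (starRingEnd ℂ β, β) := by
  classical
  rw [rootPairs, Finset.sum_union, Finset.sum_image, Finset.sum_image]
  · rintro β _ γ _ h
    exact (Prod.ext_iff.1 h).2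
  · rintro ⟨x, y⟩ _ ⟨x', y'⟩ _ h
    simpa using h
  · rw [Finset.disjoint_left]
    rintro _ h1 h2
    obtain ⟨p, _, rfl⟩ := Finset.mem_image.1 h1
    obtain ⟨β, hβ, h⟩ := Finset.mem_image.1 h2
    rw [mem_upperRoots hf] at hβ
    have h3 : β = p.2 := (Prod.ext_iff.1 h).2
    rw [h3] at hβ
    simp at hβ

theorem roots_pairCoeff_of_mem {f : ℝ[X]} (hf : f ≠ 0) {p : ℂ × ℂ} (hp : p ∈ rootPairs f) :
    lowRoot (pairCoeff p.1 p.2) = p.1 ∧ highRoot (pairCoeff p.1 p.2) = p.2 ∧ p.1 ≠ p.2 ∧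
      (f.map (algebraMap ℝ ℂ)).eval p.1 = 0 ∧ (f.map (algebraMap ℝ ℂ)).eval p.2 = 0 := by
  rw [mem_rootPairs hf] at hp
  rcases hp with ⟨x, y, hxy, hx, hy, rfl⟩ | ⟨β, hβ, h, rfl⟩
  · refine ⟨(roots_pairCoeff_ofReal hxy).1, (roots_pairCoeff_ofReal hxy).2, ?_, ?_, ?_⟩
    · exact fun h => hxy.ne (Complex.ofReal_injective h)
    · rw [eval_map_ofReal, hx, Complex.ofReal_zero]
    · rw [eval_map_ofReal, hy, Complex.ofReal_zero]
  · refine ⟨(roots_pairCoeff_conj hβ).1, (roots_pairCoeff_conj hβ).2, ?_, ?_, h⟩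
    · intro h'
      have := congrArg Complex.im h'
      simp only [Complex.conj_im] at this
      linarith
    · simp only [eval_map_conj, h, map_zero]

/-- The factorisation of `f` whose quadratic factor has the given pair of roots. -/
noncomputable def factorOfPair (f : ℝ[X]) (M : ℕ) (p : ℂ × ℂ) : Fin (2 + M) → ℝ :=
  Fin.addCases (pairCoeff p.1 p.2) fun j => (f /ₘ monicPoly (pairCoeff p.1 p.2)).coeff j

theorem mulMap_factorOfPair {y : Fin (2 + M) → ℝ} {p : ℂ × ℂ}
    (hp : p ∈ rootPairs (monicPoly y)) :
    mulMap 2 M (factorOfPair (monicPoly y) M p) = y := by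
  have hf := (monic_monicPoly y).ne_zero
  obtain ⟨h1, h2, h3, h4, h5⟩ := roots_pairCoeff_of_mem hf hp
  have hdvd : monicPoly (pairCoeff p.1 p.2) ∣ monicPoly y := by
    rw [← map_dvd_map' (algebraMap ℝ ℂ), map_monicPoly_two, h1, h2]
    exact (isCoprime_X_sub_C_of_isUnit_sub (sub_ne_zero.2 h3).isUnit).mul_dvd
      (dvd_iff_isRoot.2 h4) (dvd_iff_isRoot.2 h5)
  obtain ⟨g, hg⟩ := hdvd
  have hq := monic_monicPoly (pairCoeff p.1 p.2)
  have hgm : g.Monic := hq.of_mul_monic_left (hg ▸ monic_monicPoly y)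
  have hgd : g.natDegree = M := by
    have := congrArg natDegree hg
    rw [hq.natDegree_mul hgm, natDegree_monicPoly, natDegree_monicPoly] at this
    omega
  apply monicPoly_injective
  rw [monicPoly_mulMap]
  simp only [factorOfPair, Fin.addCases_left, Fin.addCases_right]
  rw [hg, mul_divByMonic_cancel_left _ hq, monicPoly_coeff hgm hgd]

/-- A double root of the quadratic factor would be a square factor of the product over `ℂ`. -/
theorem lowRoot_ne_highRoot_of_mulMap {x : Fin (2 + M) → ℝ}
    (hs : (monicPoly (mulMap 2 M x)).Separable) :
    lowRoot (fun j => x (Fin.castAdd M j)) ≠ highRoot (fun j => x (Fin.castAdd M j)) := by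
  rw [monicPoly_mulMap] at hs
  have h := (hs.of_mul_left.map (f := algebraMap ℝ ℂ)).squarefree
  rw [map_monicPoly_two] at h
  intro heq
  rw [heq] at h
  exact (irreducible_X_sub_C _).not_isUnit (h _ dvd_rfl)

theorem roots_mem_rootPairs {x : Fin (2 + M) → ℝ}
    (hs : (monicPoly (mulMap 2 M x)).Separable) :
    (lowRoot (fun j => x (Fin.castAdd M j)), highRoot (fun j => x (Fin.castAdd M j))) ∈
      rootPairs (monicPoly (mulMap 2 M x)) := by
  have hne := lowRoot_ne_highRoot_of_mulMap hs
  set q : Fin 2 → ℝ := fun j => x (Fin.castAdd M j) with hq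
  have hmap : (monicPoly (mulMap 2 M x)).map (algebraMap ℝ ℂ) =
      (X - C (lowRoot q)) * (X - C (highRoot q)) *
        (monicPoly fun j => x (Fin.natAdd 2 j)).map (algebraMap ℝ ℂ) := by
    rw [monicPoly_mulMap, Polynomial.map_mul, map_monicPoly_two]
  have e1 : ((monicPoly (mulMap 2 M x)).map (algebraMap ℝ ℂ)).eval (lowRoot q) = 0 := by
    simp [hmap]
  have e2 : ((monicPoly (mulMap 2 M x)).map (algebraMap ℝ ℂ)).eval (highRoot q) = 0 := by
    simp [hmap]
  rw [mem_rootPairs (monic_monicPoly _).ne_zero]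
  rcases lt_trichotomy (quadDisc q) 0 with h | h | h
  · obtain ⟨h1, h2⟩ := conj_roots_of_quadDisc_neg h
    exact Or.inr ⟨_, h1, e2, by rw [h2]⟩
  · exact absurd ((quadDisc_eq_zero_iff q).1 h) hne
  · obtain ⟨a, b, hab, ha, hb⟩ := exists_real_roots_of_quadDisc_pos h
    rw [ha, eval_map_ofReal] at e1
    rw [hb, eval_map_ofReal] at e2
    exact Or.inl ⟨a, b, hab, by exact_mod_cast e1, by exact_mod_cast e2, by rw [ha, hb]⟩

theorem factorOfPair_roots (x : Fin (2 + M) → ℝ) :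
    factorOfPair (monicPoly (mulMap 2 M x)) M
      (lowRoot (fun j => x (Fin.castAdd M j)), highRoot (fun j => x (Fin.castAdd M j))) = x := by
  ext i
  refine Fin.addCases (fun j => ?_) (fun j => ?_) i
  · simp [factorOfPair]
  · simp only [factorOfPair, Fin.addCases_right, pairCoeff_lowRoot_highRoot]
    rw [monicPoly_mulMap, mul_divByMonic_cancel_left _ (monic_monicPoly _), coeff_monicPoly_fin]

/-- With `f = (X - a)(X - b) g` the Jacobian is `g(a) g(b)`, while `f'(a) = (a - b) g(a)` and `f'(b)
= (b - a) g(b)`. For real roots `f'(a) f'(b) = -(a - b)² g(a) g(b)`; for conjugate roots the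
Jacobian is `|g(β)|²`. -/
theorem sign_det_mulMapDeriv_factorOfPair {y : Fin (2 + M) → ℝ}
    (hs : (monicPoly y).Separable) :
    (∀ a b : ℝ, ((a : ℂ), (b : ℂ)) ∈ rootPairs (monicPoly y) →
      Real.sign (mulMapDeriv 2 M (factorOfPair (monicPoly y) M (a, b))).det =
        -(Real.sign ((monicPoly y).derivative.eval a) *
          Real.sign ((monicPoly y).derivative.eval b))) ∧
    ∀ β : ℂ, (starRingEnd ℂ β, β) ∈ rootPairs (monicPoly y) →
      Real.sign (mulMapDeriv 2 M (factorOfPair (monicPoly y) M (starRingEnd ℂ β, β))).det = 1 := by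
  have hf := (monic_monicPoly y).ne_zero
  have key : ∀ p ∈ rootPairs (monicPoly y), ∃ g : ℝ[X],
      ((mulMapDeriv 2 M (factorOfPair (monicPoly y) M p)).det : ℂ) =
        (g.map (algebraMap ℝ ℂ)).eval p.1 * (g.map (algebraMap ℝ ℂ)).eval p.2 ∧
      ((monicPoly y).derivative.map (algebraMap ℝ ℂ)).eval p.1 =
        (p.1 - p.2) * (g.map (algebraMap ℝ ℂ)).eval p.1 ∧
      ((monicPoly y).derivative.map (algebraMap ℝ ℂ)).eval p.2 =
        (p.2 - p.1) * (g.map (algebraMap ℝ ℂ)).eval p.2 ∧ p.1 ≠ p.2 := by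
    intro p hp
    obtain ⟨h1, h2, h3, -, -⟩ := roots_pairCoeff_of_mem hf hp
    have hm := congrArg monicPoly (mulMap_factorOfPair hp)
    rw [monicPoly_mulMap] at hm
    set x := factorOfPair (monicPoly y) M p with hx
    have hq : (fun j => x (Fin.castAdd M j)) = pairCoeff p.1 p.2 := by
      ext j; simp [hx, factorOfPair]
    rw [hq] at hm
    have hqm := map_monicPoly_two (pairCoeff p.1 p.2)
    rw [h1, h2] at hqm
    refine ⟨monicPoly fun j => x (Fin.natAdd 2 j), ?_, ?_, ?_, h3⟩
    · rw [det_mulMapDeriv, hq, ofReal_resultant hqm]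
    · rw [← derivative_map, ← hm, Polynomial.map_mul, hqm]
      simp [derivative_mul]
    · rw [← derivative_map, ← hm, Polynomial.map_mul, hqm]
      simp [derivative_mul]
  constructor
  · intro a b hp
    obtain ⟨g, h1, h2, h3, hab⟩ := key _ hp
    simp only [eval_map_ofReal] at h1 h2 h3
    have hab' : a - b ≠ 0 := sub_ne_zero.2 fun h => hab (by simp [h])
    have h1' : (mulMapDeriv 2 M (factorOfPair (monicPoly y) M (a, b))).det =
        g.eval a * g.eval b := by exact_mod_cast h1
    have h2' : (monicPoly y).derivative.eval a = (a - b) * g.eval a := by exact_mod_cast h2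
    have h3' : (monicPoly y).derivative.eval b = (b - a) * g.eval b := by exact_mod_cast h3
    have h4 : (monicPoly y).derivative.eval a * (monicPoly y).derivative.eval b =
        -((a - b) ^ 2 * (mulMapDeriv 2 M (factorOfPair (monicPoly y) M (a, b))).det) := by
      rw [h1', h2', h3']; ring
    rw [← real_sign_mul, h4, Real.sign_neg, neg_neg, real_sign_mul, Real.sign_of_pos (sq_pos_of_ne_zero hab'),
      one_mul]
  · intro β hp
    obtain ⟨g, h1, -, h3, hab⟩ := key _ hp
    obtain ⟨-, -, -, -, h5⟩ := roots_pairCoeff_of_mem hf hp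
    simp only [eval_map_conj] at h1 h3
    -- Otherwise `f` and `f'` would both vanish at `β`, against separability.
    have hg0 : (g.map (algebraMap ℝ ℂ)).eval β ≠ 0 := by
      intro h0
      rw [h0, mul_zero] at h3
      obtain ⟨u, v, huv⟩ := hs.map (f := algebraMap ℝ ℂ)
      have := congrArg (eval β) huv
      rw [derivative_map] at this
      simp [-eval_map_algebraMap, h5, h3] at this
    apply Real.sign_of_pos
    rw [← Complex.normSq_eq_conj_mul_self] at h1
    have h1' := Complex.ofReal_injective h1
    rw [h1']
    exact Complex.normSq_pos.2 hg0

/-- The signed number of factorisations of a separable monic polynomial of degree `2 + M` into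
monic factors of degrees `2` and `M` is the integer part of `(2 + M) / 2`. -/
theorem exists_fibre_mulMap {y : Fin (2 + M) → ℝ} (hs : (monicPoly y).Separable) :
    ∃ S : Finset (Fin (2 + M) → ℝ), (∀ x, x ∈ S ↔ mulMap 2 M x = y) ∧
      S.card ≤ (2 + M) * (2 + M) + (2 + M) ∧
      ∑ x ∈ S, Real.sign (mulMapDeriv 2 M x).det = (((2 + M) / 2 : ℕ) : ℝ) := by
  classical
  have hf := (monic_monicPoly y).ne_zero
  -- The pair is recovered from the factorisation as the ordered roots of the quadratic factor.
  have hinj : Set.InjOn (factorOfPair (monicPoly y) M) (rootPairs (monicPoly y)) := by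
    intro p hp p' hp' h
    have hq : pairCoeff p.1 p.2 = pairCoeff p'.1 p'.2 := by
      ext j
      have := congrFun h (Fin.castAdd M j)
      simpa [factorOfPair] using this
    obtain ⟨h1, h2, -⟩ := roots_pairCoeff_of_mem hf hp
    obtain ⟨h1', h2', -⟩ := roots_pairCoeff_of_mem hf hp'
    exact Prod.ext (by rw [← h1, hq, h1']) (by rw [← h2, hq, h2'])
  have hcount := card_roots_add_two_mul_card_upperRoots hs
  rw [natDegree_monicPoly] at hcount
  refine ⟨(rootPairs (monicPoly y)).image (factorOfPair (monicPoly y) M), fun x => ?_, ?_, ?_⟩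
  · rw [Finset.mem_image]
    constructor
    · rintro ⟨p, hp, rfl⟩
      exact mulMap_factorOfPair hp
    · rintro rfl
      exact ⟨_, roots_mem_rootPairs hs, factorOfPair_roots x⟩
  · refine Finset.card_image_le.trans ?_
    rw [rootPairs]
    refine (Finset.card_union_le _ _).trans (Nat.add_le_add ?_ ?_)
    · refine Finset.card_image_le.trans ((Finset.card_filter_le _ _).trans ?_)
      rw [Finset.card_product]
      exact Nat.mul_le_mul (by omega) (by omega)
    · exact Finset.card_image_le.trans (by omega)
  · obtain ⟨hR, hC⟩ := sign_det_mulMapDeriv_factorOfPair hs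
    rw [Finset.sum_image hinj, sum_rootPairs _ hf]
    have e1 : ∀ p ∈ ((monicPoly y).roots.toFinset ×ˢ (monicPoly y).roots.toFinset).filter
        (fun p => p.1 < p.2), Real.sign (mulMapDeriv 2 M
          (factorOfPair (monicPoly y) M ((p.1 : ℂ), (p.2 : ℂ)))).det =
        -(Real.sign ((monicPoly y).derivative.eval p.1) *
          Real.sign ((monicPoly y).derivative.eval p.2)) := by
      intro p hp
      refine hR p.1 p.2 (Finset.mem_union_left _ (Finset.mem_image_of_mem _ hp))
    have e2 : ∀ β ∈ upperRoots (monicPoly y), Real.sign (mulMapDeriv 2 M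
        (factorOfPair (monicPoly y) M (starRingEnd ℂ β, β))).det = 1 := by
      intro β hβ
      exact hC β (Finset.mem_union_right _ (Finset.mem_image_of_mem _ hβ))
    rw [Finset.sum_congr rfl e1, Finset.sum_congr rfl e2, Finset.sum_neg_distrib]
    have hε : ∀ a ∈ (monicPoly y).roots.toFinset,
        Real.sign ((monicPoly y).derivative.eval a) ^ 2 = 1 := by
      intro a ha
      have ha' : (monicPoly y).eval a = 0 := by simpa [hf] using ha
      have hne : (monicPoly y).derivative.eval a ≠ 0 := by
        intro h0
        obtain ⟨u, v, huv⟩ := hs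
        have := congrArg (eval a) huv
        simp [ha', h0] at this
      rcases Real.sign_apply_eq_of_ne_zero _ hne with h | h <;> rw [h] <;> norm_num
    -- With `r` real roots the signs sum to `r mod 2`, so the real pairs contribute `(r - (r mod 2))
    -- / 2`. Adding the number `c` of conjugate pairs, where `r + 2c = 2 + M`, gives the integer
    -- part of `(2 + M) / 2`.
    have h1 := sum_offDiag_lt_mul hε
    rw [sum_sign_derivative (monic_monicPoly y) hs] at h1
    have h2 : (((monicPoly y).roots.toFinset.card % 2 : ℕ) : ℝ) ^ 2 = ((2 + M) % 2 : ℕ) := by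
      rw [show (2 + M) % 2 = (monicPoly y).roots.toFinset.card % 2 by omega]
      rcases Nat.mod_two_eq_zero_or_one (monicPoly y).roots.toFinset.card with h | h <;>
        rw [h] <;> norm_num
    have h3 : ((monicPoly y).roots.toFinset.card : ℝ) + 2 * (upperRoots (monicPoly y)).card =
        (2 + M : ℕ) := by exact_mod_cast hcount
    have h4 : (((2 + M) % 2 : ℕ) : ℝ) + 2 * ((2 + M) / 2 : ℕ) = (2 + M : ℕ) := by
      exact_mod_cast Nat.mod_add_div (2 + M) 2
    rw [h2] at h1
    rw [Finset.sum_const, nsmul_eq_mul, mul_one]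
    linarith

end Fibre

/-! ### Iterated factorisation into quadratics -/

section Chain

open Polynomial

variable {m M n : ℕ}

/-- Splitting a vector of length `m + M` into vectors of lengths `m` and `M`. -/
def finAppendEquiv (m M : ℕ) : (Fin (m + M) → ℝ) ≃ᵐ (Fin m → ℝ) × (Fin M → ℝ) :=
  (MeasurableEquiv.arrowCongr' finSumFinEquiv.symm (MeasurableEquiv.refl ℝ)).trans
    (MeasurableEquiv.sumPiEquivProdPi fun _ => ℝ)

theorem finAppendEquiv_apply (x : Fin (m + M) → ℝ) : finAppendEquiv m M x =
    (fun j => x (Fin.castAdd M j), fun j => x (Fin.natAdd m j)) := rfl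

theorem measurePreserving_finAppendEquiv : MeasurePreserving (finAppendEquiv m M) :=
  (volume_preserving_arrowCongr' _ _ (MeasurePreserving.id _)).trans
    (volume_measurePreserving_sumPiEquivProdPi fun _ => ℝ)

/-- Integration over monic polynomials of degree `2 + M` through factorisations into monic factors
of degrees `2` and `M`. -/
theorem integral_resultant_smul_mul (M : ℕ) {h : ℝ[X] → ℂ}
    (hh : Integrable fun b : Fin (2 + M) → ℝ => h (monicPoly b)) :
    Integrable (fun p : (Fin 2 → ℝ) × (Fin M → ℝ) =>
      resultant (monicPoly p.1) (monicPoly p.2) • h (monicPoly p.1 * monicPoly p.2)) ∧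
    ∫ p : (Fin 2 → ℝ) × (Fin M → ℝ),
      ‖resultant (monicPoly p.1) (monicPoly p.2) • h (monicPoly p.1 * monicPoly p.2)‖ ≤
        (2 * ((2 + M) * (2 + M) + (2 + M)) : ℕ) * ∫ b : Fin (2 + M) → ℝ, ‖h (monicPoly b)‖ ∧
    ∫ p : (Fin 2 → ℝ) × (Fin M → ℝ),
      resultant (monicPoly p.1) (monicPoly p.2) • h (monicPoly p.1 * monicPoly p.2) =
        (((2 + M) / 2 : ℕ) : ℝ) • ∫ b : Fin (2 + M) → ℝ, h (monicPoly b) := by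
  have hfib : ∀ᵐ y : Fin (2 + M) → ℝ, ∃ S : Finset (Fin (2 + M) → ℝ),
      (∀ x, x ∈ S ↔ mulMap 2 M x = y) ∧ S.card ≤ (2 + M) * (2 + M) + (2 + M) ∧
      ∑ x ∈ S, Real.sign (mulMapDeriv 2 M x).det = (((2 + M) / 2 : ℕ) : ℝ) := by
    filter_upwards [ae_separable_monicPoly (2 + M)] with y hy using exists_fibre_mulMap hy
  obtain ⟨h1, h2, h3⟩ := integral_det_smul_comp_eq volume (hasFDerivAt_mulMap (m := 2) (M := M))
    continuous_mulMapDeriv hfib hh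
  have e : (fun x : Fin (2 + M) → ℝ => (mulMapDeriv 2 M x).det • h (monicPoly (mulMap 2 M x))) =
      (fun p : (Fin 2 → ℝ) × (Fin M → ℝ) =>
        resultant (monicPoly p.1) (monicPoly p.2) • h (monicPoly p.1 * monicPoly p.2)) ∘
        finAppendEquiv 2 M := by
    ext x
    rw [Function.comp_apply, finAppendEquiv_apply, det_mulMapDeriv, monicPoly_mulMap]
  have hmp := measurePreserving_finAppendEquiv (m := 2) (M := M)
  have e' : ∀ x : Fin (2 + M) → ℝ, (mulMapDeriv 2 M x).det • h (monicPoly (mulMap 2 M x)) =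
      (fun p : (Fin 2 → ℝ) × (Fin M → ℝ) =>
        resultant (monicPoly p.1) (monicPoly p.2) • h (monicPoly p.1 * monicPoly p.2))
        (finAppendEquiv 2 M x) := fun x => congrFun e x
  refine ⟨?_, ?_, ?_⟩
  · rw [e] at h1
    exact (hmp.integrable_comp_emb (finAppendEquiv 2 M).measurableEmbedding).1 h1
  · simp_rw [e'] at h2
    rwa [hmp.integral_comp' (g := fun p : (Fin 2 → ℝ) × (Fin M → ℝ) =>
      ‖resultant (monicPoly p.1) (monicPoly p.2) • h (monicPoly p.1 * monicPoly p.2)‖)] at h2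
  · simp_rw [e'] at h3
    rwa [hmp.integral_comp' (g := fun p : (Fin 2 → ℝ) × (Fin M → ℝ) =>
      resultant (monicPoly p.1) (monicPoly p.2) • h (monicPoly p.1 * monicPoly p.2))] at h3

/-- The product of quadratic monic polynomials and a monic polynomial of degree `M`. -/
noncomputable def prodPoly {J : ℕ} (q : Fin J → Fin 2 → ℝ) (w : Fin M → ℝ) : ℝ[X] :=
  (∏ i, monicPoly (q i)) * monicPoly w

/-- The Jacobian of the multiplication map `(q, w) ↦ prodPoly q w`, built from resultants. -/
noncomputable def chainResultant (w : Fin M → ℝ) : (J : ℕ) → (Fin J → Fin 2 → ℝ) → ℝ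
  | 0, _ => 1
  | J + 1, q => resultant (monicPoly (q 0)) (prodPoly (fun i => q i.succ) w) *
      chainResultant w J fun i => q i.succ

theorem prodPoly_zero (q : Fin 0 → Fin 2 → ℝ) (w : Fin M → ℝ) : prodPoly q w = monicPoly w := by
  simp [prodPoly]

theorem prodPoly_succ {J : ℕ} (q : Fin (J + 1) → Fin 2 → ℝ) (w : Fin M → ℝ) :
    prodPoly q w = monicPoly (q 0) * prodPoly (fun i => q i.succ) w := by
  rw [prodPoly, prodPoly, Fin.prod_univ_succ, mul_assoc]

theorem monic_prodPoly {J : ℕ} (q : Fin J → Fin 2 → ℝ) (w : Fin M → ℝ) : (prodPoly q w).Monic :=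
  (monic_prod_of_monic _ _ fun _ _ => monic_monicPoly _).mul (monic_monicPoly _)

theorem natDegree_prodPoly {J : ℕ} (q : Fin J → Fin 2 → ℝ) (w : Fin M → ℝ) :
    (prodPoly q w).natDegree = 2 * J + M := by
  rw [prodPoly, (monic_prod_of_monic _ _ fun _ _ => monic_monicPoly _).natDegree_mul
    (monic_monicPoly _), natDegree_prod_of_monic _ _ fun _ _ => monic_monicPoly _]
  simp [mul_comm]

theorem continuous_coeff_mul {X : Type*} [TopologicalSpace X] {f g : X → ℝ[X]}
    (hf : ∀ k, Continuous fun x => (f x).coeff k) (hg : ∀ k, Continuous fun x => (g x).coeff k)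
    (k : ℕ) : Continuous fun x => (f x * g x).coeff k := by
  simp only [coeff_mul]
  exact continuous_finsetSum _ fun i _ => (hf _).mul (hg _)

theorem _root_.Continuous.coeff_monicPoly {X : Type*} [TopologicalSpace X] {b : X → Fin n → ℝ}
    (hb : Continuous b) (k : ℕ) : Continuous fun x => (monicPoly (b x)).coeff k :=
  (continuous_coeff_monicPoly k).comp hb

theorem _root_.Continuous.coeff_prodPoly {X : Type*} [TopologicalSpace X] {J : ℕ}
    {q : X → Fin J → Fin 2 → ℝ} {w : X → Fin M → ℝ} (hq : Continuous q) (hw : Continuous w)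
    (k : ℕ) : Continuous fun x => (prodPoly (q x) (w x)).coeff k := by
  induction J generalizing k with
  | zero =>
    simp only [prodPoly_zero]
    exact hw.coeff_monicPoly k
  | succ J ih =>
    simp only [prodPoly_succ]
    refine continuous_coeff_mul (fun k => ?_) (fun k => ?_) k
    · exact Continuous.coeff_monicPoly (by fun_prop) k
    · exact ih (q := fun x i => q x i.succ) (by fun_prop) k

theorem continuous_resultant {X : Type*} [TopologicalSpace X] {f g : X → ℝ[X]}
    (hf : ∀ k, Continuous fun x => (f x).coeff k) (hg : ∀ k, Continuous fun x => (g x).coeff k)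
    (hfd : ∀ x, (f x).natDegree = m) (hgd : ∀ x, (g x).natDegree = n) :
    Continuous fun x => resultant (f x) (g x) := by
  have : (fun x => resultant (f x) (g x)) = fun x => (sylvester (f x) (g x) m n).det := by
    ext x
    rw [resultant, hfd, hgd]
  rw [this]
  exact (continuous_sylvester hf hg).matrix_det

theorem _root_.Continuous.chainResultant {X : Type*} [TopologicalSpace X] {J : ℕ}
    {q : X → Fin J → Fin 2 → ℝ} {w : X → Fin M → ℝ} (hq : Continuous q) (hw : Continuous w) :
    Continuous fun x => chainResultant (w x) J (q x) := by
  induction J with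
  | zero => exact continuous_const
  | succ J ih =>
    simp only [MultDist.chainResultant]
    have hq' : Continuous fun x (i : Fin J) => q x i.succ := by fun_prop
    refine Continuous.mul ?_ (ih hq')
    exact continuous_resultant (f := fun x => monicPoly (q x 0))
      (g := fun x => prodPoly (fun i : Fin J => q x i.succ) (w x))
      (Continuous.coeff_monicPoly (by fun_prop)) (hq'.coeff_prodPoly hw)
      (fun x => natDegree_monicPoly _) (fun x => natDegree_prodPoly _ _)

/-- Splitting off the first quadratic factor. -/
def consEquiv (J M : ℕ) : (Fin (J + 1) → Fin 2 → ℝ) × (Fin M → ℝ) ≃ᵐ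
    (Fin 2 → ℝ) × ((Fin J → Fin 2 → ℝ) × (Fin M → ℝ)) :=
  ((MeasurableEquiv.piFinSuccAbove (fun _ : Fin (J + 1) => Fin 2 → ℝ) 0).prodCongr
    (MeasurableEquiv.refl (Fin M → ℝ))).trans MeasurableEquiv.prodAssoc

theorem consEquiv_apply (J M : ℕ) (p : (Fin (J + 1) → Fin 2 → ℝ) × (Fin M → ℝ)) :
    consEquiv J M p = (p.1 0, (fun i => p.1 i.succ, p.2)) := rfl

theorem measurePreserving_consEquiv (J M : ℕ) : MeasurePreserving (consEquiv J M) :=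
  ((volume_preserving_piFinSuccAbove (fun _ : Fin (J + 1) => Fin 2 → ℝ) 0).prod
    (MeasurePreserving.id volume)).trans
      (measurePreserving_prodAssoc (volume : Measure (Fin 2 → ℝ))
        (volume : Measure (Fin J → Fin 2 → ℝ)) (volume : Measure (Fin M → ℝ)))

theorem measurable_comp_mul {X : Type*} [MeasurableSpace X] [TopologicalSpace X]
    [OpensMeasurableSpace X] {h : ℝ[X] → ℂ}
    (hm : Measurable fun b : Fin n → ℝ => h (monicPoly b)) {f : X → ℝ[X]}
    (hf : ∀ k, Continuous fun x => (f x).coeff k) (hfm : ∀ x, (f x).Monic)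
    (hfd : ∀ x, (f x).natDegree = n) : Measurable fun x => h (f x) := by
  have : (fun x => h (f x)) = (fun b : Fin n → ℝ => h (monicPoly b)) ∘
      fun x (i : Fin n) => (f x).coeff i := by
    ext x
    rw [Function.comp_apply, monicPoly_coeff (hfm x) (hfd x)]
  rw [this]
  exact hm.comp (continuous_pi fun i : Fin n => hf (i : ℕ)).measurable

/-- Integration over monic polynomials of degree `2 * J + M` through factorisations into `J`
quadratic factors and one factor of degree `M`. -/
theorem integral_chainResultant_smul (M J : ℕ) : ∃ K : ℝ, ∀ n, n = 2 * J + M → ∀ h : ℝ[X] → ℂ,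
    (Measurable fun b : Fin n → ℝ => h (monicPoly b)) →
    (Integrable fun b : Fin n → ℝ => h (monicPoly b)) →
    Integrable (fun p : (Fin J → Fin 2 → ℝ) × (Fin M → ℝ) =>
      chainResultant p.2 J p.1 • h (prodPoly p.1 p.2)) ∧
    ∫ p : (Fin J → Fin 2 → ℝ) × (Fin M → ℝ), ‖chainResultant p.2 J p.1 • h (prodPoly p.1 p.2)‖ ≤
      K * ∫ b : Fin n → ℝ, ‖h (monicPoly b)‖ ∧
    ∫ p : (Fin J → Fin 2 → ℝ) × (Fin M → ℝ), chainResultant p.2 J p.1 • h (prodPoly p.1 p.2) =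
      (∏ i ∈ Finset.range J, (((2 + (2 * i + M)) / 2 : ℕ) : ℝ)) •
        ∫ b : Fin n → ℝ, h (monicPoly b) := by
  induction J with
  | zero =>
    refine ⟨1, fun n hn h hm hh => ?_⟩
    obtain rfl : n = M := by omega
    -- The empty product of measures is a point mass, so projecting it away preserves measure.
    have : IsProbabilityMeasure (volume : Measure (Fin 0 → Fin 2 → ℝ)) := by
      rw [volume_pi, Measure.pi_of_empty]
      infer_instance
    have hmp : MeasurePreserving (Prod.snd : (Fin 0 → Fin 2 → ℝ) × (Fin n → ℝ) → Fin n → ℝ) :=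
      measurePreserving_snd (μ := (volume : Measure (Fin 0 → Fin 2 → ℝ)))
        (ν := (volume : Measure (Fin n → ℝ)))
    simp only [chainResultant, prodPoly_zero, one_smul, Finset.range_zero, Finset.prod_empty,
      one_mul]
    refine ⟨hmp.integrable_comp_of_integrable hh, le_of_eq ?_, ?_⟩
    · rw [← hmp.map_eq, integral_map hmp.measurable.aemeasurable]
      rw [hmp.map_eq]
      exact hm.norm.aestronglyMeasurable
    · conv_rhs => rw [← hmp.map_eq]
      rw [integral_map hmp.measurable.aemeasurable]
      rw [hmp.map_eq]
      exact hm.aestronglyMeasurable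
  | succ J ih =>
    obtain ⟨K, hK⟩ := ih
    -- The bound of one splitting multiplies the inductive one. The absolute value is taken because
    -- `K` is not known to be nonnegative.
    refine ⟨|K| * (2 * ((2 + (2 * J + M)) * (2 + (2 * J + M)) + (2 + (2 * J + M))) : ℕ), ?_⟩
    intro n hn h hm hh
    obtain rfl : n = 2 + (2 * J + M) := by omega
    obtain ⟨hi1, hi2, hi3⟩ := integral_resultant_smul_mul (2 * J + M) hh
    -- For a fixed first factor the resultant is absorbed into the weight, which is then no longer
    -- multiplicative. This is why the induction runs over arbitrary `h`, with `K` chosen before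
    -- `h`: the uniform norm bound makes the inner integrals integrable in `q`.
    let hq : (Fin 2 → ℝ) → ℝ[X] → ℂ := fun q g => resultant (monicPoly q) g • h (monicPoly q * g)
    have hqm : ∀ q, Measurable fun b : Fin (2 * J + M) → ℝ => hq q (monicPoly b) := by
      intro q
      refine Measurable.smul (f := fun b => resultant (monicPoly q) (monicPoly b))
        (g := fun b => h (monicPoly q * monicPoly b)) ?_ (measurable_comp_mul hm ?_ ?_ ?_)
      · exact (continuous_resultant (fun k => continuous_const) continuous_coeff_monicPoly
          (fun _ => natDegree_monicPoly q) fun b => natDegree_monicPoly b).measurable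
      · exact continuous_coeff_mul (fun k => continuous_const) continuous_coeff_monicPoly
      · exact fun b => (monic_monicPoly q).mul (monic_monicPoly b)
      · intro b
        rw [(monic_monicPoly q).natDegree_mul (monic_monicPoly b), natDegree_monicPoly,
          natDegree_monicPoly]
    have hae : ∀ᵐ q : Fin 2 → ℝ, Integrable fun b : Fin (2 * J + M) → ℝ => hq q (monicPoly b) :=
      hi1.prod_right_ae
    let G : (Fin 2 → ℝ) × ((Fin J → Fin 2 → ℝ) × (Fin M → ℝ)) → ℂ := fun p =>
      chainResultant p.2.2 J p.2.1 • hq p.1 (prodPoly p.2.1 p.2.2)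
    have hGm : Measurable G := by
      have h1 : ∀ k, Continuous fun p : (Fin 2 → ℝ) × ((Fin J → Fin 2 → ℝ) × (Fin M → ℝ)) =>
          (monicPoly p.1).coeff k := continuous_fst.coeff_monicPoly
      have h2 : ∀ k, Continuous fun p : (Fin 2 → ℝ) × ((Fin J → Fin 2 → ℝ) × (Fin M → ℝ)) =>
          (prodPoly p.2.1 p.2.2).coeff k :=
        Continuous.coeff_prodPoly (by fun_prop) (by fun_prop)
      have h3 : Continuous fun p : (Fin 2 → ℝ) × ((Fin J → Fin 2 → ℝ) × (Fin M → ℝ)) =>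
          chainResultant p.2.2 J p.2.1 := Continuous.chainResultant (by fun_prop) (by fun_prop)
      have h4 : Continuous fun p : (Fin 2 → ℝ) × ((Fin J → Fin 2 → ℝ) × (Fin M → ℝ)) =>
          resultant (monicPoly p.1) (prodPoly p.2.1 p.2.2) :=
        continuous_resultant h1 h2 (fun _ => natDegree_monicPoly _)
          fun _ => natDegree_prodPoly _ _
      have h5 : Measurable fun p : (Fin 2 → ℝ) × ((Fin J → Fin 2 → ℝ) × (Fin M → ℝ)) =>
          h (monicPoly p.1 * prodPoly p.2.1 p.2.2) := by
        refine measurable_comp_mul hm (continuous_coeff_mul h1 h2)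
          (fun p => (monic_monicPoly _).mul (monic_prodPoly _ _)) fun p => ?_
        rw [(monic_monicPoly _).natDegree_mul (monic_prodPoly _ _), natDegree_monicPoly,
          natDegree_prodPoly]
      exact h3.measurable.smul (h4.measurable.smul h5)
    have hGint : ∀ᵐ q : Fin 2 → ℝ, Integrable (fun p => G (q, p)) ∧
        ∫ p, ‖G (q, p)‖ ≤ |K| * ∫ b : Fin (2 * J + M) → ℝ, ‖hq q (monicPoly b)‖ ∧
        ∫ p, G (q, p) = (∏ i ∈ Finset.range J, (((2 + (2 * i + M)) / 2 : ℕ) : ℝ)) •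
          ∫ b : Fin (2 * J + M) → ℝ, hq q (monicPoly b) := by
      filter_upwards [hae] with q hqi
      obtain ⟨h1, h2, h3⟩ := hK _ rfl (hq q) (hqm q) hqi
      refine ⟨h1, h2.trans (mul_le_mul_of_nonneg_right (le_abs_self K) ?_), h3⟩
      exact integral_nonneg fun _ => norm_nonneg _
    have hGi : Integrable G := by
      refine (integrable_prod_iff hGm.aestronglyMeasurable).2
        ⟨hGint.mono fun q hq => hq.1, Integrable.mono' (hi1.norm.integral_prod_left.const_mul |K|)
          hGm.aestronglyMeasurable.norm.integral_prod_right' ?_⟩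
      filter_upwards [hGint] with q hq
      rw [Real.norm_of_nonneg (integral_nonneg fun _ => norm_nonneg _)]
      exact hq.2.1
    have hmp := measurePreserving_consEquiv J M
    have e : ∀ p : (Fin (J + 1) → Fin 2 → ℝ) × (Fin M → ℝ),
        chainResultant p.2 (J + 1) p.1 • h (prodPoly p.1 p.2) = G (consEquiv J M p) := by
      intro p
      simp only [G, hq, consEquiv_apply, chainResultant]
      rw [prodPoly_succ, smul_smul, mul_comm]
    simp_rw [e]
    refine ⟨(hmp.integrable_comp_emb (consEquiv J M).measurableEmbedding).2 hGi, ?_, ?_⟩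
    · rw [hmp.integral_comp' (g := fun p => ‖G p‖)]
      calc ∫ p, ‖G p‖ = ∫ q, ∫ p, ‖G (q, p)‖ := integral_prod _ hGi.norm
        _ ≤ ∫ q, |K| * ∫ b : Fin (2 * J + M) → ℝ, ‖hq q (monicPoly b)‖ := by
          refine integral_mono_ae hGi.norm.integral_prod_left
            (hi1.norm.integral_prod_left.const_mul |K|) ?_
          filter_upwards [hGint] with q hq using hq.2.1
        _ = |K| * ∫ p : (Fin 2 → ℝ) × (Fin (2 * J + M) → ℝ), ‖hq p.1 (monicPoly p.2)‖ := by
          rw [integral_const_mul]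
          congr 1
          exact (integral_prod _ hi1.norm).symm
        _ ≤ _ := by
          rw [mul_assoc]
          exact mul_le_mul_of_nonneg_left hi2 (abs_nonneg K)
    · rw [hmp.integral_comp' (g := G)]
      calc ∫ p, G p = ∫ q, ∫ p, G (q, p) := integral_prod _ hGi
        _ = ∫ q, (∏ i ∈ Finset.range J, (((2 + (2 * i + M)) / 2 : ℕ) : ℝ)) •
            ∫ b : Fin (2 * J + M) → ℝ, hq q (monicPoly b) := by
          refine integral_congr_ae ?_
          filter_upwards [hGint] with q hq using hq.2.2
        _ = (∏ i ∈ Finset.range J, (((2 + (2 * i + M)) / 2 : ℕ) : ℝ)) •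
            ∫ p : (Fin 2 → ℝ) × (Fin (2 * J + M) → ℝ), hq p.1 (monicPoly p.2) := by
          rw [integral_smul]
          congr 1
          exact (integral_prod _ hi1).symm
        _ = _ := by
          rw [hi3, smul_smul, Finset.prod_range_succ]

end Chain

/-! ### Integrals over monic quadratics in root coordinates -/

section QuadraticIntegral

open Polynomial

theorem pairCoeff_ofReal_mem_iff (q : Fin 2 → ℝ) : 0 < quadDisc q ↔
    ∃ x : Fin 2 → ℝ, x 0 < x 1 ∧ pairCoeff (x 0) (x 1) = q := by
  constructor
  · intro h
    obtain ⟨x, y, hxy, hx, hy⟩ := exists_real_roots_of_quadDisc_pos h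
    refine ⟨![x, y], by simpa using hxy, ?_⟩
    simp [← hx, ← hy]
  · rintro ⟨x, hx, rfl⟩
    rw [quadDisc_pairCoeff_ofReal]
    exact pow_pos (sub_pos.2 hx) 2

theorem pairCoeff_conj_mem_iff (q : Fin 2 → ℝ) : quadDisc q < 0 ↔
    ∃ β : ℂ, 0 < β.im ∧ pairCoeff (starRingEnd ℂ β) β = q := by
  constructor
  · intro h
    obtain ⟨h1, h2⟩ := conj_roots_of_quadDisc_neg h
    exact ⟨_, h1, by rw [← h2, pairCoeff_lowRoot_highRoot]⟩
  · rintro ⟨β, hβ, rfl⟩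
    rw [quadDisc_pairCoeff_conj, neg_lt_zero]
    positivity

/-- A linear endomorphism of the plane given by a matrix. -/
noncomputable def planeMap (A : Matrix (Fin 2) (Fin 2) ℝ) : (Fin 2 → ℝ) →L[ℝ] (Fin 2 → ℝ) :=
  LinearMap.toContinuousLinearMap (Matrix.toLin' A)

theorem det_planeMap (A : Matrix (Fin 2) (Fin 2) ℝ) : (planeMap A).det = A.det := by
  rw [planeMap, LinearMap.det_toContinuousLinearMap, LinearMap.det_toLin']

theorem hasFDerivAt_plane {F : (Fin 2 → ℝ) → Fin 2 → ℝ} {A : Matrix (Fin 2) (Fin 2) ℝ}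
    {x : Fin 2 → ℝ}
    (h : ∀ i, HasFDerivAt (fun y => F y i)
      (A i 0 • (ContinuousLinearMap.proj 0 : (Fin 2 → ℝ) →L[ℝ] ℝ) +
        A i 1 • (ContinuousLinearMap.proj 1 : (Fin 2 → ℝ) →L[ℝ] ℝ)) x) :
    HasFDerivAt F (planeMap A) x := by
  rw [hasFDerivAt_pi']
  intro i
  refine (h i).congr_fderiv (ContinuousLinearMap.ext fun v => ?_)
  fin_cases i <;> simp [planeMap]

theorem hasFDerivAt_pairCoeff_ofReal (x : Fin 2 → ℝ) :
    HasFDerivAt (fun y : Fin 2 → ℝ => pairCoeff (y 0) (y 1))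
      (planeMap !![x 1, x 0; -1, -1]) x := by
  have p0 : HasFDerivAt (fun y : Fin 2 → ℝ => y 0) (ContinuousLinearMap.proj 0) x :=
    (ContinuousLinearMap.proj (R := ℝ) (φ := fun _ : Fin 2 => ℝ) 0).hasFDerivAt
  have p1 : HasFDerivAt (fun y : Fin 2 → ℝ => y 1) (ContinuousLinearMap.proj 1) x :=
    (ContinuousLinearMap.proj (R := ℝ) (φ := fun _ : Fin 2 => ℝ) 1).hasFDerivAt
  refine hasFDerivAt_plane fun i => ?_
  fin_cases i
  · have h := p0.mul p1
    simp only [pairCoeff, Fin.zero_eta, Matrix.cons_val_zero, Complex.mul_re, Complex.ofReal_re,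
      Complex.ofReal_im, mul_zero, sub_zero]
    refine h.congr_fderiv (ContinuousLinearMap.ext fun v => ?_)
    simp
    ring
  · have h := (p0.add p1).neg
    simp only [pairCoeff, Fin.mk_one, Matrix.cons_val_one, Complex.add_re, Complex.ofReal_re,
      Matrix.cons_val_fin_one]
    refine h.congr_fderiv (ContinuousLinearMap.ext fun v => ?_)
    simp
    ring

theorem hasFDerivAt_pairCoeff_conj (x : Fin 2 → ℝ) :
    HasFDerivAt (fun y : Fin 2 → ℝ => pairCoeff (starRingEnd ℂ ⟨y 0, y 1⟩) ⟨y 0, y 1⟩)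
      (planeMap !![2 * x 0, 2 * x 1; -2, 0]) x := by
  have p0 : HasFDerivAt (fun y : Fin 2 → ℝ => y 0) (ContinuousLinearMap.proj 0) x :=
    (ContinuousLinearMap.proj (R := ℝ) (φ := fun _ : Fin 2 => ℝ) 0).hasFDerivAt
  have p1 : HasFDerivAt (fun y : Fin 2 → ℝ => y 1) (ContinuousLinearMap.proj 1) x :=
    (ContinuousLinearMap.proj (R := ℝ) (φ := fun _ : Fin 2 => ℝ) 1).hasFDerivAt
  refine hasFDerivAt_plane fun i => ?_
  fin_cases i
  · have h := (p0.mul p0).add (p1.mul p1)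
    simp only [pairCoeff, Fin.zero_eta, Matrix.cons_val_zero, Complex.mul_re, Complex.conj_re,
      Complex.conj_im, neg_mul, sub_neg_eq_add]
    refine h.congr_fderiv (ContinuousLinearMap.ext fun v => ?_)
    simp
    ring
  · have h := (p0.add p0).neg
    simp only [pairCoeff, Fin.mk_one, Matrix.cons_val_one, Complex.add_re, Complex.conj_re,
      Matrix.cons_val_fin_one]
    refine h.congr_fderiv (ContinuousLinearMap.ext fun v => ?_)
    simp
    ring

/-- A vanishing discriminant makes the quadratic a square over `ℂ`, which separability excludes
almost everywhere. -/
theorem ae_quadDisc_ne_zero : ∀ᵐ q : Fin 2 → ℝ, quadDisc q ≠ 0 := by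
  filter_upwards [ae_separable_monicPoly 2] with q hq h0
  have h := (hq.map (f := algebraMap ℝ ℂ)).squarefree
  rw [map_monicPoly_two, (quadDisc_eq_zero_iff q).1 h0] at h
  exact (irreducible_X_sub_C _).not_isUnit (h _ dvd_rfl)

theorem continuous_quadDisc : Continuous quadDisc := by
  unfold quadDisc
  fun_prop

/-- The map from roots `x < y` to coefficients is injective, with Jacobian determinant `x - y`,
hence the density `y - x`. -/
theorem integral_real_roots {H : ℂ → ℂ → ℂ}
    (hH : IntegrableOn (fun p : ℝ × ℝ => (p.2 - p.1) • H p.1 p.2) {p | p.1 < p.2}) :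
    IntegrableOn (fun q => H (lowRoot q) (highRoot q)) {q | 0 < quadDisc q} ∧
      ∫ q in {q | 0 < quadDisc q}, H (lowRoot q) (highRoot q) =
        ∫ p in {p : ℝ × ℝ | p.1 < p.2}, (p.2 - p.1) • H p.1 p.2 := by
  have hmp := volume_preserving_finTwoArrow ℝ
  have hme := (MeasurableEquiv.finTwoArrow (α := ℝ)).measurableEmbedding
  have hs : MeasurableSet {x : Fin 2 → ℝ | x 0 < x 1} :=
    measurableSet_lt (measurable_pi_apply 0) (measurable_pi_apply 1)
  have himg : (fun y : Fin 2 → ℝ => pairCoeff (y 0) (y 1)) '' {x | x 0 < x 1} =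
      {q | 0 < quadDisc q} := by
    ext q
    exact (pairCoeff_ofReal_mem_iff q).symm
  have hinj : Set.InjOn (fun y : Fin 2 → ℝ => pairCoeff (y 0) (y 1)) {x | x 0 < x 1} := by
    intro x hx y hy (h : pairCoeff _ _ = pairCoeff _ _)
    obtain ⟨h1, h2⟩ := roots_pairCoeff_ofReal hx
    obtain ⟨h3, h4⟩ := roots_pairCoeff_ofReal hy
    rw [h] at h1 h2
    ext i
    fin_cases i
    · exact Complex.ofReal_injective (h1.symm.trans h3)
    · exact Complex.ofReal_injective (h2.symm.trans h4)
  have hd : ∀ x ∈ {x : Fin 2 → ℝ | x 0 < x 1}, HasFDerivWithinAt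
      (fun y : Fin 2 → ℝ => pairCoeff (y 0) (y 1)) (planeMap !![x 1, x 0; -1, -1])
        {x | x 0 < x 1} x := fun x _ => (hasFDerivAt_pairCoeff_ofReal x).hasFDerivWithinAt
  have e : ∀ x ∈ {x : Fin 2 → ℝ | x 0 < x 1},
      |(planeMap !![x 1, x 0; -1, -1]).det| •
        H (lowRoot (pairCoeff (x 0) (x 1))) (highRoot (pairCoeff (x 0) (x 1))) =
      (fun p : ℝ × ℝ => (p.2 - p.1) • H p.1 p.2) (MeasurableEquiv.finTwoArrow x) := by
    intro x hx
    obtain ⟨h1, h2⟩ := roots_pairCoeff_ofReal hx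
    rw [h1, h2, det_planeMap, Matrix.det_fin_two_of]
    have : x 1 * -1 - x 0 * -1 = -(x 1 - x 0) := by ring
    rw [this, abs_neg, abs_of_pos (sub_pos.2 hx)]
    rfl
  have hpre : (MeasurableEquiv.finTwoArrow (α := ℝ)) ⁻¹' {p | p.1 < p.2} =
      {x : Fin 2 → ℝ | x 0 < x 1} := rfl
  constructor
  · rw [← himg, integrableOn_image_iff_integrableOn_abs_det_fderiv_smul volume hs hd hinj,
      integrableOn_congr_fun e hs, ← hpre]
    exact (hmp.integrableOn_comp_preimage hme).2 hH
  · rw [← himg, integral_image_eq_integral_abs_det_fderiv_smul volume hs hd hinj,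
      setIntegral_congr_fun hs e, ← hpre]
    exact hmp.setIntegral_preimage_emb hme (fun p : ℝ × ℝ => (p.2 - p.1) • H p.1 p.2) _

/-- For `β = u + iv` the coefficients are `(u² + v², -2u)`, with Jacobian determinant `4v`. -/
theorem integral_complex_roots {H : ℂ → ℂ → ℂ}
    (hH : IntegrableOn (fun β : ℂ => (4 * β.im) • H (starRingEnd ℂ β) β) {β | 0 < β.im}) :
    IntegrableOn (fun q => H (lowRoot q) (highRoot q)) {q | quadDisc q < 0} ∧
      ∫ q in {q | quadDisc q < 0}, H (lowRoot q) (highRoot q) =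
        ∫ β in {β : ℂ | 0 < β.im}, (4 * β.im) • H (starRingEnd ℂ β) β := by
  have hmp := Complex.volume_preserving_equiv_pi.symm
  have hme := Complex.measurableEquivPi.symm.measurableEmbedding
  have hs : MeasurableSet {x : Fin 2 → ℝ | 0 < x 1} :=
    measurableSet_lt measurable_const (measurable_pi_apply 1)
  let F : (Fin 2 → ℝ) → Fin 2 → ℝ := fun y => pairCoeff (starRingEnd ℂ ⟨y 0, y 1⟩) ⟨y 0, y 1⟩
  have himg : F '' {x | 0 < x 1} = {q | quadDisc q < 0} := by
    ext q
    refine Iff.trans ⟨?_, ?_⟩ (pairCoeff_conj_mem_iff q).symm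
    · rintro ⟨x, hx, rfl⟩
      exact ⟨⟨x 0, x 1⟩, show 0 < x 1 from hx, rfl⟩
    · rintro ⟨β, hβ, rfl⟩
      exact ⟨![β.re, β.im], by simpa using hβ, rfl⟩
  have hinj : Set.InjOn F {x | 0 < x 1} := by
    intro x hx y hy (h : pairCoeff _ _ = pairCoeff _ _)
    have h2 := (roots_pairCoeff_conj (β := ⟨x 0, x 1⟩) hx).2
    have h4 := (roots_pairCoeff_conj (β := ⟨y 0, y 1⟩) hy).2
    rw [h] at h2
    have h5 := h2.symm.trans h4
    ext i
    fin_cases i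
    · exact congrArg Complex.re h5
    · exact congrArg Complex.im h5
  have hd : ∀ x ∈ {x : Fin 2 → ℝ | 0 < x 1}, HasFDerivWithinAt F
      (planeMap !![2 * x 0, 2 * x 1; -2, 0]) {x | 0 < x 1} x :=
    fun x _ => (hasFDerivAt_pairCoeff_conj x).hasFDerivWithinAt
  have hsymm : ∀ x : Fin 2 → ℝ, Complex.measurableEquivPi.symm x = ⟨x 0, x 1⟩ := by
    intro x
    rw [Complex.measurableEquivPi_symm_apply]
    exact Complex.ext (by simp) (by simp)
  have e : ∀ x ∈ {x : Fin 2 → ℝ | 0 < x 1},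
      |(planeMap !![2 * x 0, 2 * x 1; -2, 0]).det| • H (lowRoot (F x)) (highRoot (F x)) =
      (fun β : ℂ => (4 * β.im) • H (starRingEnd ℂ β) β) (Complex.measurableEquivPi.symm x) := by
    intro x hx
    obtain ⟨h1, h2⟩ := roots_pairCoeff_conj (β := ⟨x 0, x 1⟩) hx
    have hx' : 0 < x 1 := hx
    simp only [F]
    rw [h1, h2, det_planeMap, Matrix.det_fin_two_of, hsymm]
    have : 2 * x 0 * 0 - 2 * x 1 * -2 = 4 * x 1 := by ring
    rw [this, abs_of_pos (by positivity)]
  have hpre : Complex.measurableEquivPi.symm ⁻¹' {β : ℂ | 0 < β.im} =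
      {x : Fin 2 → ℝ | 0 < x 1} := by
    ext x
    simp only [Set.mem_preimage, Set.mem_ofPred_eq, hsymm]
  constructor
  · rw [← himg, integrableOn_image_iff_integrableOn_abs_det_fderiv_smul volume hs hd hinj,
      integrableOn_congr_fun e hs, ← hpre]
    exact (hmp.integrableOn_comp_preimage hme).2 hH
  · rw [← himg, integral_image_eq_integral_abs_det_fderiv_smul volume hs hd hinj,
      setIntegral_congr_fun hs e, ← hpre]
    exact hmp.setIntegral_preimage_emb hme
      (fun β : ℂ => (4 * β.im) • H (starRingEnd ℂ β) β) _

/-- Integration over monic real quadratic polynomials in terms of their roots. -/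
theorem integral_roots {H : ℂ → ℂ → ℂ}
    (hR : IntegrableOn (fun p : ℝ × ℝ => (p.2 - p.1) • H p.1 p.2) {p | p.1 < p.2})
    (hC : IntegrableOn (fun β : ℂ => (4 * β.im) • H (starRingEnd ℂ β) β) {β | 0 < β.im}) :
    Integrable (fun q => H (lowRoot q) (highRoot q)) ∧
      ∫ q, H (lowRoot q) (highRoot q) =
        (∫ p in {p : ℝ × ℝ | p.1 < p.2}, (p.2 - p.1) • H p.1 p.2) +
          ∫ β in {β : ℂ | 0 < β.im}, (4 * β.im) • H (starRingEnd ℂ β) β := by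
  obtain ⟨i1, e1⟩ := integral_real_roots hR
  obtain ⟨i2, e2⟩ := integral_complex_roots hC
  have hms : MeasurableSet {q | quadDisc q < 0} :=
    (isOpen_lt continuous_quadDisc continuous_const).measurableSet
  have hdisj : Disjoint {q | 0 < quadDisc q} {q | quadDisc q < 0} := by
    rw [Set.disjoint_left]
    intro q (hq : 0 < quadDisc q) (hq' : quadDisc q < 0)
    exact lt_asymm hq hq'
  have hu : ({q | 0 < quadDisc q} ∪ {q | quadDisc q < 0} : Set (Fin 2 → ℝ)) =ᵐ[volume]
      Set.univ := by
    rw [ae_eq_univ, ← nonpos_iff_eq_zero]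
    refine (measure_mono fun q hq => ?_).trans (le_of_eq (ae_iff.1 ae_quadDisc_ne_zero))
    simp only [Set.mem_compl_iff, Set.mem_union, Set.mem_ofPred_eq, not_or, not_lt] at hq ⊢
    exact not_not.2 (le_antisymm hq.1 hq.2)
  constructor
  · rw [← integrableOn_univ, ← integrableOn_congr_set_ae hu]
    exact i1.union i2
  · rw [← setIntegral_univ, ← setIntegral_congr_set hu, setIntegral_union hdisj hms i1 i2, e1, e2]

end QuadraticIntegral

/-! ### Pfaffian-type sums and determinants -/

section PairPermutations

open Equiv Finset

variable {α : Type*} [Fintype α] [DecidableEq α]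

/-- The polarised Pfaffian-type sum `∑ sgn(σ) ∏ B_i(σ(i,0), σ(i,1))`. -/
def pairSum (B : α → α × Fin 2 → α × Fin 2 → ℂ) : ℂ :=
  ∑ σ : Perm (α × Fin 2), (Perm.sign σ : ℂ) * ∏ i, B i (σ (i, 0)) (σ (i, 1))

/-- Expanding the product of differences chooses, for each pair, whether to swap it. A choice of
swaps multiplies `σ` on the right by a permutation whose sign matches the minus signs, so each of
the `2 ^ |α|` choices merely reindexes the same sum. -/
theorem pairSum_antisymm (B : α → α × Fin 2 → α × Fin 2 → ℂ) :
    pairSum (fun i x y => B i x y - B i y x) = (2 : ℂ) ^ Fintype.card α * pairSum B := by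
  have h1 : ∀ (σ : Perm (α × Fin 2)) (i : α),
      B i (σ (i, 0)) (σ (i, 1)) - B i (σ (i, 1)) (σ (i, 0)) =
        ∑ π : Perm (Fin 2), (Perm.sign π : ℂ) * B i (σ (i, π 0)) (σ (i, π 1)) := by
    intro σ i
    have hu : (univ : Finset (Perm (Fin 2))) = {1, Equiv.swap 0 1} := by decide
    have hne : (1 : Perm (Fin 2)) ≠ Equiv.swap 0 1 := by decide
    rw [hu, Finset.sum_pair hne, Perm.sign_one, Perm.sign_swap (by decide)]
    simp [sub_eq_add_neg]
  have h2 : pairSum (fun i x y => B i x y - B i y x) =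
      ∑ ε : α → Perm (Fin 2), ∑ σ : Perm (α × Fin 2),
        (Perm.sign (σ * prodCongrRight ε) : ℂ) *
          ∏ i, B i ((σ * prodCongrRight ε) (i, 0)) ((σ * prodCongrRight ε) (i, 1)) := by
    rw [pairSum, Finset.sum_comm]
    refine Finset.sum_congr rfl fun σ _ => ?_
    simp_rw [h1]
    rw [Finset.prod_univ_sum, Finset.mul_sum, Fintype.piFinset_univ]
    refine Finset.sum_congr rfl fun ε _ => ?_
    rw [Finset.prod_mul_distrib, Perm.sign_mul, Perm.sign_prodCongrRight]
    simp only [Perm.mul_apply, prodCongrRight_apply]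
    push_cast
    ring
  rw [h2]
  have h3 : ∀ ε : α → Perm (Fin 2), ∑ σ : Perm (α × Fin 2),
      (Perm.sign (σ * prodCongrRight ε) : ℂ) *
          ∏ i, B i ((σ * prodCongrRight ε) (i, 0)) ((σ * prodCongrRight ε) (i, 1)) =
      pairSum B := by
    intro ε
    exact Equiv.sum_comp (Equiv.mulRight (prodCongrRight ε : Perm (α × Fin 2)))
      (fun σ => (Perm.sign σ : ℂ) * ∏ i, B i (σ (i, 0)) (σ (i, 1)))
  simp_rw [h3]
  rw [Finset.sum_const, Finset.card_univ, Fintype.card_fun, Fintype.card_perm, Fintype.card_fin]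
  simp

/-- Only the antisymmetric parts of the `B i` matter, since `pairSum_antisymm` recovers the sum from
them after division by a power of `2`. -/
theorem pairSum_congr {B C : α → α × Fin 2 → α × Fin 2 → ℂ}
    (h : ∀ i x y, B i x y - B i y x = C i x y - C i y x) : pairSum B = pairSum C := by
  have h1 := pairSum_antisymm B
  have h2 := pairSum_antisymm C
  have h3 : (fun i x y => B i x y - B i y x) = fun i x y => C i x y - C i y x := by
    ext i x y; exact h i x y
  rw [h3, h2] at h1
  exact (mul_left_cancel₀ (pow_ne_zero _ two_ne_zero) h1).symm

/-- A term survives only if `σ` preserves the second coordinate, that is, if it consists of two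
permutations of `α`. The sum over the one acting at `0` is a Leibniz determinant; the one acting at
`1` remains as `τ`. -/
theorem pairSum_of_bipartite (u : α → α → α → ℂ) :
    pairSum (fun i x y => if x.2 = 0 ∧ y.2 = 1 then u i x.1 y.1 else 0) =
      ∑ τ : Perm α, (Perm.sign τ : ℂ) * (Matrix.of fun r i => u i r (τ i)).det := by
  have h1 : ∑ π : Fin 2 → Perm α, (Perm.sign (prodCongrLeft π) : ℂ) *
      ∏ i, (fun (i : α) (x y : α × Fin 2) => if x.2 = 0 ∧ y.2 = 1 then u i x.1 y.1 else 0) i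
        (prodCongrLeft π (i, 0)) (prodCongrLeft π (i, 1)) =
      pairSum (fun i x y => if x.2 = 0 ∧ y.2 = 1 then u i x.1 y.1 else 0) := by
    refine Finset.sum_of_injOn (fun π : Fin 2 → Perm α => (prodCongrLeft π : Perm (α × Fin 2)))
      ?_ (by simp) ?_ (by simp)
    · intro π _ π' _ h
      ext s a
      have := congrArg (fun σ : Perm (α × Fin 2) => (σ (a, s)).1) h
      simpa using this
    · intro σ _ hσ
      have : ¬ ∀ i, (σ (i, 0)).2 = 0 ∧ (σ (i, 1)).2 = 1 := by
        intro hall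
        apply hσ
        have hs : ∀ s a, (σ (a, s)).2 = s := by
          intro s a
          fin_cases s
          · exact (hall a).1
          · exact (hall a).2
        have hinj : ∀ s, Function.Injective fun a => (σ (a, s)).1 := by
          intro s a b hab
          have : σ (a, s) = σ (b, s) := Prod.ext hab (by rw [hs, hs])
          exact (Prod.ext_iff.1 (σ.injective this)).1
        refine ⟨fun s => Equiv.ofBijective _ (Finite.injective_iff_bijective.1 (hinj s)),
          by simp, ?_⟩
        ext1 ⟨a, s⟩
        exact Prod.ext rfl (hs s a).symm
      push Not at this
      obtain ⟨i, hi⟩ := this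
      rw [Finset.prod_eq_zero (Finset.mem_univ i), mul_zero]
      exact if_neg fun h => hi h.1 h.2
  rw [← h1, ← Equiv.sum_comp (finTwoArrowEquiv (Perm α)).symm, Fintype.sum_prod_type_right]
  refine Finset.sum_congr rfl fun τ _ => ?_
  rw [Matrix.det_apply', Finset.mul_sum]
  refine Finset.sum_congr rfl fun π _ => ?_
  rw [Perm.sign_prodCongrLeft]
  simp [Fin.prod_univ_two]
  ring

/-- A Pfaffian-type sum with checkerboard structure is a sum of determinants. -/
theorem pairSum_eq_sum_det (B : α → α × Fin 2 → α × Fin 2 → ℂ)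
    (h : ∀ i j k s, B i (j, s) (k, s) = B i (k, s) (j, s)) :
    pairSum B = ∑ τ : Perm α, (Perm.sign τ : ℂ) *
      (Matrix.of fun r i => B i (r, 0) (τ i, 1) - B i (τ i, 1) (r, 0)).det := by
  -- By `h` the antisymmetric part of `B i` vanishes when the second coordinates agree, so `B i` may
  -- be replaced by a kernel supported on `(0, 1)` with the same antisymmetric part.
  rw [← pairSum_of_bipartite fun i r k => B i (r, 0) (k, 1) - B i (k, 1) (r, 0)]
  refine pairSum_congr fun i x y => ?_
  obtain ⟨j, s⟩ := x
  obtain ⟨k, t⟩ := y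
  fin_cases s <;> fin_cases t <;> simp
  · rw [h, sub_self]
  · rw [h, sub_self]

/-- Even case: a single skew form. -/
theorem pairSum_const (B : α × Fin 2 → α × Fin 2 → ℂ)
    (h : ∀ j k s, B (j, s) (k, s) = B (k, s) (j, s)) :
    pairSum (fun _ : α => B) = (Fintype.card α).factorial *
      (Matrix.of fun r i => B (r, 0) (i, 1) - B (i, 1) (r, 0)).det := by
  rw [pairSum_eq_sum_det _ fun _ => h]
  -- Permuting the columns by `τ` produces a second sign that cancels the first, so all `|α|!` terms
  -- are equal.
  have h1 : ∀ τ : Perm α, (Perm.sign τ : ℂ) *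
      (Matrix.of fun r i => B (r, 0) (τ i, 1) - B (τ i, 1) (r, 0)).det =
      (Matrix.of fun r i => B (r, 0) (i, 1) - B (i, 1) (r, 0)).det := by
    intro τ
    have h2 := Matrix.det_permute' τ (Matrix.of fun r i => B (r, 0) (i, 1) - B (i, 1) (r, 0))
    have h3 : (Matrix.of fun r i => B (r, 0) (τ i, 1) - B (τ i, 1) (r, 0)) =
        (Matrix.of fun r i => B (r, 0) (i, 1) - B (i, 1) (r, 0)).submatrix id τ := rfl
    rw [h3, h2, ← mul_assoc, ← Int.cast_mul, ← Units.val_mul, Int.units_mul_self]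
    simp
  simp_rw [h1]
  rw [Finset.sum_const, Finset.card_univ, Fintype.card_perm, nsmul_eq_mul]

theorem card_perm_fixing (a : α) :
    (univ.filter fun τ : Perm α => τ a = a).card = (Fintype.card α - 1).factorial := by
  have h := Fintype.card_congr (Equiv.Perm.subtypeEquivSubtypePerm fun x : α => x ≠ a)
  rw [Fintype.card_perm, Fintype.card_subtype_compl, Fintype.card_subtype_eq] at h
  rw [h, Fintype.card_subtype]
  congr 1
  ext τ
  simp

/-- Odd case: one pair, indexed by `a`, carries a linear form and the extra index. -/
theorem pairSum_update (a : α) (B B' : α × Fin 2 → α × Fin 2 → ℂ)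
    (h : ∀ j k s, B (j, s) (k, s) = B (k, s) (j, s))
    (h' : ∀ j k s, B' (j, s) (k, s) = B' (k, s) (j, s))
    (hB : ∀ r, B (r, 0) (a, 1) - B (a, 1) (r, 0) = 0)
    (hB' : ∀ r k, k ≠ a → B' (r, 0) (k, 1) - B' (k, 1) (r, 0) = 0) :
    pairSum (fun i : α => if i = a then B' else B) = (Fintype.card α - 1).factorial *
      (Matrix.of fun r i => if i = a then B' (r, 0) (a, 1) - B' (a, 1) (r, 0) else
        B (r, 0) (i, 1) - B (i, 1) (r, 0)).det := by
  rw [pairSum_eq_sum_det]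
  swap
  · intro i j k s
    by_cases hi : i = a
    · simp only [if_pos hi]; exact h' j k s
    · simp only [if_neg hi]; exact h j k s
  set A : Matrix α α ℂ := Matrix.of fun r i => if i = a then B' (r, 0) (a, 1) - B' (a, 1) (r, 0)
    else B (r, 0) (i, 1) - B (i, 1) (r, 0) with hA
  -- Unless `τ` fixes `a`, column `a` is zero by `hB'`. The `τ` fixing `a` contribute equally, and
  -- there are `(|α| - 1)!` of them.
  have h1 : ∀ τ : Perm α, (Perm.sign τ : ℂ) *
      (Matrix.of fun r i => (if i = a then B' else B) (r, 0) (τ i, 1) -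
        (if i = a then B' else B) (τ i, 1) (r, 0)).det =
      if τ a = a then A.det else 0 := by
    intro τ
    split_ifs with hτ
    · have h2 := Matrix.det_permute' τ A
      have h3 : (Matrix.of fun r i => (if i = a then B' else B) (r, 0) (τ i, 1) -
          (if i = a then B' else B) (τ i, 1) (r, 0)) = A.submatrix id τ := by
        ext r i
        by_cases hi : i = a
        · subst hi
          simp [hA, hτ]
        · have : τ i ≠ a := fun h => hi (τ.injective (h.trans hτ.symm))
          simp [hA, hi, this]
      rw [h3, h2, ← mul_assoc, ← Int.cast_mul, ← Units.val_mul, Int.units_mul_self]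
      simp
    · rw [Matrix.det_eq_zero_of_column_eq_zero a, mul_zero]
      intro r
      simp only [Matrix.of_apply, if_pos]
      exact hB' r _ hτ
  simp_rw [h1]
  rw [← Finset.sum_filter, Finset.sum_const, card_perm_fixing, nsmul_eq_mul]

end PairPermutations

/-! ### The Vandermonde determinant and the Leibniz expansion -/

section VandermondeChain

open Polynomial

variable {M J : ℕ}

/-- The roots of a family of quadratic polynomials, listed in pairs and followed by `u`. -/
noncomputable def rootVec (u : Fin M → ℂ) : (J : ℕ) → (Fin J → Fin 2 → ℝ) → Fin (M + 2 * J) → ℂ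
  | 0, _ => u
  | J + 1, q => Fin.cons (α := fun _ : Fin (M + 2 * J + 1 + 1) => ℂ) (lowRoot (q 0))
      (Fin.cons (α := fun _ : Fin (M + 2 * J + 1) => ℂ) (highRoot (q 0))
        (rootVec u J fun i => q i.succ))

/-- The position of the first root of the `i`-th pair. -/
def fstIdx (M : ℕ) {J : ℕ} (i : Fin J) : Fin (M + 2 * J) := ⟨2 * i, by omega⟩

/-- The position of the second root of the `i`-th pair. -/
def sndIdx (M : ℕ) {J : ℕ} (i : Fin J) : Fin (M + 2 * J) := ⟨2 * i + 1, by omega⟩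

/-- The position of the `c`-th unpaired root. -/
def lastIdx {M : ℕ} (J : ℕ) (c : Fin M) : Fin (M + 2 * J) := ⟨2 * J + c, by omega⟩

theorem fstIdx_succ (i : Fin J) : fstIdx M i.succ = (fstIdx M i).succ.succ := by
  ext; simp [fstIdx]; omega

theorem sndIdx_succ (i : Fin J) : sndIdx M i.succ = (sndIdx M i).succ.succ := by
  ext; simp [sndIdx]; omega

theorem lastIdx_succ (c : Fin M) : lastIdx (J + 1) c = (lastIdx J c).succ.succ := by
  ext; simp [lastIdx]; omega

theorem rootVec_succ (u : Fin M → ℂ) (q : Fin (J + 1) → Fin 2 → ℝ) (r : Fin (M + 2 * J)) :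
    rootVec u (J + 1) q r.succ.succ = rootVec u J (fun i => q i.succ) r := rfl

theorem rootVec_fstIdx (u : Fin M → ℂ) (q : Fin J → Fin 2 → ℝ) (i : Fin J) :
    rootVec u J q (fstIdx M i) = lowRoot (q i) := by
  induction J with
  | zero => exact i.elim0
  | succ J ih =>
    refine Fin.cases rfl (fun i => ?_) i
    rw [fstIdx_succ, rootVec_succ, ih]

theorem rootVec_sndIdx (u : Fin M → ℂ) (q : Fin J → Fin 2 → ℝ) (i : Fin J) :
    rootVec u J q (sndIdx M i) = highRoot (q i) := by
  induction J with
  | zero => exact i.elim0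
  | succ J ih =>
    refine Fin.cases rfl (fun i => ?_) i
    rw [sndIdx_succ, rootVec_succ, ih]

theorem rootVec_lastIdx (u : Fin M → ℂ) (q : Fin J → Fin 2 → ℝ) (c : Fin M) :
    rootVec u J q (lastIdx J c) = u c := by
  induction J with
  | zero =>
    have : lastIdx 0 c = c := by ext; simp [lastIdx]
    rw [this]; rfl
  | succ J ih => rw [lastIdx_succ, rootVec_succ, ih]

theorem prod_pairs {R : Type*} [CommMonoid R] (f : Fin (M + 2 * J) → R) :
    ∏ r, f r = (∏ i, f (fstIdx M i) * f (sndIdx M i)) * ∏ c, f (lastIdx J c) := by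
  induction J with
  | zero =>
    have : ∀ c : Fin M, lastIdx 0 c = c := fun c => by ext; simp [lastIdx]
    simp [this]
  | succ J ih =>
    have h0 : ∏ r, f r = f (fstIdx M 0) * (f (sndIdx M 0) *
        ∏ r : Fin (M + 2 * J), f (Fin.succ (n := M + 2 * J + 1) r.succ)) := by
      refine (Fin.prod_univ_succ (n := M + 2 * J + 1) f).trans ?_
      rw [Fin.prod_univ_succ]
      rfl
    rw [h0, ih fun r => f (Fin.succ (n := M + 2 * J + 1) r.succ), Fin.prod_univ_succ]
    simp only [fstIdx_succ, sndIdx_succ, lastIdx_succ, mul_assoc]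

theorem map_prodPoly {w : Fin M → ℝ} {u : Fin M → ℂ}
    (hu : (monicPoly w).map (algebraMap ℝ ℂ) = ∏ c, (X - C (u c))) (q : Fin J → Fin 2 → ℝ) :
    (prodPoly q w).map (algebraMap ℝ ℂ) = ∏ r, (X - C (rootVec u J q r)) := by
  rw [prod_pairs, prodPoly, Polynomial.map_mul, Polynomial.map_prod, hu]
  simp only [map_monicPoly_two, rootVec_fstIdx, rootVec_sndIdx, rootVec_lastIdx]

theorem det_vandermonde_cons {n : ℕ} (a : ℂ) (v : Fin n → ℂ) :
    (Matrix.vandermonde (Fin.cons a v : Fin (n + 1) → ℂ)).det =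
      (∏ j, (v j - a)) * (Matrix.vandermonde v).det := by
  rw [Matrix.det_vandermonde, Matrix.det_vandermonde, Fin.prod_univ_succ, Fin.prod_Ioi_zero]
  simp [Fin.prod_Ioi_succ]

/-- The Jacobian of the multiplication map times the differences of the paired roots is a
Vandermonde determinant. -/
theorem det_vandermonde_rootVec {w : Fin M → ℝ} {u : Fin M → ℂ}
    (hu : (monicPoly w).map (algebraMap ℝ ℂ) = ∏ c, (X - C (u c))) (q : Fin J → Fin 2 → ℝ) :
    (Matrix.vandermonde (rootVec u J q)).det =
      (∏ i, (highRoot (q i) - lowRoot (q i))) * chainResultant w J q *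
        (Matrix.vandermonde u).det := by
  induction J with
  | zero =>
    simp [chainResultant]
    rfl
  | succ J ih =>
    have h1 := det_vandermonde_cons (n := M + 2 * J + 1) (lowRoot (q 0))
      (Fin.cons (α := fun _ : Fin (M + 2 * J + 1) => ℂ) (highRoot (q 0))
        (rootVec u J fun i => q i.succ))
    have h2 := det_vandermonde_cons (n := M + 2 * J) (highRoot (q 0))
        (rootVec u J fun i => q i.succ)
    have h3 : (Matrix.vandermonde (rootVec u (J + 1) q)).det = _ := h1
    rw [h3, h2, ih, Fin.prod_univ_succ, Fin.prod_univ_succ]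
    simp only [Fin.cons_zero, Fin.cons_succ, chainResultant]
    -- The new resultant is the product of the differences between the two new roots and all the
    -- later ones. Reversing these differences costs `(-1) ^ (M + 2 * J)` once per new root, so the
    -- signs cancel.
    have h4 := ofReal_resultant (g := prodPoly (fun i => q i.succ) w) (map_monicPoly_two (q 0))
    rw [map_prodPoly hu, eval_prod, eval_prod] at h4
    simp only [eval_sub, eval_X, eval_C] at h4
    have h5 : ∀ a : ℂ, ∏ r, (rootVec u J (fun i => q i.succ) r - a) =
        (-1) ^ (M + 2 * J) * ∏ r, (a - rootVec u J (fun i => q i.succ) r) := by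
      intro a
      have : ∀ r, rootVec u J (fun i => q i.succ) r - a =
        (-1) * (a - rootVec u J (fun i => q i.succ) r) := fun r => by ring
      simp_rw [this]
      rw [Finset.prod_mul_distrib, Finset.prod_const, Finset.card_univ, Fintype.card_fin]
    rw [h5, h5, Complex.ofReal_mul, h4]
    have h6 : ((-1 : ℂ) ^ (M + 2 * J)) * (-1) ^ (M + 2 * J) = 1 := by
      rw [← mul_pow]; simp
    linear_combination ((highRoot (q 0) - lowRoot (q 0)) *
      (∏ r, (lowRoot (q 0) - rootVec u J (fun i => q i.succ) r)) *
      (∏ r, (highRoot (q 0) - rootVec u J (fun i => q i.succ) r)) *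
      (∏ i : Fin J, (highRoot (q i.succ) - lowRoot (q i.succ))) *
      chainResultant w J (fun i => q i.succ) * (Matrix.vandermonde u).det) * h6

theorem map_monicPoly_of_le_one (hM : M ≤ 1) (w : Fin M → ℝ) :
    (monicPoly w).map (algebraMap ℝ ℂ) = ∏ c, (X - C (-(w c : ℂ))) := by
  interval_cases M
  · simp [monicPoly, lowPoly]
  · simp [monicPoly, lowPoly]

theorem det_vandermonde_of_le_one (hM : M ≤ 1) (u : Fin M → ℂ) :
    (Matrix.vandermonde u).det = 1 := by
  interval_cases M <;> simp [Matrix.vandermonde]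

/-- The density, over monic quadratics, of a pair of factors in the Leibniz expansion. -/
noncomputable def pairDensity (h : ℝ[X] → ℂ) (P Q : ℂ[X]) (q : Fin 2 → ℝ) : ℂ :=
  h (monicPoly q) * P.eval (lowRoot q) * Q.eval (highRoot q) / (highRoot q - lowRoot q)

/-- The Leibniz expansion of the integral over monic polynomials of a multiplicative function. -/
theorem factorial_mul_integral_eq_sum (hM : M ≤ 1) (h : ℝ[X] →* ℂ) {n : ℕ} (hn : n = 2 * J + M)
    (hm : Measurable fun b : Fin n → ℝ => h (monicPoly b))
    (hi : Integrable fun b : Fin n → ℝ => h (monicPoly b))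
    (P : Fin (M + 2 * J) → ℂ[X]) (hP : ∀ i, (P i).Monic) (hPd : ∀ i, (P i).natDegree = i)
    (hB : ∀ j k, Integrable (pairDensity h (P j) (P k)))
    (hL : ∀ j, Integrable fun x : ℝ => h (X - C x) * (P j).eval (x : ℂ)) :
    (J.factorial : ℂ) * ∫ b : Fin n → ℝ, h (monicPoly b) =
      ∑ σ : Equiv.Perm (Fin (M + 2 * J)), (Equiv.Perm.sign σ : ℂ) *
        ((∏ i, ∫ q, pairDensity h (P (σ (fstIdx M i))) (P (σ (sndIdx M i))) q) *
          ∏ c, ∫ x : ℝ, h (X - C x) * (P (σ (lastIdx J c))).eval (x : ℂ)) := by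
  obtain ⟨K, hK⟩ := integral_chainResultant_smul M J
  obtain ⟨-, -, h3⟩ := hK n hn h hm hi
  -- Because `M ≤ 1`, the integer part of `(2 + 2i + M) / 2` is `i + 1`.
  have hfac : (∏ i ∈ Finset.range J, (((2 + (2 * i + M)) / 2 : ℕ) : ℝ)) = J.factorial := by
    rw [← Finset.prod_range_add_one_eq_factorial, Nat.cast_prod]
    refine Finset.prod_congr rfl fun i _ => ?_
    congr 1
    omega
  rw [hfac] at h3
  have hlin : ∀ w : Fin M → ℝ, h (monicPoly w) = ∏ c, h (X - C (-w c)) := by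
    intro w
    rw [← map_prod]
    congr 1
    interval_cases M <;> simp [monicPoly, lowPoly]
  -- The linear factor is `x + w`, so its root is `-w`; a reflection of the line removes the sign
  -- after integration.
  let T : Equiv.Perm (Fin (M + 2 * J)) → (Fin J → Fin 2 → ℝ) × (Fin M → ℝ) → ℂ := fun σ p =>
    (∏ i, pairDensity h (P (σ (fstIdx M i))) (P (σ (sndIdx M i))) (p.1 i)) *
      ∏ c, (h (X - C (-p.2 c)) * (P (σ (lastIdx J c))).eval ((-p.2 c : ℝ) : ℂ))
  have hLn : ∀ j, Integrable fun x : ℝ => h (X - C (-x)) * (P j).eval ((-x : ℝ) : ℂ) := fun j =>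
    (hL j).comp_neg
  have hTi : ∀ σ, Integrable (T σ) := fun σ =>
    (Integrable.fintype_prod fun i => hB (σ (fstIdx M i)) (σ (sndIdx M i))).mul_prod
      (Integrable.fintype_prod fun c => hLn (σ (lastIdx J c)))
  have hTe : ∀ σ, ∫ p, T σ p =
      (∏ i, ∫ q, pairDensity h (P (σ (fstIdx M i))) (P (σ (sndIdx M i))) q) *
          ∏ c, ∫ x : ℝ, h (X - C x) * (P (σ (lastIdx J c))).eval (x : ℂ) := by
    intro σ
    refine (integral_prod_mul (μ := (volume : Measure (Fin J → Fin 2 → ℝ)))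
      (ν := (volume : Measure (Fin M → ℝ)))
      (fun p => ∏ i, pairDensity h (P (σ (fstIdx M i))) (P (σ (sndIdx M i))) (p i))
      (fun w => ∏ c, (h (X - C (-w c)) * (P (σ (lastIdx J c))).eval ((-w c : ℝ) : ℂ)))).trans ?_
    rw [integral_fintype_prod_volume_eq_prod, integral_fintype_prod_volume_eq_prod
      (f := fun c x => h (X - C (-x)) * (P (σ (lastIdx J c))).eval ((-x : ℝ) : ℂ))]
    congr 1
    refine Finset.prod_congr rfl fun c _ => ?_
    exact integral_neg_eq_self (fun x : ℝ => h (X - C x) * (P (σ (lastIdx J c))).eval (x : ℂ)) volume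
  have hne : ∀ᵐ p : (Fin J → Fin 2 → ℝ) × (Fin M → ℝ), ∀ i, quadDisc (p.1 i) ≠ 0 := by
    rw [ae_all_iff]
    intro i
    have h1 : Measure.QuasiMeasurePreserving (fun q : Fin J → Fin 2 → ℝ => q i) :=
      Measure.quasiMeasurePreserving_eval (fun _ => volume) i
    exact (h1.comp Measure.quasiMeasurePreserving_fst).ae ae_quadDisc_ne_zero
  have hae : (fun p : (Fin J → Fin 2 → ℝ) × (Fin M → ℝ) =>
      chainResultant p.2 J p.1 • h (prodPoly p.1 p.2)) =ᵐ[volume]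
      fun p => ∑ σ, (Equiv.Perm.sign σ : ℂ) * T σ p := by
    filter_upwards [hne] with p hp
    have hd : ∏ i, (highRoot (p.1 i) - lowRoot (p.1 i)) ≠ 0 := by
      refine Finset.prod_ne_zero_iff.2 fun i _ => sub_ne_zero.2 fun heq => hp i ?_
      exact (quadDisc_eq_zero_iff _).2 heq.symm
    have hu := map_monicPoly_of_le_one hM p.2
    have hV := det_vandermonde_rootVec hu p.1
    -- Monic polynomials of degrees `0, 1, 2, …` give the same determinant as the powers.
    -- Transposing puts the permutation on the polynomials and leaves the roots in order, so that
    -- the variables separate.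
    rw [det_vandermonde_of_le_one hM, mul_one,
      Matrix.det_eval_matrixOfPolynomials_eq_det_vandermonde _ P hPd hP, ← Matrix.det_transpose,
      Matrix.det_apply'] at hV
    have hh : h (prodPoly p.1 p.2) = (∏ i, h (monicPoly (p.1 i))) * ∏ c, h (X - C (-p.2 c)) := by
      rw [prodPoly, map_mul, map_prod, hlin]
    rw [Complex.real_smul]
    apply mul_left_cancel₀ hd
    rw [← mul_assoc, ← hV, Finset.sum_mul, Finset.mul_sum]
    refine Finset.sum_congr rfl fun σ _ => ?_
    have hprod := prod_pairs (fun r => (P (σ r)).eval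
      (rootVec (fun c => -(p.2 c : ℂ)) J p.1 r))
    simp only [rootVec_fstIdx, rootVec_sndIdx, rootVec_lastIdx] at hprod
    simp only [Matrix.transpose_apply, Matrix.of_apply]
    rw [hprod, hh]
    simp only [T, pairDensity, Finset.prod_div_distrib, Finset.prod_mul_distrib]
    push_cast
    field_simp
  calc (J.factorial : ℂ) * ∫ b : Fin n → ℝ, h (monicPoly b)
      = ∫ p : (Fin J → Fin 2 → ℝ) × (Fin M → ℝ),
        chainResultant p.2 J p.1 • h (prodPoly p.1 p.2) := by
        rw [h3, Complex.real_smul]; simp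
    _ = ∫ p, ∑ σ, (Equiv.Perm.sign σ : ℂ) * T σ p := integral_congr_ae hae
    _ = ∑ σ, ∫ p, (Equiv.Perm.sign σ : ℂ) * T σ p :=
        integral_finsetSum _ fun σ _ => (hTi σ).const_mul _
    _ = _ := by
        refine Finset.sum_congr rfl fun σ _ => ?_
        rw [integral_const_mul, hTe]

end VandermondeChain

/-! ### From permutations of indices to permutations of pairs -/

section Expansion

open Equiv Finset

variable {J : ℕ}

/-- The position `2 i + s` of the index `(i, s)`. -/
def pairPos {n : ℕ} (x : Fin n × Fin 2) : ℕ := 2 * (x.1 : ℕ) + x.2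

theorem sum_perm_pairs_even (B : Fin (0 + 2 * J) → Fin (0 + 2 * J) → ℂ)
    (h : ∀ j k : Fin (0 + 2 * J), (j : ℕ) % 2 = k % 2 → B j k = B k j) :
    ∑ σ : Perm (Fin (0 + 2 * J)), (Perm.sign σ : ℂ) *
        ∏ i, B (σ (fstIdx 0 i)) (σ (sndIdx 0 i)) =
      J.factorial * (Matrix.of fun r i : Fin J =>
        B (fstIdx 0 r) (sndIdx 0 i) - B (sndIdx 0 i) (fstIdx 0 r)).det := by
  let e : Fin J × Fin 2 ≃ Fin (0 + 2 * J) := finProdFinEquiv.trans (finCongr (by omega))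
  have he : ∀ x, ((e x : Fin (0 + 2 * J)) : ℕ) = pairPos x := by
    intro x
    simp [e, pairPos]
    omega
  have e0 : ∀ i, e (i, 0) = fstIdx 0 i := fun i => Fin.ext (by rw [he]; simp [pairPos, fstIdx])
  have e1 : ∀ i, e (i, 1) = sndIdx 0 i := fun i => Fin.ext (by rw [he]; simp [pairPos, sndIdx])
  have h1 := pairSum_const (fun x y : Fin J × Fin 2 => B (e x) (e y)) (by
    intro j k s
    refine h _ _ ?_
    rw [he, he, pairPos, pairPos]
    simp only
    omega)
  simp only [e0, e1, Fintype.card_fin] at h1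
  rw [← h1, pairSum, ← Equiv.sum_comp e.permCongr]
  refine Finset.sum_congr rfl fun σ _ => ?_
  simp [← e0, ← e1, Perm.sign_permCongr]

/-- Reindexing `Fin (2 J + 1)` with one additional point by pairs. -/
noncomputable def optionPairEquiv (J : ℕ) : Option (Fin (1 + 2 * J)) ≃ Fin (J + 1) × Fin 2 :=
  (finSuccEquivLast.symm.trans (finCongr (by omega))).trans
    (finProdFinEquiv : Fin (J + 1) × Fin 2 ≃ Fin ((J + 1) * 2)).symm

theorem pairPos_optionPairEquiv_some (j : Fin (1 + 2 * J)) :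
    pairPos (optionPairEquiv J (some j)) = j := by
  simp [optionPairEquiv, pairPos, Nat.div_add_mod]

theorem pairPos_optionPairEquiv_none : pairPos (optionPairEquiv J none) = 1 + 2 * J := by
  simp [optionPairEquiv, pairPos, Nat.div_add_mod]
  omega

theorem pairPos_injective {n : ℕ} : Function.Injective (pairPos : Fin n × Fin 2 → ℕ) := by
  rintro ⟨i, s⟩ ⟨j, t⟩ h
  simp only [pairPos] at h
  ext <;> simp <;> omega

/-- Permutations of `Option β` that fix `none` are exactly the extensions of permutations of `β`. -/
theorem sum_perm_option {β : Type*} [Fintype β] [DecidableEq β] (f : Perm (Option β) → ℂ)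
    (hf : ∀ ρ, ρ none ≠ none → f ρ = 0) :
    ∑ ρ : Perm (Option β), f ρ = ∑ σ : Perm β, f (optionCongr σ) := by
  rw [← Equiv.sum_comp (Perm.decomposeOption (α := β)).symm, Fintype.sum_prod_type,
    Finset.sum_eq_single none]
  · refine Finset.sum_congr rfl fun σ _ => congrArg f ?_
    ext1 x
    simp
  · intro x _ hx
    refine Finset.sum_eq_zero fun σ _ => hf _ ?_
    simpa using hx
  · simp

/-- An extra index completes the unpaired one to a pair. The kernel of that last pair is `L` in its
first slot and requires the extra index in its second, so only permutations fixing the extra index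
count. -/
theorem sum_perm_pairs_odd (B : Fin (1 + 2 * J) → Fin (1 + 2 * J) → ℂ)
    (L : Fin (1 + 2 * J) → ℂ)
    (h : ∀ j k : Fin (1 + 2 * J), (j : ℕ) % 2 = k % 2 → B j k = B k j)
    (hL : ∀ j : Fin (1 + 2 * J), (j : ℕ) % 2 = 1 → L j = 0) :
    ∑ σ : Perm (Fin (1 + 2 * J)), (Perm.sign σ : ℂ) *
        ((∏ i, B (σ (fstIdx 1 i)) (σ (sndIdx 1 i))) * L (σ (lastIdx J 0))) =
      J.factorial * (Matrix.of fun r i : Fin (J + 1) =>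
        if hi : (i : ℕ) < J then
          B ⟨2 * r, by omega⟩ ⟨2 * i + 1, by omega⟩ - B ⟨2 * i + 1, by omega⟩ ⟨2 * r, by omega⟩
        else L ⟨2 * r, by omega⟩).det := by
  let e := optionPairEquiv J
  let B' : Fin (J + 1) × Fin 2 → Fin (J + 1) × Fin 2 → ℂ := fun x y =>
    if h : pairPos x < 1 + 2 * J ∧ pairPos y < 1 + 2 * J then
      B ⟨pairPos x, h.1⟩ ⟨pairPos y, h.2⟩ else 0
  let L' : Fin (J + 1) × Fin 2 → Fin (J + 1) × Fin 2 → ℂ := fun x y =>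
    if h : pairPos x < 1 + 2 * J ∧ ¬ pairPos y < 1 + 2 * J then L ⟨pairPos x, h.1⟩ else 0
  have hlast : ∀ i : Fin (J + 1), i ≠ Fin.last J → (i : ℕ) < J := fun i hi =>
    lt_of_le_of_ne (Nat.lt_succ_iff.1 i.2) fun h => hi (Fin.ext h)
  have h1 := pairSum_update (Fin.last J) B' L' (by
    intro j k s
    simp only [B']
    by_cases hjk : pairPos (j, s) < 1 + 2 * J ∧ pairPos (k, s) < 1 + 2 * J
    · rw [dif_pos hjk, dif_pos hjk.symm]
      refine h _ _ ?_
      simp only [pairPos]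
      omega
    · rw [dif_neg hjk, dif_neg fun h => hjk h.symm]) (by
    -- The extra position `2J + 1` is odd, so with equal second coordinates the first position is
    -- odd as well, where `L` vanishes.
    have h0 : ∀ j k s, L' (j, s) (k, s) = 0 := by
      intro j k s
      simp only [L']
      split_ifs with hjk
      · refine hL _ ?_
        simp only [pairPos] at hjk ⊢
        omega
      · rfl
    intro j k s
    rw [h0, h0]) (by
    intro r
    have : ¬ pairPos (Fin.last J, (1 : Fin 2)) < 1 + 2 * J := by simp [pairPos]; omega
    simp [B', this]) (by
    intro r k hk
    have h1 : pairPos (k, (1 : Fin 2)) < 1 + 2 * J := by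
      have := hlast k hk
      simp [pairPos]; omega
    have h2 : pairPos (r, (0 : Fin 2)) < 1 + 2 * J := by
      simp [pairPos]; omega
    simp [L', h1.not_ge, h2.not_ge])
  rw [Fintype.card_fin, Nat.add_sub_cancel] at h1
  convert h1 using 1
  · let B0 : Option (Fin (1 + 2 * J)) → Option (Fin (1 + 2 * J)) → ℂ := fun x y => B' (e x) (e y)
    have hB0 : ∀ j k, B0 (some j) (some k) = B j k := by
      intro j k
      simp [B0, B', e, pairPos_optionPairEquiv_some]
    have hL0 : ∀ j, L' (e (some j)) (e none) = L j := by
      intro j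
      simp [L', e, pairPos_optionPairEquiv_some, pairPos_optionPairEquiv_none]
    have hL1 : ∀ j k, L' j (e (some k)) = 0 := by
      intro j k
      simp [L', e, pairPos_optionPairEquiv_some]
    have p0 : ∀ i : Fin J, (i.castSucc, (0 : Fin 2)) = e (some (fstIdx 1 i)) := fun i =>
      pairPos_injective (by rw [pairPos_optionPairEquiv_some]; simp [pairPos, fstIdx])
    have p1 : ∀ i : Fin J, (i.castSucc, (1 : Fin 2)) = e (some (sndIdx 1 i)) := fun i =>
      pairPos_injective (by rw [pairPos_optionPairEquiv_some]; simp [pairPos, sndIdx])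
    have p2 : (Fin.last J, (0 : Fin 2)) = e (some (lastIdx J 0)) :=
      pairPos_injective (by rw [pairPos_optionPairEquiv_some]; simp [pairPos, lastIdx])
    have p3 : (Fin.last J, (1 : Fin 2)) = e none :=
      pairPos_injective (by rw [pairPos_optionPairEquiv_none]; simp [pairPos]; omega)
    rw [pairSum, ← Equiv.sum_comp e.permCongr, sum_perm_option]
    · refine Finset.sum_congr rfl fun σ _ => ?_
      rw [Perm.sign_permCongr, optionCongr_sign, Fin.prod_univ_castSucc]
      congr 2
      · refine Finset.prod_congr rfl fun i _ => ?_
        rw [if_neg (Fin.castSucc_lt_last i).ne, p0, p1]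
        simp [← hB0, B0]
      · rw [if_pos rfl, p2, p3]
        simp [← hL0]
    · intro ρ hρ
      rw [Fin.prod_univ_castSucc, if_pos rfl, p2, p3]
      obtain ⟨k, hk⟩ := Option.ne_none_iff_exists'.1 hρ
      simp [hk, hL1]
  · congr 2
    ext r i
    have q0 : ∀ r : Fin (J + 1), pairPos (r, (0 : Fin 2)) < 1 + 2 * J := fun r => by
      simp [pairPos]; omega
    simp only [Matrix.of_apply]
    by_cases hi : (i : ℕ) < J
    · have hi' : i ≠ Fin.last J := fun h => by simp [h] at hi
      have q1 : pairPos (i, (1 : Fin 2)) < 1 + 2 * J := by simp [pairPos]; omega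
      rw [dif_pos hi, if_neg hi']
      simp only [B']
      rw [dif_pos ⟨q0 r, q1⟩, dif_pos ⟨q1, q0 r⟩]
      rfl
    · have hi' : i = Fin.last J := by_contra fun h => hi (hlast i h)
      have q1 : ¬ pairPos (Fin.last J, (1 : Fin 2)) < 1 + 2 * J := by simp [pairPos]; omega
      rw [dif_neg hi, if_pos hi']
      simp only [L']
      rw [dif_pos ⟨q0 r, q1⟩, dif_neg fun h => q1 h.1, sub_zero]
      rfl

end Expansion

/-! ### Growth of the distance function and absolute convergence -/

section Bounds

open Polynomial

variable {Φ : ℂ[X] → ℝ}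

theorem IsMultiplicativeDistance.map_one (hΦ : IsMultiplicativeDistance Φ) : Φ 1 = 1 := by
  have h1 : Φ 1 ≠ 0 := fun h => one_ne_zero ((hΦ.eq_zero_iff 1).1 h)
  have h2 := hΦ.map_mul 1 1
  rw [mul_one] at h2
  exact (mul_eq_left₀ h1).1 h2.symm

theorem IsMultiplicativeDistance.pos (hΦ : IsMultiplicativeDistance Φ) {f : ℂ[X]} (hf : f ≠ 0) :
    0 < Φ f :=
  lt_of_le_of_ne (hΦ.nonneg f) fun h => hf ((hΦ.eq_zero_iff f).1 h.symm)

theorem sum_C_mul_X_pow_eq_zero {n : ℕ} {a : Fin n → ℂ}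
    (h : ∑ i : Fin n, C (a i) * X ^ (i : ℕ) = 0) : a = 0 := by
  ext j
  have := congrArg (fun f => coeff f j) h
  simpa [coeff_X_pow, Fin.val_inj, Finset.sum_ite_eq] using this

/-- A multiplicative distance function dominates the sup norm of the coefficient vector. -/
theorem IsMultiplicativeDistance.exists_norm_le (hΦ : IsMultiplicativeDistance Φ) (n : ℕ) :
    ∃ c > 0, ∀ a : Fin n → ℂ, c * ‖a‖ ≤ Φ (∑ i : Fin n, C (a i) * X ^ (i : ℕ)) := by
  rcases (Metric.sphere (0 : Fin n → ℂ) 1).eq_empty_or_nonempty with h | h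
  · refine ⟨1, one_pos, fun a => ?_⟩
    have : a = 0 := by
      by_contra ha
      have : ‖a‖⁻¹ • a ∈ Metric.sphere (0 : Fin n → ℂ) 1 := by
        simp [norm_smul, norm_ne_zero_iff.2 ha]
      rw [h] at this
      exact this
    simp [this, hΦ.nonneg]
  -- The constant is the minimum of `Φ` over the compact unit sphere, positive by definiteness;
  -- homogeneity extends the bound to all vectors.
  · obtain ⟨a₀, ha₀, hmin⟩ := (isCompact_sphere (0 : Fin n → ℂ) 1).exists_isMinOn h
      (hΦ.continuous n).continuousOn
    have ha₀' : a₀ ≠ 0 := fun h0 => by simp [h0] at ha₀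
    refine ⟨_, hΦ.pos fun h0 => ha₀' (sum_C_mul_X_pow_eq_zero h0), fun a => ?_⟩
    rcases eq_or_ne a 0 with rfl | ha
    · simp [hΦ.nonneg]
    have hn : ‖a‖ ≠ 0 := norm_ne_zero_iff.2 ha
    let a' : Fin n → ℂ := ((‖a‖⁻¹ : ℝ) : ℂ) • a
    have ha' : a' ∈ Metric.sphere (0 : Fin n → ℂ) 1 := by
      simp [a', norm_smul, hn]
    have h1 := hmin ha'
    have h2 : ∑ i : Fin n, C (a i) * X ^ (i : ℕ) =
        C ((‖a‖ : ℝ) : ℂ) * ∑ i : Fin n, C (a' i) * X ^ (i : ℕ) := by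
      rw [Finset.mul_sum]
      refine Finset.sum_congr rfl fun i _ => ?_
      rw [← mul_assoc, ← C_mul]
      congr 2
      simp only [a', Pi.smul_apply, smul_eq_mul]
      rw [← mul_assoc, ← Complex.ofReal_mul, mul_inv_cancel₀ hn, Complex.ofReal_one, one_mul]
    rw [h2, hΦ.homogeneous, mul_comm]
    have h3 : ‖((‖a‖ : ℝ) : ℂ)‖ = ‖a‖ := by simp
    rw [h3]
    exact mul_le_mul_of_nonneg_left h1 (norm_nonneg a)

/-- The multiplicative function `f ↦ Φ(f)^(-s)` on real polynomials. -/
noncomputable def weight (hΦ : IsMultiplicativeDistance Φ) (s : ℂ) : ℝ[X] →* ℂ where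
  toFun f := (Φ (f.map (algebraMap ℝ ℂ)) : ℂ) ^ (-s)
  map_one' := by simp [hΦ.map_one]
  map_mul' f g := by
    rw [Polynomial.map_mul, hΦ.map_mul, Complex.ofReal_mul,
      Complex.mul_cpow_ofReal_nonneg (hΦ.nonneg _) (hΦ.nonneg _)]

theorem weight_apply (hΦ : IsMultiplicativeDistance Φ) (s : ℂ) (f : ℝ[X]) :
    weight hΦ s f = (Φ (f.map (algebraMap ℝ ℂ)) : ℂ) ^ (-s) := rfl

theorem continuous_cpow_neg {Y : Type*} [TopologicalSpace Y] {F : Y → ℝ} (hF : Continuous F)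
    (hpos : ∀ y, 0 < F y) (s : ℂ) : Continuous fun y => (F y : ℂ) ^ (-s) :=
  (Complex.continuous_ofReal.comp hF).cpow continuous_const fun y =>
    Complex.ofReal_mem_slitPlane.2 (hpos y)

theorem norm_cpow_neg_le {x y : ℝ} {s : ℂ} (hs : 0 ≤ s.re) (hx : 0 < x) (hxy : x ≤ y) :
    ‖(y : ℂ) ^ (-s)‖ ≤ x ^ (-s.re) := by
  rw [Complex.norm_cpow_eq_rpow_re_of_pos (hx.trans_le hxy), Complex.neg_re]
  exact Real.rpow_le_rpow_of_nonpos hx hxy (neg_nonpos.2 hs)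

theorem map_monicPoly_eq_sum {N : ℕ} (b : Fin N → ℝ) :
    (monicPoly b).map (algebraMap ℝ ℂ) = ∑ i : Fin (N + 1),
      C ((Fin.snoc (fun i => (b i : ℂ)) 1 : Fin (N + 1) → ℂ) i) * X ^ (i : ℕ) := by
  rw [Fin.sum_univ_castSucc]
  simp [monicPoly, lowPoly, Polynomial.map_sum, add_comm]

theorem continuous_snoc_one (N : ℕ) : Continuous fun b : Fin N → ℝ =>
    (Fin.snoc (fun i => (b i : ℂ)) 1 : Fin (N + 1) → ℂ) := by
  refine continuous_pi fun i => ?_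
  refine Fin.lastCases ?_ (fun i => ?_) i
  · simp only [Fin.snoc_last]
    exact continuous_const
  · simp only [Fin.snoc_castSucc]
    fun_prop

theorem continuous_weight_monicPoly (hΦ : IsMultiplicativeDistance Φ) (s : ℂ) (N : ℕ) :
    Continuous fun b : Fin N → ℝ => weight hΦ s (monicPoly b) := by
  refine continuous_cpow_neg ?_ (fun b => hΦ.pos ?_) s
  · simp only [map_monicPoly_eq_sum]
    exact (hΦ.continuous (N + 1)).comp (continuous_snoc_one N)
  · exact ((monic_monicPoly b).map _).ne_zero

/-- The coefficient vector including the leading `1` has norm at least `1` and at least `‖b‖`, hence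
at least `(1 + ‖b‖) / 2`. The weight is thus bounded by a multiple of `(1 + ‖b‖) ^ (-Re s)`,
integrable on `ℝ^N` for `Re s > N`. -/
theorem integrable_weight_monicPoly (hΦ : IsMultiplicativeDistance Φ) {s : ℂ} {N : ℕ}
    (hs : (N : ℝ) < s.re) : Integrable fun b : Fin N → ℝ => weight hΦ s (monicPoly b) := by
  obtain ⟨c, hc, hle⟩ := hΦ.exists_norm_le (N + 1)
  have hs0 : 0 ≤ s.re := (Nat.cast_nonneg N).trans hs.le
  have h1 : Integrable fun b : Fin N → ℝ => (c / 2) ^ (-s.re) * (1 + ‖b‖) ^ (-s.re) :=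
    (integrable_one_add_norm (by simpa using hs)).const_mul _
  refine h1.mono' (continuous_weight_monicPoly hΦ s N).aestronglyMeasurable
    (Filter.Eventually.of_forall fun b => ?_)
  rw [← Real.mul_rpow (by positivity) (by positivity)]
  refine norm_cpow_neg_le hs0 (by positivity) ?_
  rw [map_monicPoly_eq_sum]
  refine le_trans ?_ (hle _)
  set a : Fin (N + 1) → ℂ := Fin.snoc (fun i => (b i : ℂ)) 1 with ha
  have e1 : (1 : ℝ) ≤ ‖a‖ := by
    have := norm_le_pi_norm a (Fin.last N)
    simpa [ha] using this
  have e2 : ‖b‖ ≤ ‖a‖ := by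
    refine (pi_norm_le_iff_of_nonneg (norm_nonneg a)).2 fun i => ?_
    have := norm_le_pi_norm a i.castSucc
    simpa [ha] using this
  nlinarith

/-- The moment integrand lists coefficients from the highest power down and `monicPoly` from the
lowest up, hence the volume-preserving reversal. -/
theorem momentIntegrand_eq (hΦ : IsMultiplicativeDistance Φ) (s : ℂ) (N : ℕ) (b : Fin N → ℝ) :
    momentIntegrand Φ N s b = weight hΦ s (monicPoly fun i => b (Fin.rev i)) := by
  rw [momentIntegrand, monicRestriction, weight_apply]
  congr 3
  simp only [monicPoly, lowPoly, Polynomial.map_add, Polynomial.map_pow, map_X,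
    Polynomial.map_sum, Polynomial.map_mul, map_C, Complex.coe_algebraMap]
  congr 1
  rw [← Equiv.sum_comp Fin.revPerm]
  refine Finset.sum_congr rfl fun i _ => ?_
  rw [Fin.revPerm_apply, Fin.val_rev]
  congr 2
  omega

theorem measurePreserving_rev (N : ℕ) : MeasurePreserving
    (MeasurableEquiv.arrowCongr' (Fin.revPerm (n := N)) (MeasurableEquiv.refl ℝ)) :=
  volume_preserving_arrowCongr' _ _ (MeasurePreserving.id _)

theorem integrable_momentIntegrand (hΦ : IsMultiplicativeDistance Φ) {s : ℂ} {N : ℕ}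
    (hs : (N : ℝ) < s.re) : Integrable (momentIntegrand Φ N s) := by
  have h := ((measurePreserving_rev N).integrable_comp_emb
    (MeasurableEquiv.measurableEmbedding _)).2 (integrable_weight_monicPoly hΦ hs)
  refine h.congr (Filter.Eventually.of_forall fun b => ?_)
  rw [momentIntegrand_eq hΦ]
  rfl

theorem momentFunction_eq (hΦ : IsMultiplicativeDistance Φ) (s : ℂ) (N : ℕ) :
    momentFunction Φ N s = ∫ b : Fin N → ℝ, weight hΦ s (monicPoly b) := by
  rw [← (measurePreserving_rev N).integral_comp'
    (g := fun b : Fin N → ℝ => weight hΦ s (monicPoly b)), momentFunction]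
  congr 1
  ext b
  rw [momentIntegrand_eq hΦ]
  rfl

/-- The function `φ(z)^(-s) P(z)` on the complex plane. -/
noncomputable def rootWeight (Φ : ℂ[X] → ℝ) (s : ℂ) (P : ℂ[X]) (z : ℂ) : ℂ :=
  (rootFunction Φ z : ℂ) ^ (-s) * P.eval z

theorem rootFunction_eq (z : ℂ) : rootFunction Φ z =
    Φ (∑ i : Fin 2, C ((![-z, 1] : Fin 2 → ℂ) i) * X ^ (i : ℕ)) := by
  rw [rootFunction]
  congr 1
  simp [Fin.sum_univ_two]
  ring

theorem rootFunction_pos (hΦ : IsMultiplicativeDistance Φ) (z : ℂ) : 0 < rootFunction Φ z :=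
  hΦ.pos (X_sub_C_ne_zero z)

theorem continuous_rootFunction (hΦ : IsMultiplicativeDistance Φ) :
    Continuous (rootFunction Φ) := by
  have h1 : Continuous fun z : ℂ => (![-z, 1] : Fin 2 → ℂ) := by
    refine continuous_pi fun i => ?_
    fin_cases i
    · exact continuous_neg
    · exact continuous_const
  have h2 := (hΦ.continuous 2).comp h1
  refine h2.congr fun z => ?_
  rw [rootFunction_eq]
  rfl

theorem continuous_rootWeight (hΦ : IsMultiplicativeDistance Φ) (s : ℂ) (P : ℂ[X]) :
    Continuous (rootWeight Φ s P) :=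
  (continuous_cpow_neg (continuous_rootFunction hΦ) (rootFunction_pos hΦ) s).mul P.continuous

theorem exists_norm_eval_le (P : ℂ[X]) {d : ℕ} (hd : P.natDegree ≤ d) :
    ∃ K, 0 ≤ K ∧ ∀ z, ‖P.eval z‖ ≤ K * (1 + ‖z‖) ^ (d : ℝ) := by
  refine ⟨∑ i ∈ Finset.range (d + 1), ‖P.coeff i‖,
    Finset.sum_nonneg fun _ _ => norm_nonneg _, fun z => ?_⟩
  rw [eval_eq_sum_range' (Nat.lt_succ_of_le hd), Finset.sum_mul]
  refine (norm_sum_le _ _).trans (Finset.sum_le_sum fun i hi => ?_)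
  rw [norm_mul, norm_pow, Real.rpow_natCast]
  refine mul_le_mul_of_nonneg_left ?_ (norm_nonneg _)
  have h1 : ‖z‖ ^ i ≤ (1 + ‖z‖) ^ i := pow_le_pow_left₀ (norm_nonneg _) (by linarith) i
  refine h1.trans (pow_le_pow_right₀ (by linarith [norm_nonneg z]) ?_)
  exact Nat.lt_succ_iff.1 (Finset.mem_range.1 hi)

theorem exists_norm_rootWeight_le (hΦ : IsMultiplicativeDistance Φ) {s : ℂ} (hs : 0 ≤ s.re)
    (P : ℂ[X]) {d : ℕ} (hd : P.natDegree ≤ d) :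
    ∃ K, 0 ≤ K ∧ ∀ z, ‖rootWeight Φ s P z‖ ≤ K * (1 + ‖z‖) ^ (-(s.re - d)) := by
  obtain ⟨c, hc, hle⟩ := hΦ.exists_norm_le 2
  obtain ⟨K, hK, hP⟩ := exists_norm_eval_le P hd
  refine ⟨(c / 2) ^ (-s.re) * K, by positivity, fun z => ?_⟩
  have h1 : ‖(rootFunction Φ z : ℂ) ^ (-s)‖ ≤ (c / 2) ^ (-s.re) * (1 + ‖z‖) ^ (-s.re) := by
    rw [← Real.mul_rpow (by positivity) (by positivity)]
    refine norm_cpow_neg_le hs (by positivity) ?_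
    rw [rootFunction_eq]
    refine le_trans ?_ (hle _)
    have e1 : (1 : ℝ) ≤ ‖(![-z, 1] : Fin 2 → ℂ)‖ := by
      simpa using norm_le_pi_norm (![-z, 1] : Fin 2 → ℂ) 1
    have e2 : ‖z‖ ≤ ‖(![-z, 1] : Fin 2 → ℂ)‖ := by
      simpa using norm_le_pi_norm (![-z, 1] : Fin 2 → ℂ) 0
    nlinarith
  have h2 : (1 + ‖z‖) ^ (-(s.re - d)) = (1 + ‖z‖) ^ (-s.re) * (1 + ‖z‖) ^ (d : ℝ) := by
    rw [← Real.rpow_add (by positivity)]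
    congr 1
    ring
  rw [rootWeight, norm_mul, h2]
  calc _ ≤ ((c / 2) ^ (-s.re) * (1 + ‖z‖) ^ (-s.re)) * (K * (1 + ‖z‖) ^ (d : ℝ)) :=
        mul_le_mul h1 (hP z) (norm_nonneg _) (by positivity)
    _ = _ := by ring

theorem integrable_rootWeight_ofReal (hΦ : IsMultiplicativeDistance Φ) {s : ℂ}
    {P : ℂ[X]} (hd : (P.natDegree : ℝ) + 1 < s.re) :
    Integrable fun x : ℝ => rootWeight Φ s P x := by
  have hs : 0 ≤ s.re := by
    have : (0 : ℝ) ≤ P.natDegree := Nat.cast_nonneg _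
    linarith
  obtain ⟨K, -, hK⟩ := exists_norm_rootWeight_le hΦ hs P le_rfl
  have h1 : Integrable fun x : ℝ => K * (1 + ‖x‖) ^ (-(s.re - P.natDegree)) :=
    (integrable_one_add_norm (by simp; linarith)).const_mul _
  refine h1.mono' ((continuous_rootWeight hΦ s P).comp
    Complex.continuous_ofReal).aestronglyMeasurable (Filter.Eventually.of_forall fun x => ?_)
  simpa using hK x

/-- Each factor decays with exponent greater than `1`, so the product decays with exponent greater
than `2`, the real dimension of `ℂ`. -/
theorem integrable_rootWeight_conj_mul (hΦ : IsMultiplicativeDistance Φ) {s : ℂ}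
    {P Q : ℂ[X]} (hP : (P.natDegree : ℝ) + 1 < s.re) (hQ : (Q.natDegree : ℝ) + 1 < s.re) :
    Integrable fun β : ℂ => rootWeight Φ s P (starRingEnd ℂ β) * rootWeight Φ s Q β := by
  have hs : 0 ≤ s.re := by
    have : (0 : ℝ) ≤ P.natDegree := Nat.cast_nonneg _
    linarith
  obtain ⟨K, hK0, hK⟩ := exists_norm_rootWeight_le hΦ hs P le_rfl
  obtain ⟨K', hK0', hK'⟩ := exists_norm_rootWeight_le hΦ hs Q le_rfl
  have h1 : Integrable fun β : ℂ =>
      (K * K') * (1 + ‖β‖) ^ (-((s.re - P.natDegree) + (s.re - Q.natDegree))) :=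
    (integrable_one_add_norm (by simp; linarith)).const_mul _
  refine h1.mono' (((continuous_rootWeight hΦ s P).comp Complex.continuous_conj).mul
    (continuous_rootWeight hΦ s Q)).aestronglyMeasurable (Filter.Eventually.of_forall fun β => ?_)
  have h2 : (1 + ‖β‖) ^ (-((s.re - P.natDegree) + (s.re - Q.natDegree))) =
      (1 + ‖β‖) ^ (-(s.re - P.natDegree)) * (1 + ‖β‖) ^ (-(s.re - Q.natDegree)) := by
    rw [← Real.rpow_add (by positivity)]
    congr 1
    ring
  have h3 := hK (starRingEnd ℂ β)
  rw [RCLike.norm_conj] at h3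
  rw [norm_mul, h2]
  calc _ ≤ (K * (1 + ‖β‖) ^ (-(s.re - P.natDegree))) *
        (K' * (1 + ‖β‖) ^ (-(s.re - Q.natDegree))) :=
        mul_le_mul h3 (hK' β) (norm_nonneg _) (by positivity)
    _ = _ := by ring

end Bounds

/-! ### Splitting an integral against a sign -/

section SignSplit

variable {X : Type*} [MeasurableSpace X] {μ : Measure X} {F : X → ℂ} {τ : X → ℝ}

theorem mul_sign_eq_indicator_sub {X : Type*} (F : X → ℂ) (τ : X → ℝ) : (fun x => F x * (Real.sign (τ x) : ℂ)) =
    fun x => {x | 0 < τ x}.indicator F x - {x | τ x < 0}.indicator F x := by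
  ext x
  rcases lt_trichotomy (τ x) 0 with h | h | h
  · simp [Set.indicator, h, h.not_gt, Real.sign_of_neg h]
  · simp [Set.indicator, h]
  · simp [Set.indicator, h, h.not_gt, Real.sign_of_pos h]

theorem integrable_mul_sign (hF : Integrable F μ) (hτ : Measurable τ) :
    Integrable (fun x => F x * (Real.sign (τ x) : ℂ)) μ := by
  rw [mul_sign_eq_indicator_sub]
  exact (hF.indicator (measurableSet_lt measurable_const hτ)).sub
    (hF.indicator (measurableSet_lt hτ measurable_const))

/-- The involutions used for `e`, swapping coordinates and conjugation, reverse `τ` and so carry the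
negative half onto the positive one. -/
theorem integral_mul_sign (hF : Integrable F μ) (hτ : Measurable τ) {e : X → X}
    (he : MeasurePreserving e μ μ) (he' : MeasurableEmbedding e) (h : ∀ x, τ (e x) = -τ x) :
    ∫ x, F x * (Real.sign (τ x) : ℂ) ∂μ =
      ∫ x in {x | 0 < τ x}, F x ∂μ - ∫ x in {x | 0 < τ x}, F (e x) ∂μ := by
  have h1 : MeasurableSet {x | 0 < τ x} := measurableSet_lt measurable_const hτ
  have h2 : MeasurableSet {x | τ x < 0} := measurableSet_lt hτ measurable_const
  rw [mul_sign_eq_indicator_sub, integral_sub (hF.indicator h1) (hF.indicator h2),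
    integral_indicator h1, integral_indicator h2,
    ← he.setIntegral_preimage_emb he' F {x | τ x < 0}]
  congr 3
  ext x
  simp [h]

end SignSplit

/-! ### The skew form and its parity symmetry -/

section Forms

open Polynomial

variable {Φ : ℂ[X] → ℝ} {s : ℂ}

/-- The half of the skew-symmetric form supported on ordered pairs of real numbers and on the
upper half plane. -/
noncomputable def plusForm (Φ : ℂ[X] → ℝ) (s : ℂ) (P Q : ℂ[X]) : ℂ :=
  (∫ p in {p : ℝ × ℝ | p.1 < p.2}, rootWeight Φ s P p.1 * rootWeight Φ s Q p.2) +
    -2 * Complex.I *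
      ∫ β in {β : ℂ | 0 < β.im}, rootWeight Φ s P (starRingEnd ℂ β) * rootWeight Φ s Q β

theorem weight_X_sub_C (hΦ : IsMultiplicativeDistance Φ) (x : ℝ) (P : ℂ[X]) :
    weight hΦ s (X - C x) * P.eval (x : ℂ) = rootWeight Φ s P x := by
  simp [weight_apply, rootWeight, rootFunction]

theorem pairDensity_weight (hΦ : IsMultiplicativeDistance Φ) (P Q : ℂ[X]) (q : Fin 2 → ℝ) :
    pairDensity (weight hΦ s) P Q q =
      rootWeight Φ s P (lowRoot q) * rootWeight Φ s Q (highRoot q) /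
        (highRoot q - lowRoot q) := by
  rw [pairDensity, weight_apply, map_monicPoly_two, hΦ.map_mul, Complex.ofReal_mul,
    Complex.mul_cpow_ofReal_nonneg (hΦ.nonneg _) (hΦ.nonneg _), rootWeight, rootWeight,
    rootFunction, rootFunction]
  ring

theorem integrable_rootWeight_mul (hΦ : IsMultiplicativeDistance Φ) {P Q : ℂ[X]}
    (hP : (P.natDegree : ℝ) + 1 < s.re) (hQ : (Q.natDegree : ℝ) + 1 < s.re) :
    Integrable fun p : ℝ × ℝ => rootWeight Φ s P p.1 * rootWeight Φ s Q p.2 :=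
  (integrable_rootWeight_ofReal hΦ hP).mul_prod (integrable_rootWeight_ofReal hΦ hQ)

/-- The Jacobian in root coordinates meets the denominator `highRoot - lowRoot`: for real roots the
two cancel, and for conjugate roots `4 Im β / (2i Im β) = -2i`. -/
theorem integral_pairDensity (hΦ : IsMultiplicativeDistance Φ) {P Q : ℂ[X]}
    (hP : (P.natDegree : ℝ) + 1 < s.re) (hQ : (Q.natDegree : ℝ) + 1 < s.re) :
    Integrable (pairDensity (weight hΦ s) P Q) ∧
      ∫ q, pairDensity (weight hΦ s) P Q q = plusForm Φ s P Q := by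
  have hlt : MeasurableSet {p : ℝ × ℝ | p.1 < p.2} := measurableSet_lt measurable_fst measurable_snd
  have him : MeasurableSet {β : ℂ | 0 < β.im} := measurableSet_lt measurable_const Complex.measurable_im
  let H : ℂ → ℂ → ℂ := fun a b => rootWeight Φ s P a * rootWeight Φ s Q b / (b - a)
  have e1 : Set.EqOn (fun p : ℝ × ℝ => rootWeight Φ s P p.1 * rootWeight Φ s Q p.2)
      (fun p : ℝ × ℝ => (p.2 - p.1) • H p.1 p.2) {p : ℝ × ℝ | p.1 < p.2} := by
    intro p hp
    have h0 : (p.2 : ℂ) - p.1 ≠ 0 := by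
      rw [← Complex.ofReal_sub, Complex.ofReal_ne_zero]
      exact (sub_pos.2 hp).ne'
    simp only [H, Complex.real_smul, Complex.ofReal_sub]
    field_simp
  have e2 : Set.EqOn (fun β : ℂ => -2 * Complex.I *
        (rootWeight Φ s P (starRingEnd ℂ β) * rootWeight Φ s Q β))
      (fun β : ℂ => (4 * β.im) • H (starRingEnd ℂ β) β) {β : ℂ | 0 < β.im} := by
    intro β hβ
    have h0 : (β.im : ℂ) ≠ 0 := Complex.ofReal_ne_zero.2 (ne_of_gt hβ)
    simp only [H, Complex.real_smul, Complex.sub_conj]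
    push_cast
    have hI := Complex.I_ne_zero
    field_simp
    rw [Complex.I_sq]
    ring
  have i1 := (integrable_rootWeight_mul hΦ hP hQ).integrableOn (s := {p : ℝ × ℝ | p.1 < p.2})
  have i2 := ((integrable_rootWeight_conj_mul hΦ hP hQ).const_mul
    (-2 * Complex.I)).integrableOn (s := {β : ℂ | 0 < β.im})
  obtain ⟨h1, h2⟩ := integral_roots (H := H) (i1.congr_fun e1 hlt) (i2.congr_fun e2 him)
  have e3 : pairDensity (weight hΦ s) P Q = fun q => H (lowRoot q) (highRoot q) :=
    funext (pairDensity_weight hΦ P Q)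
  rw [e3]
  refine ⟨h1, ?_⟩
  rw [h2, ← setIntegral_congr_fun hlt e1, ← setIntegral_congr_fun him e2, plusForm,
    integral_const_mul]

theorem realIntegrand_eq (P Q : ℂ[X]) : realIntegrand Φ s P Q = fun p =>
    rootWeight Φ s P p.1 * rootWeight Φ s Q p.2 * (Real.sign (p.2 - p.1) : ℂ) := by
  ext p
  simp only [realIntegrand, rootWeight]
  ring

theorem complexIntegrand_eq (P Q : ℂ[X]) : complexIntegrand Φ s P Q = fun β =>
    rootWeight Φ s P (starRingEnd ℂ β) * rootWeight Φ s Q β * (Real.sign β.im : ℂ) := by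
  ext β
  simp only [complexIntegrand, rootWeight]
  ring

theorem integrable_realIntegrand (hΦ : IsMultiplicativeDistance Φ) {P Q : ℂ[X]}
    (hP : (P.natDegree : ℝ) + 1 < s.re) (hQ : (Q.natDegree : ℝ) + 1 < s.re) :
    Integrable (realIntegrand Φ s P Q) := by
  rw [realIntegrand_eq]
  exact integrable_mul_sign (integrable_rootWeight_mul hΦ hP hQ)
    (measurable_snd.sub measurable_fst)

theorem integrable_complexIntegrand (hΦ : IsMultiplicativeDistance Φ) {P Q : ℂ[X]}
    (hP : (P.natDegree : ℝ) + 1 < s.re) (hQ : (Q.natDegree : ℝ) + 1 < s.re) :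
    Integrable (complexIntegrand Φ s P Q) := by
  rw [complexIntegrand_eq]
  exact integrable_mul_sign (integrable_rootWeight_conj_mul hΦ hP hQ) Complex.measurable_im

theorem measurePreserving_swap : MeasurePreserving (Prod.swap : ℝ × ℝ → ℝ × ℝ) :=
  Measure.measurePreserving_swap

theorem measurableEmbedding_swap : MeasurableEmbedding (Prod.swap : ℝ × ℝ → ℝ × ℝ) :=
  (MeasurableEquiv.prodComm : ℝ × ℝ ≃ᵐ ℝ × ℝ).measurableEmbedding

theorem measurePreserving_conj : MeasurePreserving (starRingEnd ℂ) :=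
  Complex.conjLIE.measurePreserving

theorem measurableEmbedding_conj : MeasurableEmbedding (starRingEnd ℂ) :=
  Complex.conjLIE.toHomeomorph.measurableEmbedding

/-- The sign splits each integral into two halves. Swapping `x` and `y`, or conjugating `β`, turns
the negative half into the positive one with `P` and `Q` exchanged. -/
theorem skewForm_eq (hΦ : IsMultiplicativeDistance Φ) {P Q : ℂ[X]}
    (hP : (P.natDegree : ℝ) + 1 < s.re) (hQ : (Q.natDegree : ℝ) + 1 < s.re) :
    skewForm Φ s P Q = plusForm Φ s P Q - plusForm Φ s Q P := by
  have h1 : realForm Φ s P Q =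
      (∫ p in {p : ℝ × ℝ | p.1 < p.2}, rootWeight Φ s P p.1 * rootWeight Φ s Q p.2) -
        ∫ p in {p : ℝ × ℝ | p.1 < p.2}, rootWeight Φ s Q p.1 * rootWeight Φ s P p.2 := by
    rw [realForm, realIntegrand_eq]
    refine (integral_mul_sign (τ := fun p : ℝ × ℝ => p.2 - p.1)
      (integrable_rootWeight_mul hΦ hP hQ) (measurable_snd.sub measurable_fst)
      measurePreserving_swap measurableEmbedding_swap fun p => by simp).trans ?_
    simp only [sub_pos, Prod.fst_swap, Prod.snd_swap, mul_comm]
  have h2 : ∫ β, complexIntegrand Φ s P Q β =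
      (∫ β in {β : ℂ | 0 < β.im}, rootWeight Φ s P (starRingEnd ℂ β) * rootWeight Φ s Q β) -
        ∫ β in {β : ℂ | 0 < β.im}, rootWeight Φ s Q (starRingEnd ℂ β) * rootWeight Φ s P β := by
    rw [complexIntegrand_eq, integral_mul_sign (integrable_rootWeight_conj_mul hΦ hP hQ)
      Complex.measurable_im measurePreserving_conj measurableEmbedding_conj Complex.conj_im]
    simp only [Complex.conj_conj, mul_comm]
  rw [skewForm, complexForm, h1, h2, plusForm, plusForm]
  ring

theorem rootWeight_neg (hsymm : ∀ β, rootFunction Φ (-β) = rootFunction Φ β) {P : ℂ[X]} {ε : ℂ}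
    (hP : ∀ z, P.eval (-z) = ε * P.eval z) (z : ℂ) :
    rootWeight Φ s P (-z) = ε * rootWeight Φ s P z := by
  rw [rootWeight, hsymm, hP, rootWeight]
  ring

/-- The maps `(x, y) ↦ (-y, -x)` and `β ↦ -conj β` preserve `x < y` and the upper half plane. They
exchange the roles of `P` and `Q`, and the two equal parities cancel. -/
theorem plusForm_comm (hsymm : ∀ β, rootFunction Φ (-β) = rootFunction Φ β) {P Q : ℂ[X]} {ε : ℂ}
    (hε : ε * ε = 1) (hP : ∀ z, P.eval (-z) = ε * P.eval z)
    (hQ : ∀ z, Q.eval (-z) = ε * Q.eval z) : plusForm Φ s P Q = plusForm Φ s Q P := by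
  have hmul : ∀ a b, rootWeight Φ s P (-a) * rootWeight Φ s Q (-b) =
      rootWeight Φ s Q b * rootWeight Φ s P a := fun a b => by
    rw [rootWeight_neg hsymm hP, rootWeight_neg hsymm hQ]
    linear_combination rootWeight Φ s P a * rootWeight Φ s Q b * hε
  rw [plusForm, plusForm]
  congr 1
  · have h := ((Measure.measurePreserving_neg (volume : Measure (ℝ × ℝ))).comp
      measurePreserving_swap).setIntegral_preimage_emb
      ((MeasurableEquiv.neg _).measurableEmbedding.comp measurableEmbedding_swap)
      (fun p : ℝ × ℝ => rootWeight Φ s P p.1 * rootWeight Φ s Q p.2) {p : ℝ × ℝ | p.1 < p.2}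
    rw [← h]
    simp [hmul, Set.preimage]
  · congr 1
    have h := ((Measure.measurePreserving_neg (volume : Measure ℂ)).comp
      measurePreserving_conj).setIntegral_preimage_emb
      ((MeasurableEquiv.neg _).measurableEmbedding.comp measurableEmbedding_conj)
      (fun β : ℂ => rootWeight Φ s P (starRingEnd ℂ β) * rootWeight Φ s Q β) {β : ℂ | 0 < β.im}
    rw [← h]
    simp [hmul, Set.preimage]

theorem integral_rootWeight_eq_zero (hsymm : ∀ β, rootFunction Φ (-β) = rootFunction Φ β)
    {P : ℂ[X]} (hP : ∀ z, P.eval (-z) = -P.eval z) : ∫ x : ℝ, rootWeight Φ s P x = 0 := by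
  have h := integral_neg_eq_self (fun x : ℝ => rootWeight Φ s P x) volume
  have h1 : ∀ x : ℝ, rootWeight Φ s P (-x : ℝ) = -rootWeight Φ s P x := fun x => by
    rw [Complex.ofReal_neg, rootWeight_neg (ε := -1) hsymm (by simpa using hP)]
    ring
  simp only [h1, integral_neg] at h
  exact self_eq_neg.1 h.symm

/-- A functional equation `P(-x) = εP(x)` on the real line extends to the complex plane. -/
theorem eval_map_neg_of_real {P : ℝ[X]} {ε : ℝ} (h : ∀ x, P.eval (-x) = ε * P.eval x) (z : ℂ) :
    (P.map (algebraMap ℝ ℂ)).eval (-z) = ε * (P.map (algebraMap ℝ ℂ)).eval z := by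
  have h1 : P.comp (-X) = C ε * P := Polynomial.funext fun x => by simp [h]
  have h2 := congrArg (fun f => (f.map (algebraMap ℝ ℂ)).eval z) h1
  simpa [Polynomial.map_comp] using h2

end Forms

/-! ### The moment function as a determinant -/

section Determinant

open Polynomial

variable {Φ : ℂ[X] → ℝ} {s : ℂ}

/-- Every `p j` has degree at most `N - 1`, where `N = M + 2J`, so `Re s > N` supplies all the
integrability needed. -/
theorem momentFunction_expansion (hΦ : IsMultiplicativeDistance Φ) {M J : ℕ} (hM : M ≤ 1)
    (hs : ((M + 2 * J : ℕ) : ℝ) < s.re) {p : Fin (M + 2 * J) → ℂ[X]}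
    (hmonic : ∀ j, (p j).Monic) (hdeg : ∀ j, (p j).natDegree = j) :
    (J.factorial : ℂ) * momentFunction Φ (M + 2 * J) s =
      ∑ σ : Equiv.Perm (Fin (M + 2 * J)), (Equiv.Perm.sign σ : ℂ) *
        ((∏ i, plusForm Φ s (p (σ (fstIdx M i))) (p (σ (sndIdx M i)))) *
          ∏ c, ∫ x : ℝ, rootWeight Φ s (p (σ (lastIdx J c))) x) := by
  have hnd : ∀ j, ((p j).natDegree : ℝ) + 1 < s.re := fun j => by
    rw [hdeg]
    refine lt_of_le_of_lt ?_ hs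
    exact_mod_cast j.2
  have hB := fun j k => integral_pairDensity hΦ (hnd j) (hnd k)
  rw [momentFunction_eq hΦ, factorial_mul_integral_eq_sum hM (weight hΦ s) (add_comm _ _)
    (continuous_weight_monicPoly hΦ s _).measurable (integrable_weight_monicPoly hΦ hs) p hmonic
    hdeg (fun j k => (hB j k).1) fun j => ?_]
  · simp only [weight_X_sub_C, fun j k => (hB j k).2]
  · simp only [weight_X_sub_C]
    exact integrable_rootWeight_ofReal hΦ (hnd j)

theorem eval_neg_of_parity {N : ℕ} {P : Fin N → ℝ[X]}
    (heven : ∀ n : Fin N, Even (n : ℕ) → Function.Even fun x : ℝ => (P n).eval x)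
    (hodd : ∀ n : Fin N, Odd (n : ℕ) → Function.Odd fun x : ℝ => (P n).eval x) (n : Fin N) (z : ℂ) :
    ((P n).map (algebraMap ℝ ℂ)).eval (-z) =
      (-1) ^ (n : ℕ) * ((P n).map (algebraMap ℝ ℂ)).eval z := by
  have h := eval_map_neg_of_real (P := P n) (ε := (-1) ^ (n : ℕ)) (fun x => ?_) z
  · simpa using h
  · rcases Nat.even_or_odd (n : ℕ) with h | h
    · rw [h.neg_one_pow, one_mul]
      exact heven n h x
    · rw [h.neg_one_pow, neg_one_mul]
      exact hodd n h x

theorem momentFunction_eq_det (hΦ : IsMultiplicativeDistance Φ)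
    (hsymm : ∀ β, rootFunction Φ (-β) = rootFunction Φ β) {N : ℕ} (hs : (N : ℝ) < s.re)
    {p : Fin N → ℂ[X]} (hmonic : ∀ j, (p j).Monic) (hdeg : ∀ j, (p j).natDegree = j)
    (hpar : ∀ j z, (p j).eval (-z) = (-1) ^ (j : ℕ) * (p j).eval z) :
    momentFunction Φ N s = (matrixA Φ s p).det := by
  have hnd : ∀ j, ((p j).natDegree : ℝ) + 1 < s.re := fun j => by
    rw [hdeg]
    refine lt_of_le_of_lt ?_ hs
    exact_mod_cast j.2
  have hcomm : ∀ j k : Fin N, (j : ℕ) % 2 = k % 2 →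
      plusForm Φ s (p j) (p k) = plusForm Φ s (p k) (p j) := fun j k h => by
    refine plusForm_comm hsymm (ε := (-1) ^ (j : ℕ)) ?_ (hpar j) fun z => ?_
    · rw [← mul_pow]; simp
    · rw [hpar, neg_one_pow_eq_pow_mod_two, ← h, ← neg_one_pow_eq_pow_mod_two]
  obtain ⟨J, rfl | rfl⟩ : ∃ J, N = 0 + 2 * J ∨ N = 1 + 2 * J := ⟨N / 2, by omega⟩
  · have hJ : J = (0 + 2 * J + 1) / 2 := by omega
    have h := momentFunction_expansion hΦ zero_le_one hs hmonic hdeg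
    simp only [Finset.univ_eq_empty, Finset.prod_empty, mul_one] at h
    rw [sum_perm_pairs_even (fun j k => plusForm Φ s (p j) (p k)) hcomm] at h
    rw [mul_left_cancel₀ (Nat.cast_ne_zero.2 J.factorial_ne_zero) h,
      ← Matrix.det_submatrix_equiv_self (finCongr hJ)]
    congr 1
    ext r i
    have hr := r.2
    have hi := i.2
    simp only [Matrix.of_apply, Matrix.submatrix_apply, matrixA, matrixU, finCongr_apply,
      Fin.val_cast]
    rw [dif_pos ⟨by omega, by omega⟩, skewForm_eq hΦ (hnd _) (hnd _)]
    rfl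
  · have hJ : J + 1 = (1 + 2 * J + 1) / 2 := by omega
    have h := momentFunction_expansion hΦ le_rfl hs hmonic hdeg
    simp only [Fin.prod_univ_one] at h
    rw [sum_perm_pairs_odd (fun j k => plusForm Φ s (p j) (p k))
      (fun j => ∫ x : ℝ, rootWeight Φ s (p j) x) hcomm fun j hj =>
        integral_rootWeight_eq_zero hsymm fun z => ?_] at h
    swap
    · rw [hpar, (Nat.odd_iff.2 hj).neg_one_pow, neg_one_mul]
    rw [mul_left_cancel₀ (Nat.cast_ne_zero.2 J.factorial_ne_zero) h,
      ← Matrix.det_submatrix_equiv_self (finCongr hJ)]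
    congr 1
    ext r i
    have hr := r.2
    have hi := i.2
    simp only [Matrix.of_apply, Matrix.submatrix_apply, matrixA, matrixU, finCongr_apply,
      Fin.val_cast]
    by_cases hiJ : (i : ℕ) < J
    · rw [dif_pos hiJ, dif_pos ⟨by omega, by omega⟩, skewForm_eq hΦ (hnd _) (hnd _)]
    -- In the last column `i = J`, so `2i + 1 = N` is the extra index of `matrixU`. Every row index
    -- `2r` is smaller, hence the sign is `+1` and the entry is the line integral of `p` at `2r`.
    · have hmin : min (2 * (r : ℕ)) (2 * i + 1) = 2 * r := by omega
      have hlt : (0 : ℝ) < ((2 * (i : ℕ) + 1 : ℕ) : ℝ) - ((2 * (r : ℕ) : ℕ) : ℝ) := by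
        rw [sub_pos, Nat.cast_lt]
        omega
      rw [dif_neg hiJ, dif_neg (by omega), dif_pos (by omega), Real.sign_of_pos hlt,
        Complex.ofReal_one, one_mul]
      simp only [hmin]
      rfl

end Determinant

end MultDist

theorem corollary3 (Φ : Polynomial ℂ → ℝ) (hΦ : MultDist.IsMultiplicativeDistance Φ)
    (hsymm : ∀ β : ℂ, MultDist.rootFunction Φ (-β) = MultDist.rootFunction Φ β)
    (N : ℕ) (s : ℂ) (hs : (N : ℝ) < s.re)
    (P : Fin N → Polynomial ℝ)
    (hmonic : ∀ n, (P n).Monic)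
    (hdeg : ∀ n, (P n).natDegree = (n : ℕ))
    (heven : ∀ n : Fin N, Even (n : ℕ) → Function.Even fun x : ℝ => (P n).eval x)
    (hodd : ∀ n : Fin N, Odd (n : ℕ) → Function.Odd fun x : ℝ => (P n).eval x) :
    -- the integrals defining `F_N` and the entries of `U_P` converge absolutely
    MeasureTheory.Integrable (MultDist.momentIntegrand Φ N s) ∧
    (∀ j k : Fin N,
      MeasureTheory.Integrable (MultDist.realIntegrand Φ s
        ((P j).map (algebraMap ℝ ℂ)) ((P k).map (algebraMap ℝ ℂ))) ∧
      MeasureTheory.Integrable (MultDist.complexIntegrand Φ s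
        ((P j).map (algebraMap ℝ ℂ)) ((P k).map (algebraMap ℝ ℂ)))) ∧
    (∀ j : Fin N,
      MeasureTheory.Integrable (MultDist.lineIntegrand Φ s ((P j).map (algebraMap ℝ ℂ)))) ∧
    MultDist.momentFunction Φ N s =
      (MultDist.matrixA Φ s fun n => (P n).map (algebraMap ℝ ℂ)).det := by
  have hd : ∀ n, ((P n).map (algebraMap ℝ ℂ)).natDegree = n := fun n => by
    rw [Polynomial.natDegree_map, hdeg]
  have hnd : ∀ n, (((P n).map (algebraMap ℝ ℂ)).natDegree : ℝ) + 1 < s.re := fun n => by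
    rw [hd]
    refine lt_of_le_of_lt ?_ hs
    exact_mod_cast n.2
  exact ⟨MultDist.integrable_momentIntegrand hΦ hs,
    fun j k => ⟨MultDist.integrable_realIntegrand hΦ (hnd j) (hnd k),
      MultDist.integrable_complexIntegrand hΦ (hnd j) (hnd k)⟩,
    fun j => MultDist.integrable_rootWeight_ofReal hΦ (hnd j),
    MultDist.momentFunction_eq_det hΦ hsymm hs (fun n => (hmonic n).map _) hd
      (MultDist.eval_neg_of_parity heven hodd)⟩
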